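/- Let $\Omega=[0,1]$, $1<p<\infty$, $T>0$, $\Psi(r)=|r|^{p-2}r$ (with $\Psi(0)=0$), and let $K:\Omega^2\to[0,\infty)$ be measurable and symmetric with $\|K\|_{L^{\infty,2}(\Omega^2)}<\infty$, where $\|F\|_{L^{\infty,2}(\Omega^2)}=\operatorname{ess\,sup}_{x\in\Omega}\|F(x,\cdot)\|_{L^2(\Omega)}$. Put $\Delta_p^Ku(x)=-\int_\Omega K(x,y)\Psi(u(y)-u(x))\,dy$, an operator in $L^1(\Omega)$ whose domain consists of the $u\in L^1(\Omega)$ for which $K(x,y)\Psi(u(y)-u(x))$ is integrable on $\Omega^2$. Let $g:\Omega\to\mathbb R$ and let $f:\Omega\times[0,T]\to\mathbb R$ be measurable with $f\in BV([0,T];L^2(\Omega))$. A solution of the continuum problem is a function $u\in C([0,T];L^1(\Omega))\cap W^{1,1}(]0,T[;L^1(\Omega))$ with $u(\cdot,0)=g$ a.e. such that, for a.e. $t\in\,]0,T[$, $u(\cdot,t)$ lies in the domain of $\Delta_p^K$ and $\partial_tu=-\Delta_p^Ku+f$ a.e. in $\Omega$. Consider the hypotheses (a) $p<2$, $g\in L^2(\Omega)$,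 $f\in L^1([0,T];L^2(\Omega))$; (b) $p\ge2$, $g\in L^{2(p-1)}(\Omega)$, $f\in L^1([0,T];L^{2(p-1)}(\Omega))$; (c) $g\in L^\infty(\Omega)$, $f\in L^1([0,T];L^\infty(\Omega))$. *Discretization.* For $n\ge1$ and $i\in[n]$ let $\Omega_i=\,](i-1)/n,i/n]$, let $P_n$ map a function on $\Omega$ (or on $\Omega^2$) to the vector (matrix) of its averages over the cells $\Omega_i$ (or $\Omega_i\times\Omega_j$), and let $I_n$ map a vector (matrix) to the corresponding piecewise constant function. Let $\rho_n>0$, $\rho_n\to0$ and $n\rho_n=\omega((\log n)^\gamma)$ for some $\gamma>1$. The random graph $G(n,K,\rho_n)$ on $[n]$ is undirected; distinct unordered pairs $\{i,j\}$ are edges independently, $\{i,j\}$ with probability $\rho_n\min((P_nK)_{ij},\rho_n^{-1})$. (Loops are irrelevant below.) Given a partition $0=t_0<\dots<t_N=T$ with steps $\tau_k=t_k-t_{k-1}$ and $\tau=\max_k\tau_k$, let $\mathbf f^k=\tau_k^{-1}\int_{t_{k-1}}^{t_k}P_nf(\cdot,t)\,dt$, let $\bar f_n(\cdot,t)=I_n\mathbf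 f^k$ for $t\in\,]t_{k-1},t_k]$, and consider the backward Euler scheme $$\mathbf u^0=P_ng,\qquad \frac{\mathbf u^k_i-\mathbf u^{k-1}_i}{\tau_k}=\frac1{\rho_nn}\sum_{j:(i,j)\in E(G(n,K,\rho_n))}\Psi(\mathbf u^k_j-\mathbf u^k_i)+\mathbf f^k_i\qquad(k\in[N],\ i\in[n]).$$ Write $\mathcal E=\sup_{k\in[N],\,t\in]t_{k-1},t_k]}\|I_n\mathbf u^k-u(\cdot,t)\|_{L^2(\Omega)}$. **Theorem.** 1. Assume (a), (b) or (c). There are constants $C>0$, $\tau_0>0$ depending only on $p,g,f,K$ (and on $T$, as the length of the time interval on which $f$ is given) such that for every solution $u$, all $(\rho_n)$ as above, all $\beta\in\,]0,1[$, all $n\ge1$ and all partitions with $\tau\le\tau_0$, with probability at least $1-(\rho_nn)^{-(1-\beta)}$ the scheme has a unique solution and $$\mathcal E\le e^{T/2}\Big(\|I_nP_ng-g\|_{L^2(\Omega)}+\|\bar f_n-f\|_{L^1([0,T];L^2(\Omega))}+CT^{1/2}(\rho_nn)^{-\beta/2}+CT^{1/2}\big(\tau^{\alpha}+\|(K-\rho_n^{-1})_+\|_X+\|I_nP_nK-K\|_X\big)\Big),$$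 where $\alpha=\frac1{3-p}$, $X=L^{\infty,2}(\Omega^2)$ under (a); $\alpha=\frac p{2p-1}$, $X=L^{\infty,2}(\Omega^2)$ under (b); under (c), $X=L^2(\Omega^2)$ and $\alpha=\frac1{3-p}$ if $p\le2$, $\alpha=1$ if $p\ge2$. 2. Let $s\in\,]0,1]$ and assume moreover that $g\in L^\infty(\Omega)\cap\mathrm{Lip}(s,L^2(\Omega))$, $K\in\mathrm{Lip}(s,L^2(\Omega^2))$ and $f\in L^1([0,T];L^\infty(\Omega))\cap\mathrm{Lip}(s,L^2(\Omega\times[0,T]))$. Here $F\in\mathrm{Lip}(s,L^2(S))$ means that $F\in L^2(S)$ and $\sup_{h>0}h^{-s}\sup_{|z|<h}\big(\int_{x,\,x+z\in S}|F(x+z)-F(x)|^2dx\big)^{1/2}<\infty$. Then $\|(K-\rho_n^{-1})_+\|_{L^2(\Omega^2)}\to0$ as $n\to\infty$, and there are $C>0$, $\tau_0>0$ depending only on $p,g,f,K,s$ (and $T$) such that for every solution $u$, all $(\rho_n)$ as above, all $\beta\in\,]0,1[$, all $n\ge1$ and all partitions with $\tau\le\tau_0$, with probability at least $1-(\rho_nn)^{-(1-\beta)}$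 the scheme has a unique solution and $$\mathcal E\le Ce^{T/2}\Big((1+T^{1/2})n^{-s}+T^{1/2}\|(K-\rho_n^{-1})_+\|_{L^2(\Omega^2)}+T^{1/2}(\rho_nn)^{-\beta/2}+T^{1/2}\tau^{\alpha}\Big),$$ where $\alpha=\min(s,\frac1{3-p})$ if $p\le2$ and $\alpha=s$ if $p\ge2$. If $f$ is time-independent, the same holds with $\alpha=\frac1{3-p}$ if $p\le2$ and $\alpha=1$ if $p\ge2$. -/

import Mathlib

open MeasureTheory ProbabilityTheory Filter Topology Asymptotics
open scoped ENNReal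

namespace PLap

noncomputable section

/-- Lebesgue measure on the spatial domain `[0,1]`. -/
abbrev leb : Measure ℝ := volume.restrict (Set.Icc 0 1)

/-- `Ψ(r) = |r|^{p-2} r` (so `Ψ(0) = 0`). -/
def Psi (p r : ℝ) : ℝ := |r| ^ (p - 2) * r

/-! ### Norms and function spaces -/

/-- The mixed norm `‖F‖_{L^{∞,q}([0,1]²)}`, the (essential) supremum over `x` of
`‖F(x,·)‖_{L^q([0,1])}`. -/
def normLinf (q : ℝ≥0∞) (F : ℝ → ℝ → ℝ) : ℝ≥0∞ := essSup (fun x => eLpNorm (F x) q leb) leb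

/-- The norm of `L²([0,1]²)`. -/
def normL2sq (F : ℝ → ℝ → ℝ) : ℝ≥0∞ := eLpNorm (fun z : ℝ × ℝ => F z.1 z.2) 2 (leb.prod leb)

/-- The norm of `L¹([0,T]; L^q([0,1]))`; time is the first argument of `f`. -/
def normL1t (T : ℝ) (q : ℝ≥0∞) (f : ℝ → ℝ → ℝ) : ℝ≥0∞ :=
  ∫⁻ t in Set.Icc 0 T, eLpNorm (f t) q leb

/-- Membership in `L¹([0,T]; L^q([0,1]))`. -/
def MemL1t (T : ℝ) (q : ℝ≥0∞) (f : ℝ → ℝ → ℝ) : Prop :=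
  Measurable (fun z : ℝ × ℝ => f z.1 z.2) ∧ normL1t T q f < ∞

/-- The total variation of `t ↦ f(·,t) ∈ L^q([0,1])` on `[0,T]`. -/
def timeVar (T : ℝ) (q : ℝ≥0∞) (f : ℝ → ℝ → ℝ) : ℝ≥0∞ :=
  ⨆ (N : ℕ) (t : {t : ℕ → ℝ // Monotone t ∧ ∀ i, t i ∈ Set.Icc 0 T}),
    ∑ i ∈ Finset.range N, eLpNorm (fun x => f (t.1 (i + 1)) x - f (t.1 i) x) q leb

/-- Membership in `BV([0,T]; L^q([0,1]))`. -/
def MemBV (T : ℝ) (q : ℝ≥0∞) (f : ℝ → ℝ → ℝ) : Prop :=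
  Measurable (fun z : ℝ × ℝ => f z.1 z.2) ∧ MemLp (f 0) q leb ∧ timeVar T q f < ∞

/-- The first-order `L^q(S)` modulus of smoothness `ω(F,h)_q`. -/
def modulus {E : Type*} [NormedAddCommGroup E] [MeasureSpace E]
    (S : Set E) (q : ℝ≥0∞) (F : E → ℝ) (h : ℝ) : ℝ≥0∞ :=
  ⨆ (z : E) (_ : ‖z‖ < h),
    eLpNorm (fun x => F (x + z) - F x) q (volume.restrict {x | x ∈ S ∧ x + z ∈ S})

/-- Membership in the Lipschitz space `Lip(s, L^q(S))`.  (On `ℝ × ℝ` the norm on increments is the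
maximum norm; it defines the same space as the Euclidean one.) -/
def MemLip {E : Type*} [NormedAddCommGroup E] [MeasureSpace E]
    (S : Set E) (s : ℝ) (q : ℝ≥0∞) (F : E → ℝ) : Prop :=
  MemLp F q (volume.restrict S) ∧
    (⨆ (h : ℝ) (_ : 0 < h), ENNReal.ofReal (h ^ (-s)) * modulus S q F h) < ∞

/-! ### Kernels, the nonlocal operator and the continuum problem -/

/-- A nonnegative symmetric measurable kernel in `L^{∞,2}([0,1]²)`. -/
structure IsKernel (K : ℝ → ℝ → ℝ) : Prop where
  measurable : Measurable (fun z : ℝ × ℝ => K z.1 z.2)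
  nonneg : ∀ x ∈ Set.Icc (0 : ℝ) 1, ∀ y ∈ Set.Icc (0 : ℝ) 1, 0 ≤ K x y
  symm : ∀ x ∈ Set.Icc (0 : ℝ) 1, ∀ y ∈ Set.Icc (0 : ℝ) 1, K x y = K y x
  bounded : normLinf 2 K < ∞

/-- The nonlocal `p`-Laplacian `-∫ K(x,y) |u(y)-u(x)|^{p-2} (u(y)-u(x)) dy`. -/
def pLap (p : ℝ) (K : ℝ → ℝ → ℝ) (u : ℝ → ℝ) (x : ℝ) : ℝ :=
  -∫ y, K x y * Psi p (u y - u x) ∂leb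

/-- The domain of `pLap` as an operator in `L¹([0,1])`: the defining double integral converges. -/
def InDom (p : ℝ) (K : ℝ → ℝ → ℝ) (u : ℝ → ℝ) : Prop :=
  Integrable u leb ∧
    Integrable (fun z : ℝ × ℝ => K z.1 z.2 * Psi p (u z.2 - u z.1)) (leb.prod leb)

/-- Solutions of the continuum evolution problem on `[0,T]`:
`u ∈ C([0,T]; L¹) ∩ W^{1,1}(]0,T[; L¹)` with time derivative `v`, `u(0) = g`, and
`∂ₜ u = -pLap u + f` almost everywhere. -/
def IsSolution (p T : ℝ) (K : ℝ → ℝ → ℝ) (g : ℝ → ℝ) (f : ℝ → ℝ → ℝ)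
    (u : ℝ → Lp ℝ 1 leb) : Prop :=
  ContinuousOn u (Set.Icc 0 T) ∧ (u 0 : ℝ → ℝ) =ᵐ[leb] g ∧
    ∃ v : ℝ → Lp ℝ 1 leb, IntegrableOn v (Set.Ioo 0 T) ∧
      (∀ t ∈ Set.Icc 0 T, u t = u 0 + ∫ r in (0 : ℝ)..t, v r) ∧
      ∀ᵐ t ∂(volume.restrict (Set.Ioo 0 T)),
        InDom p K (u t) ∧ (v t : ℝ → ℝ) =ᵐ[leb] fun x => -pLap p K (u t) x + f t x

/-! ### Space discretization -/

/-- The `i`-th cell `]i/n, (i+1)/n]`, `i = 0, …, n-1`. -/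
def cell (n : ℕ) (i : Fin n) : Set ℝ := Set.Ioc ((i : ℝ) / n) (((i : ℝ) + 1) / n)

/-- The projector `P_n`: cell averages. -/
def proj (n : ℕ) (u : ℝ → ℝ) (i : Fin n) : ℝ := (n : ℝ) * ∫ x in cell n i, u x

/-- The projector `P_n` for kernels. -/
def projK (n : ℕ) (K : ℝ → ℝ → ℝ) (i j : Fin n) : ℝ :=
  (n : ℝ) ^ 2 * ∫ z in cell n i ×ˢ cell n j, K z.1 z.2

/-- The injector `I_n`: piecewise constant extension. -/
def inj (n : ℕ) (v : Fin n → ℝ) (x : ℝ) : ℝ := ∑ i, (cell n i).indicator (fun _ => v i) x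

/-- The injector `I_n` for matrices. -/
def injK (n : ℕ) (A : Fin n → Fin n → ℝ) (x y : ℝ) : ℝ :=
  ∑ i, ∑ j, (cell n i ×ˢ cell n j).indicator (fun _ => A i j) (x, y)

/-- `I_n P_n K - K`. -/
def kernelErr (n : ℕ) (K : ℝ → ℝ → ℝ) (x y : ℝ) : ℝ := injK n (projK n K) x y - K x y

/-- `(K - ρ⁻¹)_+`. -/
def kernelExcess (ρ : ℝ) (K : ℝ → ℝ → ℝ) (x y : ℝ) : ℝ := max (K x y - ρ⁻¹) 0

/-! ### The sparse random graph -/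

/-- `G` is a random graph of type `G(n,K,ρ)` with weight matrix `P_n K`: `G ω i j` says that
`{i,j}` is an edge; distinct unordered pairs are edges independently, `{i,j}` with probability
`ρ min((P_n K)_{ij}, ρ⁻¹)`.  Nothing is required of loops (they do not enter the scheme, as
`Ψ(0) = 0`). -/
structure IsRandomGraph {Ω : Type*} [MeasurableSpace Ω] (P : Measure Ω)
    (n : ℕ) (K : ℝ → ℝ → ℝ) (ρ : ℝ) (G : Ω → Fin n → Fin n → Prop) : Prop where
  symm : ∀ ω i j, G ω i j → G ω j i
  measurable : ∀ i j, i < j → MeasurableSet {ω | G ω i j}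
  prob : ∀ i j, i < j → P {ω | G ω i j} = ENNReal.ofReal (ρ * min (projK n K i j) ρ⁻¹)
  indep : iIndepSet (fun e : {e : Fin n × Fin n // e.1 < e.2} => {ω | G ω e.1.1 e.1.2}) P

/-! ### Time discretization -/

/-- `0 = t_0 < t_1 < ⋯ < t_N = T`. -/
structure IsPartition (T : ℝ) {N : ℕ} (t : Fin (N + 1) → ℝ) : Prop where
  start : t 0 = 0
  final : t (Fin.last N) = T
  strictMono : StrictMono t

/-- The step `t_k - t_{k-1}`; the index `k : Fin N` here and below stands for step `k + 1`. -/
def step {N : ℕ} (t : Fin (N + 1) → ℝ) (k : Fin N) : ℝ := t k.succ - t k.castSucc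

/-- The maximal step `τ`. -/
def mesh {N : ℕ} (t : Fin (N + 1) → ℝ) : ℝ := ⨆ k : Fin N, step t k

/-- The discrete source: space projection averaged over the time step. -/
def discSource (n : ℕ) (f : ℝ → ℝ → ℝ) {N : ℕ} (t : Fin (N + 1) → ℝ) (k : Fin N) (i : Fin n) : ℝ :=
  (step t k)⁻¹ * ∫ r in t k.castSucc..t k.succ, proj n (f r) i

/-- The time-space piecewise constant extension of the discrete source. -/
def sourceExt (n : ℕ) (f : ℝ → ℝ → ℝ) {N : ℕ} (t : Fin (N + 1) → ℝ) (r x : ℝ) : ℝ :=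
  ∑ k : Fin N,
    (Set.Ioc (t k.castSucc) (t k.succ)).indicator (fun _ => inj n (discSource n f t k) x) r

open Classical in
/-- The backward Euler scheme on the graph `G`, normalised by `ρ n`, with data `P_n g` and the
discrete source of `f`. -/
def IsScheme (p : ℝ) (n : ℕ) (ρ : ℝ) (G : Fin n → Fin n → Prop) (g : ℝ → ℝ) (f : ℝ → ℝ → ℝ)
    {N : ℕ} (t : Fin (N + 1) → ℝ) (U : Fin (N + 1) → Fin n → ℝ) : Prop :=
  U 0 = proj n g ∧
    ∀ (k : Fin N) (i : Fin n),
      (U k.succ i - U k.castSucc i) / step t k =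
        1 / (ρ * n) * (∑ j with G i j, Psi p (U k.succ j - U k.succ i)) + discSource n f t k i

/-- `sup_{k ∈ [N], r ∈ ]t_{k-1}, t_k]} ‖I_n U^k - u(·,r)‖_{L²}`. -/
def schemeError (n : ℕ) {N : ℕ} (t : Fin (N + 1) → ℝ) (U : Fin (N + 1) → Fin n → ℝ)
    (u : ℝ → Lp ℝ 1 leb) : ℝ≥0∞ :=
  ⨆ (k : Fin N) (r : ℝ) (_ : r ∈ Set.Ioc (t k.castSucc) (t k.succ)),
    eLpNorm (fun x => inj n (U k.succ) x - u r x) 2 leb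

/-- The event that the scheme on the random graph has exactly one solution and that the error of
this solution is at most `B`. -/
def errorEvent {Ω : Type*} (p : ℝ) (n : ℕ) (ρ : ℝ) (G : Ω → Fin n → Fin n → Prop)
    (g : ℝ → ℝ) (f : ℝ → ℝ → ℝ) {N : ℕ} (t : Fin (N + 1) → ℝ) (u : ℝ → Lp ℝ 1 leb)
    (B : ℝ≥0∞) : Set Ω :=
  {ω | (∃! U : Fin (N + 1) → Fin n → ℝ, IsScheme p n ρ (G ω) g f t U) ∧
    ∀ U : Fin (N + 1) → Fin n → ℝ, IsScheme p n ρ (G ω) g f t U → schemeError n t U u ≤ B}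

/-! ### The three regimes of the data -/

/-- The three alternative sets of hypotheses on the data. -/
inductive Regime
  | a
  | b
  | c

/-- The hypotheses of each regime. -/
def Regime.Holds (p T : ℝ) (g : ℝ → ℝ) (f : ℝ → ℝ → ℝ) : Regime → Prop
  | .a => p < 2 ∧ MemLp g 2 leb ∧ MemL1t T 2 f
  | .b => 2 ≤ p ∧ MemLp g (ENNReal.ofReal (2 * (p - 1))) leb ∧
      MemL1t T (ENNReal.ofReal (2 * (p - 1))) f
  | .c => MemLp g ∞ leb ∧ MemL1t T ∞ f

/-- The exponent of `τ` in each regime (for `p = 2` the two values in regime `c` agree). -/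
def Regime.exponent (p : ℝ) : Regime → ℝ
  | .a => 1 / (3 - p)
  | .b => p / (2 * p - 1)
  | .c => if p ≤ 2 then 1 / (3 - p) else 1

/-- The norm in which kernels are measured in each regime. -/
def Regime.kernelNorm : Regime → (ℝ → ℝ → ℝ) → ℝ≥0∞
  | .a => normLinf 2
  | .b => normLinf 2
  | .c => normL2sq

/-- The exponent of `τ` under Lipschitz regularity of order `s` of the data. -/
def rateExponent (p s : ℝ) : ℝ := if p ≤ 2 then min s (1 / (3 - p)) else s

/-- The right-hand side of the general error bound. -/
def generalBound (R : Regime) (p T : ℝ) (K : ℝ → ℝ → ℝ) (g : ℝ → ℝ) (f : ℝ → ℝ → ℝ)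
    (C β : ℝ) (n : ℕ) (ρ : ℝ) {N : ℕ} (t : Fin (N + 1) → ℝ) : ℝ≥0∞ :=
  ENNReal.ofReal (Real.exp (T / 2)) *
    (eLpNorm (fun x => inj n (proj n g) x - g x) 2 leb
      + normL1t T 2 (fun r x => sourceExt n f t r x - f r x)
      + ENNReal.ofReal (C * T ^ (1 / 2 : ℝ) * (ρ * n) ^ (-(β / 2)))
      + ENNReal.ofReal (C * T ^ (1 / 2 : ℝ)) *
        (ENNReal.ofReal (mesh t ^ R.exponent p)
          + R.kernelNorm (kernelExcess ρ K) + R.kernelNorm (kernelErr n K)))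

/-- The right-hand side of the rate, with power `α` of `τ`. -/
def rateBound (T : ℝ) (K : ℝ → ℝ → ℝ) (C s α β : ℝ) (n : ℕ) (ρ : ℝ)
    {N : ℕ} (t : Fin (N + 1) → ℝ) : ℝ≥0∞ :=
  ENNReal.ofReal (C * Real.exp (T / 2)) *
    (ENNReal.ofReal ((1 + T ^ (1 / 2 : ℝ)) * (n : ℝ) ^ (-s))
      + ENNReal.ofReal (T ^ (1 / 2 : ℝ)) * normL2sq (kernelExcess ρ K)
      + ENNReal.ofReal (T ^ (1 / 2 : ℝ) * (ρ * n) ^ (-(β / 2)))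
      + ENNReal.ofReal (T ^ (1 / 2 : ℝ) * mesh t ^ α))

/-- The standing assumptions on the sparsity parameters: `ρ_n > 0`, `ρ_n → 0` and
`n ρ_n = ω((log n)^γ)` for some `γ > 1`. -/
structure IsSparsity (ρ : ℕ → ℝ) : Prop where
  pos : ∀ n, 1 ≤ n → 0 < ρ n
  tendsto : Tendsto ρ atTop (𝓝 0)
  growth : ∃ γ : ℝ, 1 < γ ∧ (fun n : ℕ => Real.log n ^ γ) =o[atTop] fun n : ℕ => (n : ℝ) * ρ n

end

end PLap

/-!
The scheme on the random graph is compared with the continuum solution `u` through the backward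
Euler scheme on the complete graph with the deterministic weights `avgWeight`, the cell averages of
`K` divided by `n`. All the schemes have the form `Solves`: each step is a resolvent of the
operator `-gen`, which is monotone for symmetric nonnegative weights, so that a step exists and is
unique (`resolvent_exists`, `resolvent_unique`). For the scheme on the graph this holds for every
realization; only the size of the error is random.

*Deterministic scheme against continuum.* A solution `u` is only a curve in `L¹`, so the squared
`L²` norm of the error `e` cannot be differentiated. It is replaced by `truncEnergy R e`, the
integral of a Huber function whose derivative is the truncation `clamp R`. This energy is convex and
Lipschitz on `L¹`, which suffices for a chain rule along absolutely continuous curves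
(`convex_chain_rule`). The scheme is interpolated affinely in time. The three-point inequality
`monotone_cross_le`, integrated against the kernel (`flux_le_defect`), bounds the flux term in the
derivative of the energy by the monotonicity defect `⟨A w_{k+1} - A w_k, w_{k+1} - w_k⟩` of the
step, where `A = -gen`. This bound uses no Hölder continuity of `Ψ`. The remaining terms are the
errors of the source and of the kernel in `L²`, and a Gronwall argument (`gronwall_sq_add`) gives a
bound independent of `R`; letting `R` grow yields the `L²` bound (`eLpNorm_le_of_truncEnergy_le`).
Testing the difference of two consecutive steps with the discrete time derivative makes the defects
telescope (`solves_rate`): as `f` has bounded variation, their sum, weighted with the steps, is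
`O(τ²)`. The time discretization is therefore of first order for every `p`. Since `τ ≤ τ ^ α` for
`τ ≤ 1` and `α ≤ 1`, and `e^{T/2} ≥ 1`, this is more than the bounds `generalBound` and `rateBound`
require.

*Errors in the kernel.* Replacing a kernel by one that differs from it by `D` costs at most
`consErr p D w`, where `w` is the solution of the deterministic scheme. `Regime.exists_bound`
controls it by the norm of `D` that belongs to the regime: the `L²`, `L^{2(p-1)}` and `L^∞`
stability of the scheme bounds the moment of `w` of order `2(p-1)`, or its supremum. This applies to the
averaging of `K` and to its truncation at the height `ρ⁻¹`.

*Random against deterministic scheme.* By `l2_sub_le_of_solves`, the distance of two schemes is at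
most the accumulated difference of their operators, both evaluated at the solution of the second
one. Taking the deterministic solution there, the difference is a sum of independent centered edge
variables with fixed coefficients. Its second moment is of order `1 / (ρ n)`
(`integral_sq_gen_sub_le`), and Markov's inequality gives the claimed probability
(`prob_fluctuation_ge`).

*Lipschitz data.* The distance of a function to its cell averages is bounded by an average of its
increments over translations of the length of a cell (`lintegral_sq_sub_average_le`), which gives
the rate `n^{-s}`. The variation of `f` in time bounds the time part of the error of the source by a
multiple of `τ`, so the same estimate covers sources depending on time and sources that do not.
-/

namespace PLap

/-! ### The nonlinearity `Ψ` and truncation -/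

lemma Psi_eq {p : ℝ} (hp : 1 < p) (r : ℝ) :
    Psi p r = (max r 0) ^ (p - 1) - (max (-r) 0) ^ (p - 1) := by
  have hp0 : p - 1 ≠ 0 := by linarith
  have key : ∀ x : ℝ, 0 < x → x ^ (p - 2) * x = x ^ (p - 1) := fun x hx => by
    rw [← Real.rpow_add_one hx.ne']; congr 1; ring
  unfold Psi
  rcases lt_trichotomy r 0 with h | h | h
  · rw [abs_of_neg h, max_eq_right h.le, max_eq_left (by linarith), Real.zero_rpow hp0,
      ← key _ (by linarith : 0 < -r)]
    ring
  · simp [h]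
  · rw [abs_of_pos h, max_eq_left h.le, max_eq_right (by linarith), Real.zero_rpow hp0, key _ h]
    ring

lemma Psi_zero (p : ℝ) : Psi p 0 = 0 := by simp [Psi]

lemma Psi_neg (p r : ℝ) : Psi p (-r) = -Psi p r := by simp [Psi]

lemma Psi_mono {p : ℝ} (hp : 1 < p) : Monotone (Psi p) := by
  intro a b hab
  rw [Psi_eq hp, Psi_eq hp]
  have h1 : (max a 0) ^ (p - 1) ≤ (max b 0) ^ (p - 1) :=
    Real.rpow_le_rpow (le_max_right _ _) (max_le_max hab le_rfl) (by linarith)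
  have h2 : (max (-b) 0) ^ (p - 1) ≤ (max (-a) 0) ^ (p - 1) :=
    Real.rpow_le_rpow (le_max_right _ _) (max_le_max (by linarith) le_rfl) (by linarith)
  linarith

lemma Psi_continuous {p : ℝ} (hp : 1 < p) : Continuous (Psi p) := by
  have : Psi p = fun r => (max r 0) ^ (p - 1) - (max (-r) 0) ^ (p - 1) := funext (Psi_eq hp)
  rw [this]
  exact ((continuous_id.max continuous_const).rpow_const fun _ => Or.inr (by linarith)).sub
    ((continuous_neg.max continuous_const).rpow_const fun _ => Or.inr (by linarith))

lemma abs_Psi {p : ℝ} (hp : 1 < p) (r : ℝ) : |Psi p r| = |r| ^ (p - 1) := by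
  rcases eq_or_ne r 0 with h | h
  · simp [h, Psi, Real.zero_rpow (by linarith : p - 1 ≠ 0)]
  · have := abs_pos.2 h
    rw [Psi, abs_mul, abs_of_nonneg (by positivity), ← Real.rpow_add_one this.ne']
    congr 1; ring

/-- The truncation `T_R` of a real number at height `R ≥ 0`. -/
def clamp (R x : ℝ) : ℝ := max (-R) (min x R)

lemma clamp_continuous (R : ℝ) : Continuous (clamp R) := by
  unfold clamp; fun_prop

lemma abs_clamp_le {R : ℝ} (hR : 0 ≤ R) (x : ℝ) : |clamp R x| ≤ R :=
  abs_le.2 ⟨le_max_left _ _, max_le (by linarith) (min_le_right _ _)⟩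

lemma abs_clamp_le_abs {R : ℝ} (hR : 0 ≤ R) (x : ℝ) : |clamp R x| ≤ |x| := by
  unfold clamp
  rcases abs_cases x with ⟨h, _⟩ | ⟨h, _⟩ <;> rw [h, abs_le] <;>
  rcases min_cases x R with ⟨h1, _⟩ | ⟨h1, _⟩ <;> rw [h1] <;>
  rcases max_cases (-R) (x) with ⟨h2, _⟩ | ⟨h2, _⟩ <;>
  rcases max_cases (-R) (R) with ⟨h3, _⟩ | ⟨h3, _⟩ <;> constructor <;> linarith

lemma clamp_mono (R : ℝ) : Monotone (clamp R) := fun _ _ h =>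
  max_le_max le_rfl (min_le_min h le_rfl)

lemma clamp_sub_le {R x y : ℝ} (h : x ≤ y) : clamp R y - clamp R x ≤ y - x := by
  unfold clamp
  rcases min_cases x R with ⟨h1, _⟩ | ⟨h1, _⟩ <;> rw [h1] <;>
  rcases min_cases y R with ⟨h2, _⟩ | ⟨h2, _⟩ <;> rw [h2] <;>
  rcases max_cases (-R) x with ⟨h3, _⟩ | ⟨h3, _⟩ <;>
  rcases max_cases (-R) y with ⟨h4, _⟩ | ⟨h4, _⟩ <;>
  rcases max_cases (-R) R with ⟨h5, _⟩ | ⟨h5, _⟩ <;> linarith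

/-- A three-point inequality for a monotone function.  Here `c'` lies between `a` and `c`, and `d`
lies between `0` and `c' - u`.  With `a`, `c` the new and old differences of a step of the scheme,
`c'` a difference of the affine interpolant and `u` one of the continuum solution, it says that the
flux error caused by evaluating `Ψ` at the new time is controlled by the new and old values
alone. -/
lemma monotone_cross_le {ψ : ℝ → ℝ} (hψ : Monotone ψ) {a c c' u d : ℝ}
    (h1 : min a c ≤ c') (h2 : c' ≤ max a c)
    (h3 : min 0 (c' - u) ≤ d) (h4 : d ≤ max 0 (c' - u)) :
    (ψ u - ψ a) * d ≤ (ψ a - ψ c) * (a - c) := by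
  have hpos : 0 ≤ (ψ a - ψ c) * (a - c) := by
    rcases le_total a c with h | h
    · have := hψ h; nlinarith
    · have := hψ h; nlinarith
  rcases le_total c' u with hu | hu
  · rw [min_eq_right (by linarith)] at h3
    rw [max_eq_left (by linarith)] at h4
    rcases le_total a u with hau | hau
    · have := hψ hau; nlinarith
    · rcases le_total a c with h | h
      · rw [min_eq_left h] at h1
        have hua : u = a := by linarith
        subst hua; simpa using hpos
      have hc : c ≤ c' := by rwa [min_eq_right h] at h1
      have e1 := hψ hau
      have e2 := hψ (hc.trans hu)
      calc (ψ u - ψ a) * d = (ψ a - ψ u) * (-d) := by ring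
        _ ≤ (ψ a - ψ c) * (a - c) := mul_le_mul (by linarith) (by linarith) (by linarith)
          (by linarith)
  · rw [min_eq_left (by linarith)] at h3
    rw [max_eq_right (by linarith)] at h4
    rcases le_total u a with hau | hau
    · have := hψ hau; nlinarith
    · rcases le_total c a with h | h
      · rw [max_eq_left h] at h2
        have hua : u = a := by linarith
        subst hua; simpa using hpos
      have hc : c' ≤ c := by rwa [max_eq_right h] at h2
      have e1 := hψ hau
      have e2 := hψ (hu.trans hc)
      calc (ψ u - ψ a) * d ≤ (ψ c - ψ a) * (c - a) := mul_le_mul (by linarith) (by linarith)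
            (by linarith) (by linarith)
        _ = (ψ a - ψ c) * (a - c) := by ring

/-! ### Nonlinear diffusion on a finite weighted graph -/

variable {n : ℕ}

/-- The `p`-Laplacian (with the sign of a generator) of a finite weighted graph. -/
noncomputable def gen (p : ℝ) (W : Fin n → Fin n → ℝ) (w : Fin n → ℝ) (i : Fin n) : ℝ :=
  ∑ j, W i j * Psi p (w j - w i)

lemma sum_gen_mul {p : ℝ} {W : Fin n → Fin n → ℝ} (hW : ∀ i j, W i j = W j i)
    (w φ : Fin n → ℝ) :
    ∑ i, gen p W w i * φ i = -(1 / 2) * ∑ i, ∑ j, W i j * (Psi p (w j - w i) * (φ j - φ i)) := by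
  have h1 : ∑ i, gen p W w i * φ i = ∑ i, ∑ j, W i j * Psi p (w j - w i) * φ i := by
    simp only [gen, Finset.sum_mul]
  have h2 : ∑ i, ∑ j, W i j * Psi p (w j - w i) * φ i
      = -∑ i, ∑ j, W i j * Psi p (w j - w i) * φ j := by
    rw [Finset.sum_comm, ← Finset.sum_neg_distrib]
    refine Finset.sum_congr rfl fun i _ => ?_
    rw [← Finset.sum_neg_distrib]
    refine Finset.sum_congr rfl fun j _ => ?_
    rw [hW, ← neg_sub (w j) (w i), Psi_neg]; ring
  have h3 : ∑ i, ∑ j, W i j * (Psi p (w j - w i) * (φ j - φ i))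
      = ∑ i, ∑ j, W i j * Psi p (w j - w i) * φ j - ∑ i, ∑ j, W i j * Psi p (w j - w i) * φ i := by
    rw [← Finset.sum_sub_distrib]
    refine Finset.sum_congr rfl fun i _ => ?_
    rw [← Finset.sum_sub_distrib]
    exact Finset.sum_congr rfl fun j _ => by ring
  rw [h1, h3]; linarith

/-- Complete accretivity, tested with an increasing function of the unknown. -/
lemma sum_gen_mul_mono_nonpos {p : ℝ} (hp : 1 < p) {W : Fin n → Fin n → ℝ}
    (hW : ∀ i j, W i j = W j i) (hW0 : ∀ i j, 0 ≤ W i j) (w : Fin n → ℝ) {φ : ℝ → ℝ}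
    (hφ : Monotone φ) : ∑ i, gen p W w i * φ (w i) ≤ 0 := by
  rw [sum_gen_mul hW w (fun i => φ (w i))]
  have : 0 ≤ ∑ i, ∑ j, W i j * (Psi p (w j - w i) * (φ (w j) - φ (w i))) := by
    refine Finset.sum_nonneg fun i _ => Finset.sum_nonneg fun j _ => mul_nonneg (hW0 i j) ?_
    rcases le_total (w i) (w j) with h | h
    · have := hφ h
      have h2 := Psi_mono hp (sub_nonneg.2 h)
      rw [Psi_zero] at h2
      exact mul_nonneg h2 (by linarith)
    · have := hφ h
      have h2 := Psi_mono hp (sub_nonpos.2 h)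
      rw [Psi_zero] at h2
      exact mul_nonneg_of_nonpos_of_nonpos h2 (by linarith)
  linarith

/-- Symmetrization of the monotonicity pairing of `gen`. -/
lemma sum_gen_sub_mul {p : ℝ} {W : Fin n → Fin n → ℝ} (hW : ∀ i j, W i j = W j i)
    (w w' : Fin n → ℝ) :
    ∑ i, (gen p W w i - gen p W w' i) * (w i - w' i) = -(1 / 2) * ∑ i, ∑ j, W i j *
      ((Psi p (w j - w i) - Psi p (w' j - w' i)) * ((w j - w i) - (w' j - w' i))) := by
  have h1 := sum_gen_mul (p := p) hW w (fun i => w i - w' i)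
  have h2 := sum_gen_mul (p := p) hW w' (fun i => w i - w' i)
  simp only [sub_mul, Finset.sum_sub_distrib] at *
  rw [h1, h2, ← mul_sub, ← Finset.sum_sub_distrib]
  congr 1
  refine Finset.sum_congr rfl fun i _ => ?_
  rw [← Finset.sum_sub_distrib]
  exact Finset.sum_congr rfl fun j _ => by ring

lemma sum_gen_sub_mul_nonpos {p : ℝ} (hp : 1 < p) {W : Fin n → Fin n → ℝ}
    (hW : ∀ i j, W i j = W j i) (hW0 : ∀ i j, 0 ≤ W i j) (w w' : Fin n → ℝ) :
    ∑ i, (gen p W w i - gen p W w' i) * (w i - w' i) ≤ 0 := by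
  rw [sum_gen_sub_mul hW]
  have : 0 ≤ ∑ i, ∑ j, W i j *
      ((Psi p (w j - w i) - Psi p (w' j - w' i)) * ((w j - w i) - (w' j - w' i))) := by
    refine Finset.sum_nonneg fun i _ => Finset.sum_nonneg fun j _ => mul_nonneg (hW0 i j) ?_
    rcases le_total (w j - w i) (w' j - w' i) with h | h
    · have := Psi_mono hp h
      exact mul_nonneg_of_nonpos_of_nonpos (by linarith) (by linarith)
    · have := Psi_mono hp h
      exact mul_nonneg (by linarith) (by linarith)
  linarith

lemma resolvent_unique {p : ℝ} (hp : 1 < p) {W : Fin n → Fin n → ℝ}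
    (hW : ∀ i j, W i j = W j i) (hW0 : ∀ i j, 0 ≤ W i j) {τ : ℝ} (hτ : 0 ≤ τ)
    {h w w' : Fin n → ℝ} (hw : ∀ i, w i = h i + τ * gen p W w i)
    (hw' : ∀ i, w' i = h i + τ * gen p W w' i) : w = w' := by
  have h1 := sum_gen_sub_mul_nonpos hp hW hW0 w w'
  have h2 : ∑ i, (w i - w' i) ^ 2 = τ * ∑ i, (gen p W w i - gen p W w' i) * (w i - w' i) := by
    rw [Finset.mul_sum]
    refine Finset.sum_congr rfl fun i _ => ?_
    have : w i - w' i = τ * (gen p W w i - gen p W w' i) := by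
      linear_combination hw i - hw' i
    rw [sq]; nth_rw 1 [this]; ring
  have h3 : ∑ i, (w i - w' i) ^ 2 = 0 :=
    le_antisymm (by rw [h2]; exact mul_nonpos_of_nonneg_of_nonpos hτ h1)
      (Finset.sum_nonneg fun i _ => sq_nonneg _)
  rw [Finset.sum_eq_zero_iff_of_nonneg fun i _ => sq_nonneg _] at h3
  funext i
  have := h3 i (Finset.mem_univ i)
  have := pow_eq_zero_iff (two_ne_zero) |>.1 this
  linarith

/-- The resolvent equation is the Euler–Lagrange equation of a coercive energy, which has a
minimizer. -/
lemma resolvent_exists {p : ℝ} (hp : 1 < p) {W : Fin n → Fin n → ℝ}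
    (hW : ∀ i j, W i j = W j i) (hW0 : ∀ i j, 0 ≤ W i j) {τ : ℝ} (hτ : 0 ≤ τ) (h : Fin n → ℝ) :
    ∃ w : Fin n → ℝ, ∀ i, w i = h i + τ * gen p W w i := by
  let J : (Fin n → ℝ) → ℝ := fun w => 1 / 2 * ∑ i, (w i - h i) ^ 2 +
    τ / (2 * p) * ∑ i, ∑ j, W i j * |w j - w i| ^ p
  have hJc : Continuous J := by
    refine (continuous_const.mul (by fun_prop)).add (continuous_const.mul ?_)
    refine continuous_finsetSum _ fun i _ => continuous_finsetSum _ fun j _ =>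
      continuous_const.mul (Continuous.rpow_const (by fun_prop) fun _ => Or.inr (by linarith))
  have hJlow : ∀ w i, 1 / 2 * (w i - h i) ^ 2 ≤ J w := by
    intro w i
    have e1 : (w i - h i) ^ 2 ≤ ∑ i, (w i - h i) ^ 2 :=
      Finset.single_le_sum (f := fun i => (w i - h i) ^ 2) (fun i _ => sq_nonneg _)
        (Finset.mem_univ i)
    have e2 : 0 ≤ τ / (2 * p) * ∑ i, ∑ j, W i j * |w j - w i| ^ p :=
      mul_nonneg (by positivity) (Finset.sum_nonneg fun i _ => Finset.sum_nonneg fun j _ =>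
        mul_nonneg (hW0 i j) (by positivity))
    simp only [J]; linarith
  have hex : ∃ w, ∀ v, J w ≤ J v := by
    refine hJc.exists_forall_le' h ?_
    have hev : ∀ᶠ w in cocompact (Fin n → ℝ), 2 * (J h + 1) < ‖w - h‖ := by
      have : Tendsto (fun w : Fin n → ℝ => ‖w - h‖) (cocompact _) atTop := by
        have := tendsto_norm_cocompact_atTop (E := Fin n → ℝ)
        exact (tendsto_norm_cocompact_atTop).comp
          ((Homeomorph.subRight h).isClosedEmbedding.tendsto_cocompact)
      exact this.eventually_gt_atTop _
    have hJ0 : 0 ≤ J h := by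
      simp only [J, sub_self]
      have : 0 ≤ τ / (2 * p) * ∑ i, ∑ j, W i j * |h j - h i| ^ p :=
        mul_nonneg (by positivity) (Finset.sum_nonneg fun i _ => Finset.sum_nonneg fun j _ =>
          mul_nonneg (hW0 i j) (by positivity))
      simpa using this
    filter_upwards [hev] with w hw
    by_contra! hlt
    have : ‖w - h‖ ≤ 2 * (J h + 1) := by
      refine (pi_norm_le_iff_of_nonneg (by linarith)).2 fun i => ?_
      rw [Real.norm_eq_abs, Pi.sub_apply]
      refine abs_le_of_sq_le_sq ?_ (by linarith)
      have := hJlow w i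
      nlinarith
    linarith
  obtain ⟨w, hw⟩ := hex
  refine ⟨w, fun i => ?_⟩
  -- the derivative of `J` at `w` in the direction `e_i`
  let v : Fin n → ℝ := Pi.single i 1
  have hpt : ∀ k l : Fin n, HasDerivAt
      (fun s : ℝ => |(w + s • v) l - (w + s • v) k| ^ p)
      (p * Psi p (w l - w k) * (v l - v k)) 0 := by
    intro k l
    have h1 : HasDerivAt (fun s : ℝ => (w l - w k) +
        s * (v l - v k))
        (v l - v k) 0 := by
      simpa using ((hasDerivAt_id (0 : ℝ)).mul_const
        (v l - v k)).const_add (w l - w k)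
    have h2 := hasDerivAt_abs_rpow
      ((w l - w k) + 0 * (v l - v k)) hp
    have h3 := h2.comp (0 : ℝ) h1
    refine (h3.congr_deriv ?_).congr_of_eventuallyEq (Eventually.of_forall fun s => ?_)
    · rw [zero_mul, add_zero, Psi]; ring
    · simp only [Pi.add_apply, Pi.smul_apply, smul_eq_mul, Function.comp]
      congr 2; ring
  have hd : HasDerivAt (fun s : ℝ => J (w + s • v))
      (1 / 2 * ∑ k, 2 * (w k - h k) * v k +
        τ / (2 * p) * ∑ k, ∑ l, W k l * (p * Psi p (w l - w k) *
          (v l - v k))) 0 := by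
    refine HasDerivAt.add (HasDerivAt.const_mul _ (HasDerivAt.fun_sum fun k _ => ?_))
      (HasDerivAt.const_mul _ (HasDerivAt.fun_sum fun k _ => HasDerivAt.fun_sum fun l _ =>
        (hpt k l).const_mul _))
    have h1 : HasDerivAt (fun s : ℝ => (w + s • v) k - h k)
        (v k) 0 := by
      have := (((hasDerivAt_id (0 : ℝ)).mul_const
        (v k)).const_add (w k)).sub_const (h k)
      simpa using this
    have h2 := h1.fun_pow 2
    simpa using h2
  have hmin : IsLocalMin (fun s : ℝ => J (w + s • v)) 0 :=
    Eventually.of_forall fun s => by simpa using hw _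
  have hzero := hmin.hasDerivAt_eq_zero hd
  have hs := sum_gen_mul (p := p) hW w v
  have e1 : ∑ k, gen p W w k * v k = gen p W w i := by
    simp [v, Pi.single_apply]
  have e2 : ∑ k, 2 * (w k - h k) * v k = 2 * (w i - h i) := by
    simp [v, Pi.single_apply]
  have e3 : ∑ k, ∑ l, W k l * (p * Psi p (w l - w k) *
          (v l - v k))
      = p * ∑ k, ∑ l, W k l * (Psi p (w l - w k) *
          (v l - v k)) := by
    simp only [Finset.mul_sum]
    exact Finset.sum_congr rfl fun k _ => Finset.sum_congr rfl fun l _ => by ring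
  rw [e1] at hs
  rw [e2, e3] at hzero
  have hp0 : p ≠ 0 := by linarith
  have : τ / (2 * p) * (p * ∑ k, ∑ l, W k l * (Psi p (w l - w k) *
          (v l - v k)))
      = - τ * gen p W w i := by
    rw [hs]; field_simp
  rw [this] at hzero
  linarith

/-! ### Normalized norms on vectors -/

/-- The norm of `L²` of the uniform probability on `n` points. -/
noncomputable def l2 (v : Fin n → ℝ) : ℝ := √((n : ℝ)⁻¹ * ∑ i, v i ^ 2)

/-- The norm of `L^q` of the uniform probability on `n` points. -/
noncomputable def lq (q : ℝ) (v : Fin n → ℝ) : ℝ := ((n : ℝ)⁻¹ * ∑ i, |v i| ^ q) ^ (1 / q)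

lemma l2_nonneg (v : Fin n → ℝ) : 0 ≤ l2 v := Real.sqrt_nonneg _

lemma l2_sq (v : Fin n → ℝ) : l2 v ^ 2 = (n : ℝ)⁻¹ * ∑ i, v i ^ 2 :=
  Real.sq_sqrt (mul_nonneg (by positivity) (Finset.sum_nonneg fun _ _ => sq_nonneg _))

lemma mean_mul_le_l2 (v w : Fin n → ℝ) : (n : ℝ)⁻¹ * ∑ i, v i * w i ≤ l2 v * l2 w := by
  have h := Real.sum_mul_le_sqrt_mul_sqrt Finset.univ v w
  have hn : 0 ≤ (n : ℝ)⁻¹ := by positivity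
  unfold l2
  rw [Real.sqrt_mul hn, Real.sqrt_mul hn]
  calc (n : ℝ)⁻¹ * ∑ i, v i * w i
      ≤ (n : ℝ)⁻¹ * (√(∑ i, v i ^ 2) * √(∑ i, w i ^ 2)) := mul_le_mul_of_nonneg_left h hn
    _ = (√(n : ℝ)⁻¹ * √(n : ℝ)⁻¹) * (√(∑ i, v i ^ 2) * √(∑ i, w i ^ 2)) := by
        rw [Real.mul_self_sqrt hn]
    _ = _ := by ring

lemma l2_le_of_sq_le {v : Fin n → ℝ} {c : ℝ} (hc : 0 ≤ c) (h : l2 v ^ 2 ≤ c * l2 v) :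
    l2 v ≤ c := by
  rcases (l2_nonneg v).eq_or_lt with h0 | h0
  · rw [← h0]; exact hc
  · rw [sq] at h; exact le_of_mul_le_mul_right h h0

lemma l2_add_le (v w : Fin n → ℝ) : l2 (fun i => v i + w i) ≤ l2 v + l2 w := by
  refine l2_le_of_sq_le (add_nonneg (l2_nonneg _) (l2_nonneg _)) ?_
  have h1 := mean_mul_le_l2 v (fun i => v i + w i)
  have h2 := mean_mul_le_l2 w (fun i => v i + w i)
  rw [l2_sq]
  have : (n : ℝ)⁻¹ * ∑ i, (v i + w i) ^ 2 = (n : ℝ)⁻¹ * ∑ i, v i * (v i + w i) +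
      (n : ℝ)⁻¹ * ∑ i, w i * (v i + w i) := by
    rw [← mul_add, ← Finset.sum_add_distrib]
    congr 1; exact Finset.sum_congr rfl fun i _ => by ring
  rw [this]; linarith

lemma l2_smul (c : ℝ) (v : Fin n → ℝ) : l2 (fun i => c * v i) = |c| * l2 v := by
  unfold l2
  rw [← Real.sqrt_sq_eq_abs, ← Real.sqrt_mul (sq_nonneg c)]
  congr 1
  simp only [mul_pow, ← Finset.mul_sum]; ring

lemma l2_neg (v : Fin n → ℝ) : l2 (fun i => -v i) = l2 v := by
  simp [l2]

lemma l2_zero : l2 (fun _ : Fin n => (0 : ℝ)) = 0 := by simp [l2]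

lemma lq_nonneg (q : ℝ) (v : Fin n → ℝ) : 0 ≤ lq q v :=
  Real.rpow_nonneg (mul_nonneg (by positivity)
    (Finset.sum_nonneg fun _ _ => by positivity)) _

lemma lq_rpow {q : ℝ} (hq : q ≠ 0) (v : Fin n → ℝ) :
    lq q v ^ q = (n : ℝ)⁻¹ * ∑ i, |v i| ^ q := by
  unfold lq
  rw [← Real.rpow_mul (mul_nonneg (by positivity)
    (Finset.sum_nonneg fun _ _ => by positivity)), one_div_mul_cancel hq, Real.rpow_one]

lemma mean_mul_le_lq {q q' : ℝ} (hq : q.HolderConjugate q') (v w : Fin n → ℝ) :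
    (n : ℝ)⁻¹ * ∑ i, v i * w i ≤ lq q v * lq q' w := by
  have h := Real.inner_le_Lp_mul_Lq Finset.univ v w hq
  have hn : 0 ≤ (n : ℝ)⁻¹ := by positivity
  have s1 : 0 ≤ ∑ i, |v i| ^ q := Finset.sum_nonneg fun _ _ => by positivity
  have s2 : 0 ≤ ∑ i, |w i| ^ q' := Finset.sum_nonneg fun _ _ => by positivity
  unfold lq
  rw [Real.mul_rpow hn s1, Real.mul_rpow hn s2]
  have e : ((n : ℝ)⁻¹) ^ (1 / q) * ((n : ℝ)⁻¹) ^ (1 / q') = (n : ℝ)⁻¹ := by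
    rcases hn.eq_or_lt with h0 | h0
    · rw [← h0, Real.zero_rpow (by have := hq.pos; positivity), zero_mul]
    · rw [← Real.rpow_add h0, one_div, one_div, hq.inv_add_inv_eq_one, Real.rpow_one]
  calc (n : ℝ)⁻¹ * ∑ i, v i * w i
      ≤ (n : ℝ)⁻¹ * ((∑ i, |v i| ^ q) ^ (1 / q) * (∑ i, |w i| ^ q') ^ (1 / q')) :=
        mul_le_mul_of_nonneg_left h hn
    _ = _ := by nth_rw 1 [← e]; ring

lemma mul_Psi {q : ℝ} (hq : 1 < q) (r : ℝ) : r * Psi q r = |r| ^ q := by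
  rcases eq_or_ne r 0 with h | h
  · simp [h, Real.zero_rpow (by linarith : q ≠ 0)]
  · have := abs_pos.2 h
    have e : r * Psi q r = |r| ^ (q - 2) * |r| ^ (2 : ℝ) := by
      rw [Psi, Real.rpow_two, sq_abs]; ring
    rw [e, ← Real.rpow_add this]; congr 1; ring

lemma lq_Psi {q q' : ℝ} (hq : q.HolderConjugate q') (v : Fin n → ℝ) :
    lq q' (fun i => Psi q (v i)) = lq q v ^ (q - 1) := by
  have h1 : ∀ i, |Psi q (v i)| ^ q' = |v i| ^ q := fun i => by
    rw [abs_Psi hq.lt, ← Real.rpow_mul (abs_nonneg _), hq.sub_one_mul_conj]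
  unfold lq
  simp only [h1]
  rw [← Real.rpow_mul (mul_nonneg (by positivity)
    (Finset.sum_nonneg fun _ _ => by positivity))]
  congr 1
  have e1 := hq.inv_add_inv_eq_one
  have := hq.pos
  have : q * (1 / q') = q - 1 := by
    have : 1 / q' = 1 - q⁻¹ := by rw [one_div]; linarith
    rw [this, mul_sub, mul_inv_cancel₀ hq.ne_zero, mul_one]
  field_simp
  rw [mul_one_div] at this
  exact this

/-- `‖v‖_q` is attained by testing with `|v|^{q-2} v`. -/
lemma lq_le_of_dual {q q' : ℝ} (hq : q.HolderConjugate q') {v : Fin n → ℝ} {c : ℝ} (hc : 0 ≤ c)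
    (h : (n : ℝ)⁻¹ * ∑ i, |v i| ^ q ≤ c * lq q' (fun i => Psi q (v i))) : lq q v ≤ c := by
  rw [← lq_rpow hq.ne_zero, lq_Psi hq] at h
  rcases (lq_nonneg q v).eq_or_lt with h0 | h0
  · rw [← h0]; exact hc
  · refine le_of_mul_le_mul_right ?_ (Real.rpow_pos_of_pos h0 (q - 1))
    calc lq q v * lq q v ^ (q - 1) = lq q v ^ q := by
          rw [mul_comm, ← Real.rpow_add_one h0.ne']; congr 1; ring
      _ ≤ _ := h

/-! ### The backward Euler scheme on a finite weighted graph -/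

/-- The implicit Euler scheme with weights `W`, time steps `τ` and source `F`; the source of the
step from `k` to `k + 1` is `F (k + 1)`. -/
def Solves (p : ℝ) (W : Fin n → Fin n → ℝ) (N : ℕ) (τ : ℕ → ℝ) (F w : ℕ → Fin n → ℝ) : Prop :=
  ∀ k < N, ∀ i, w (k + 1) i = w k i + τ k * (gen p W (w (k + 1)) i + F (k + 1) i)

lemma exists_solves {p : ℝ} (hp : 1 < p) {W : Fin n → Fin n → ℝ}
    (hW : ∀ i j, W i j = W j i) (hW0 : ∀ i j, 0 ≤ W i j) {τ : ℕ → ℝ} (hτ : ∀ k, 0 ≤ τ k)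
    (F : ℕ → Fin n → ℝ) (u0 : Fin n → ℝ) (N : ℕ) :
    ∃ w : ℕ → Fin n → ℝ, w 0 = u0 ∧ Solves p W N τ F w := by
  choose S hS using fun (k : ℕ) (h : Fin n → ℝ) =>
    resolvent_exists hp hW hW0 (hτ k) (fun i => h i + τ k * F (k + 1) i)
  refine ⟨fun k => Nat.rec u0 (fun k v => S k v) k, rfl, fun k _ i => ?_⟩
  have := hS k (Nat.rec u0 (fun k v => S k v) k) i
  simp only at this ⊢
  linarith

lemma solves_unique {p : ℝ} (hp : 1 < p) {W : Fin n → Fin n → ℝ}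
    (hW : ∀ i j, W i j = W j i) (hW0 : ∀ i j, 0 ≤ W i j) {N : ℕ} {τ : ℕ → ℝ} (hτ : ∀ k, 0 ≤ τ k)
    {F w w' : ℕ → Fin n → ℝ} (hw : Solves p W N τ F w) (hw' : Solves p W N τ F w')
    (h0 : w 0 = w' 0) : ∀ k ≤ N, w k = w' k := by
  intro k
  induction k with
  | zero => intro _; exact h0
  | succ k ih =>
    intro hk
    have e := ih (by omega)
    refine resolvent_unique hp hW hW0 (hτ k) (h := fun i => w k i + τ k * F (k + 1) i)
      (fun i => ?_) (fun i => ?_)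
    · linarith [hw k (by omega) i]
    · rw [e]; linarith [hw' k (by omega) i]

lemma le_sum_of_step_le {N : ℕ} {a c : ℕ → ℝ} (h : ∀ k < N, a (k + 1) ≤ a k + c k) :
    ∀ k ≤ N, a k ≤ a 0 + ∑ j ∈ Finset.range k, c j := by
  intro k
  induction k with
  | zero => intro _; simp
  | succ k ih =>
    intro hk
    rw [Finset.sum_range_succ]
    linarith [ih (by omega), h k (by omega)]

/-- Stability of the scheme with respect to the weights.  The consistency error is evaluated on
the solution `w` of the second scheme, which makes it accessible when only the first weights are
random. -/
lemma l2_sub_le_of_solves {p : ℝ} (hp : 1 < p) {W W' : Fin n → Fin n → ℝ}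
    (hW : ∀ i j, W i j = W j i) (hW0 : ∀ i j, 0 ≤ W i j) {N : ℕ} {τ : ℕ → ℝ}
    (hτ : ∀ k, 0 ≤ τ k) {F U w : ℕ → Fin n → ℝ} (hU : Solves p W N τ F U)
    (hw : Solves p W' N τ F w) (h0 : U 0 = w 0) : ∀ k ≤ N,
    l2 (fun i => U k i - w k i) ≤ ∑ j ∈ Finset.range k,
      τ j * l2 (fun i => gen p W (w (j + 1)) i - gen p W' (w (j + 1)) i) := by
  have key := le_sum_of_step_le (N := N) (a := fun k => l2 (fun i => U k i - w k i))
    (c := fun j => τ j * l2 (fun i => gen p W (w (j + 1)) i - gen p W' (w (j + 1)) i)) ?_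
  · intro k hk
    have := key k hk
    simpa [h0, l2_zero] using this
  intro k hk
  set e := fun i => U (k + 1) i - w (k + 1) i with he
  set z := fun i => gen p W (w (k + 1)) i - gen p W' (w (k + 1)) i
  refine l2_le_of_sq_le (add_nonneg (l2_nonneg _) (mul_nonneg (hτ k) (l2_nonneg _))) ?_
  have h1 := sum_gen_sub_mul_nonpos hp hW hW0 (U (k + 1)) (w (k + 1))
  have h2 : ∑ i, e i ^ 2 = τ k * (∑ i, (gen p W (U (k + 1)) i - gen p W (w (k + 1)) i) * e i)
      + ∑ i, (U k i - w k i) * e i + τ k * ∑ i, z i * e i := by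
    rw [Finset.mul_sum, Finset.mul_sum, ← Finset.sum_add_distrib, ← Finset.sum_add_distrib]
    refine Finset.sum_congr rfl fun i _ => ?_
    have : e i = (U k i - w k i) + τ k * (gen p W (U (k + 1)) i - gen p W (w (k + 1)) i)
        + τ k * z i := by
      simp only [e, z]; linear_combination hU k hk i - hw k hk i
    rw [sq]; nth_rw 1 [this]; ring
  have hn : 0 ≤ (n : ℝ)⁻¹ := by positivity
  have h3 := mean_mul_le_l2 (fun i => U k i - w k i) e
  have h4 := mul_le_mul_of_nonneg_left (mean_mul_le_l2 z e) (hτ k)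
  have h5 := mul_nonpos_of_nonneg_of_nonpos (mul_nonneg hn (hτ k)) h1
  rw [l2_sq, h2, add_mul]
  have : (n : ℝ)⁻¹ * (τ k * (∑ i, (gen p W (U (k + 1)) i - gen p W (w (k + 1)) i) * e i)
      + ∑ i, (U k i - w k i) * e i + τ k * ∑ i, z i * e i) =
      (n : ℝ)⁻¹ * τ k * (∑ i, (gen p W (U (k + 1)) i - gen p W (w (k + 1)) i) * e i) +
      (n : ℝ)⁻¹ * ∑ i, (U k i - w k i) * e i + τ k * ((n : ℝ)⁻¹ * ∑ i, z i * e i) := by ring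
  rw [this]
  linarith

/-- `L^q` stability of the scheme, from testing with `Ψ_q(w) = |w|^{q-2} w`; the source is measured
by duality. -/
lemma lq_le_of_solves {p : ℝ} (hp : 1 < p) {W : Fin n → Fin n → ℝ}
    (hW : ∀ i j, W i j = W j i) (hW0 : ∀ i j, 0 ≤ W i j) {q q' : ℝ} (hq : q.HolderConjugate q')
    {N : ℕ} {τ : ℕ → ℝ} (hτ : ∀ k, 0 ≤ τ k) {F w : ℕ → Fin n → ℝ} (hw : Solves p W N τ F w)
    {M : ℕ → ℝ} (hM0 : ∀ k < N, 0 ≤ M k)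
    (hM : ∀ k < N, ∀ ψ : Fin n → ℝ, (n : ℝ)⁻¹ * ∑ i, τ k * F (k + 1) i * ψ i ≤ M k * lq q' ψ) :
    ∀ k ≤ N, lq q (w k) ≤ lq q (w 0) + ∑ j ∈ Finset.range k, M j := by
  refine le_sum_of_step_le (a := fun k => lq q (w k)) fun k hk => ?_
  refine lq_le_of_dual hq (add_nonneg (lq_nonneg _ _) (hM0 k hk)) ?_
  have h1 := sum_gen_mul_mono_nonpos hp hW hW0 (w (k + 1)) (Psi_mono hq.lt)
  have h2 := mean_mul_le_lq hq (w k) (fun i => Psi q (w (k + 1) i))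
  have h3 := hM k hk (fun i => Psi q (w (k + 1) i))
  have hn : 0 ≤ (n : ℝ)⁻¹ := by positivity
  have h5 := mul_nonpos_of_nonneg_of_nonpos (mul_nonneg hn (hτ k)) h1
  have : (n : ℝ)⁻¹ * ∑ i, |w (k + 1) i| ^ q =
      (n : ℝ)⁻¹ * τ k * (∑ i, gen p W (w (k + 1)) i * Psi q (w (k + 1) i)) +
      (n : ℝ)⁻¹ * ∑ i, w k i * Psi q (w (k + 1) i) +
      (n : ℝ)⁻¹ * ∑ i, τ k * F (k + 1) i * Psi q (w (k + 1) i) := by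
    rw [mul_assoc, ← mul_add, ← mul_add, Finset.mul_sum (a := τ k), ← Finset.sum_add_distrib,
      ← Finset.sum_add_distrib]
    congr 1
    refine Finset.sum_congr rfl fun i _ => ?_
    rw [← mul_Psi hq.lt]; nth_rw 1 [hw k hk i]; ring
  rw [this, add_mul]; linarith

/-- The maximum principle: at a maximum of `w (k + 1)` the generator is nonpositive. -/
lemma abs_le_of_solves {p : ℝ} (hp : 1 < p) {W : Fin n → Fin n → ℝ} (hW0 : ∀ i j, 0 ≤ W i j)
    {N : ℕ} {τ : ℕ → ℝ} (hτ : ∀ k, 0 ≤ τ k) {F w : ℕ → Fin n → ℝ} (hw : Solves p W N τ F w)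
    {A : ℝ} (hA : ∀ i, |w 0 i| ≤ A) {M : ℕ → ℝ} (hM : ∀ k < N, ∀ i, |τ k * F (k + 1) i| ≤ M k) :
    ∀ k ≤ N, ∀ i, |w k i| ≤ A + ∑ j ∈ Finset.range k, M j := by
  intro k
  induction k with
  | zero => intro _ i; simpa using hA i
  | succ k ih =>
    intro hk i
    have ih := ih (by omega)
    rw [Finset.sum_range_succ]
    have : Nonempty (Fin n) := ⟨i⟩
    obtain ⟨a, ha⟩ := Finite.exists_max (w (k + 1))
    obtain ⟨b, hb⟩ := Finite.exists_min (w (k + 1))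
    have ga : gen p W (w (k + 1)) a ≤ 0 := Finset.sum_nonpos fun j _ =>
      mul_nonpos_of_nonneg_of_nonpos (hW0 _ _)
        (by have := Psi_mono hp (sub_nonpos.2 (ha j)); rwa [Psi_zero] at this)
    have gb : 0 ≤ gen p W (w (k + 1)) b := Finset.sum_nonneg fun j _ =>
      mul_nonneg (hW0 _ _) (by have := Psi_mono hp (sub_nonneg.2 (hb j)); rwa [Psi_zero] at this)
    have ea := hw k (by omega) a
    have eb := hw k (by omega) b
    have fa := abs_le.1 (hM k (by omega) a)
    have fb := abs_le.1 (hM k (by omega) b)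
    have ia := abs_le.1 (ih a)
    have ib := abs_le.1 (ih b)
    have ka := mul_nonpos_of_nonneg_of_nonpos (hτ k) ga
    have kb := mul_nonneg (hτ k) gb
    rw [mul_add] at ea eb
    rw [abs_le]
    constructor
    · linarith [hb i]
    · linarith [ha i]

/-- The monotonicity defect `⟨A w - A w', w - w'⟩` of two vectors, where `A = -gen` and the inner
product is that of `l2`.  It is nonnegative for symmetric nonnegative weights. -/
noncomputable def defect (p : ℝ) (W : Fin n → Fin n → ℝ) (w w' : Fin n → ℝ) : ℝ :=
  (n : ℝ)⁻¹ * ∑ i, (gen p W w' i - gen p W w i) * (w i - w' i)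

/-- Bounds for the discrete time derivative `δ_k = -A w_k + F_k` (with `A = -gen`), and the
telescoping bound for the accumulated defect.  As the defects, weighted with the steps, sum to
`O(τ²)` whatever the regularity of `Ψ`, the time discretization is of first order for every `p`. -/
lemma solves_rate {p : ℝ} (hp : 1 < p) {W : Fin n → Fin n → ℝ}
    (hW : ∀ i j, W i j = W j i) (hW0 : ∀ i j, 0 ≤ W i j) {N : ℕ} {τ : ℕ → ℝ} {τm : ℝ}
    (hτ : ∀ k < N, 0 < τ k) (hτm : ∀ k < N, τ k ≤ τm) {F w : ℕ → Fin n → ℝ}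
    (hw : Solves p W N τ F w) {φ : ℕ → ℝ} {V L : ℝ}
    (hφ : ∀ k < N, l2 (fun i => F (k + 1) i - F k i) ≤ φ k)
    (hV : ∑ k ∈ Finset.range N, φ k ≤ V) (hL : l2 (fun i => gen p W (w 0) i + F 0 i) + V ≤ L) :
    (∀ k < N, l2 (fun i => w (k + 1) i - w k i) ≤ τ k * L) ∧
    ∑ k ∈ Finset.range N, τ k * defect p W (w (k + 1)) (w k) ≤ τm ^ 2 * (L ^ 2 / 2 + L * V) := by
  set δ : ℕ → Fin n → ℝ := fun k i => gen p W (w k) i + F k i with hδ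
  have hn : 0 ≤ (n : ℝ)⁻¹ := by positivity
  have hφ0 : ∀ k < N, 0 ≤ φ k := fun k hk => (l2_nonneg _).trans (hφ k hk)
  have hinc : ∀ k < N, ∀ i, w (k + 1) i - w k i = τ k * δ (k + 1) i := fun k hk i => by
    rw [hw k hk i]; simp only [hδ]; ring
  have hdef : ∀ k < N, 0 ≤ defect p W (w (k + 1)) (w k) ∧
      defect p W (w (k + 1)) (w k) = τ k * ((n : ℝ)⁻¹ * ∑ i, δ k i * δ (k + 1) i -
        l2 (δ (k + 1)) ^ 2 + (n : ℝ)⁻¹ * ∑ i, (F (k + 1) i - F k i) * δ (k + 1) i) := by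
    intro k hk
    constructor
    · have := sum_gen_sub_mul_nonpos hp hW hW0 (w (k + 1)) (w k)
      refine mul_nonneg hn ?_
      rw [← neg_nonneg, ← Finset.sum_neg_distrib] at this
      refine this.trans_eq (Finset.sum_congr rfl fun i _ => by ring)
    · rw [l2_sq, defect, ← mul_sub, ← mul_add, ← mul_assoc, mul_comm (τ k), mul_assoc,
        ← Finset.sum_sub_distrib, ← Finset.sum_add_distrib, Finset.mul_sum (a := τ k)]
      congr 1
      refine Finset.sum_congr rfl fun i _ => ?_
      rw [hinc k hk i]; simp only [hδ]; ring
  -- the difference of the equations at `k + 1` and `k`, tested with `δ (k + 1)`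
  have hpair : ∀ k < N, l2 (δ (k + 1)) ^ 2 + defect p W (w (k + 1)) (w k) / τ k ≤
      (n : ℝ)⁻¹ * ∑ i, δ k i * δ (k + 1) i + φ k * l2 (δ (k + 1)) := by
    intro k hk
    have h1 := (hdef k hk).2
    have h2 := mean_mul_le_l2 (fun i => F (k + 1) i - F k i) (δ (k + 1))
    have h3 := mul_le_mul_of_nonneg_right (hφ k hk) (l2_nonneg (δ (k + 1)))
    rw [h1, mul_div_cancel_left₀ _ (hτ k hk).ne']
    linarith
  have hstep : ∀ k < N, l2 (δ (k + 1)) ≤ l2 (δ k) + φ k := by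
    intro k hk
    refine l2_le_of_sq_le (add_nonneg (l2_nonneg _) (hφ0 k hk)) ?_
    have h1 := hpair k hk
    have h2 := mean_mul_le_l2 (δ k) (δ (k + 1))
    have h3 := div_nonneg (hdef k hk).1 (hτ k hk).le
    linarith
  have hδL : ∀ k ≤ N, l2 (δ k) ≤ L := by
    intro k hk
    have h1 := le_sum_of_step_le (a := fun k => l2 (δ k)) hstep k hk
    have h2 : ∑ j ∈ Finset.range k, φ j ≤ ∑ j ∈ Finset.range N, φ j :=
      Finset.sum_le_sum_of_subset_of_nonneg (Finset.range_mono hk) fun j hj _ =>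
        hφ0 j (Finset.mem_range.1 hj)
    linarith
  have hL0 : 0 ≤ L := (l2_nonneg _).trans (hδL 0 (Nat.zero_le _))
  refine ⟨fun k hk => ?_, ?_⟩
  · have : (fun i => w (k + 1) i - w k i) = fun i => τ k * δ (k + 1) i := funext (hinc k hk)
    rw [this, l2_smul, abs_of_pos (hτ k hk)]
    exact mul_le_mul_of_nonneg_left (hδL _ hk) (hτ k hk).le
  · -- `⟨δ_k, δ_{k+1}⟩ ≤ (‖δ_k‖² + ‖δ_{k+1}‖²) / 2` makes the squared norms telescope
    have hterm : ∀ k < N, τ k * defect p W (w (k + 1)) (w k) ≤ τm ^ 2 *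
        ((l2 (δ k) ^ 2 / 2 - l2 (δ (k + 1)) ^ 2 / 2) + φ k * L) := by
      intro k hk
      have h1 := hpair k hk
      have h2 := mean_mul_le_l2 (δ k) (δ (k + 1))
      have h3 := mul_le_mul_of_nonneg_left (hδL (k + 1) hk) (hφ0 k hk)
      have h4 : defect p W (w (k + 1)) (w k) / τ k ≤
          (l2 (δ k) ^ 2 / 2 - l2 (δ (k + 1)) ^ 2 / 2) + φ k * L := by
        nlinarith [sq_nonneg (l2 (δ k) - l2 (δ (k + 1)))]
      have h5 := div_nonneg (hdef k hk).1 (hτ k hk).le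
      have e : τ k * defect p W (w (k + 1)) (w k) =
          τ k ^ 2 * (defect p W (w (k + 1)) (w k) / τ k) := by
        have := (hτ k hk).ne'
        field_simp
      rw [e]
      exact mul_le_mul (pow_le_pow_left₀ (hτ k hk).le (hτm k hk) 2) h4 h5 (sq_nonneg _)
    refine (Finset.sum_le_sum fun k hk => hterm k (Finset.mem_range.1 hk)).trans ?_
    rw [← Finset.mul_sum, Finset.sum_add_distrib, ← Finset.sum_mul,
      Finset.sum_range_sub' (fun k => l2 (δ k) ^ 2 / 2)]
    refine mul_le_mul_of_nonneg_left ?_ (sq_nonneg _)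
    have h1 := pow_le_pow_left₀ (l2_nonneg _) (hδL 0 (Nat.zero_le _)) 2
    have h2 := mul_le_mul_of_nonneg_right hV hL0
    nlinarith [sq_nonneg (l2 (δ N))]

/-! ### A quadratic Gronwall inequality -/

/-- If `(q²)' ≤ 2 α q` in integrated form, then `q' ≤ α` in integrated form. -/
lemma gronwall_sq {s₀ s₁ : ℝ} (hs : s₀ ≤ s₁) {q α : ℝ → ℝ} (hq : ContinuousOn q (Set.Icc s₀ s₁))
    (hq0 : ∀ t ∈ Set.Icc s₀ s₁, 0 ≤ q t) (hα : IntervalIntegrable α volume s₀ s₁)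
    (hα0 : ∀ t ∈ Set.Icc s₀ s₁, 0 ≤ α t)
    (h : ∀ s ∈ Set.Icc s₀ s₁, ∀ t ∈ Set.Icc s₀ s₁, s ≤ t →
      q t ^ 2 - q s ^ 2 ≤ 2 * ∫ r in s..t, α r * q r) :
    q s₁ ≤ q s₀ + ∫ r in s₀..s₁, α r := by
  have hsub : ∀ s ∈ Set.Icc s₀ s₁, ∀ t ∈ Set.Icc s₀ s₁, IntervalIntegrable α volume s t :=
    fun s hs t ht => hα.mono_set (by
      rw [Set.uIcc_of_le ‹s₀ ≤ s₁›]
      exact (Set.uIcc_subset_Icc hs ht))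
  have hA : ContinuousOn (fun t => ∫ r in s₀..t, α r) (Set.Icc s₀ s₁) := by
    have := intervalIntegral.continuousOn_primitive_interval' hα Set.left_mem_uIcc
    rwa [Set.uIcc_of_le hs] at this
  -- strict comparison with a slightly steeper function that starts slightly higher
  suffices hε : ∀ ε > 0, q s₁ ≤ q s₀ + ε + (1 + ε) * ∫ r in s₀..s₁, α r by
    have hlim : Tendsto (fun ε : ℝ => q s₀ + ε + (1 + ε) * ∫ r in s₀..s₁, α r) (𝓝[>] 0)
        (𝓝 (q s₀ + 0 + (1 + 0) * ∫ r in s₀..s₁, α r)) := by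
      refine Tendsto.mono_left ?_ nhdsWithin_le_nhds
      exact (Continuous.tendsto (by fun_prop) 0)
    have := ge_of_tendsto hlim (eventually_mem_nhdsWithin.mono fun ε hε' => hε ε hε')
    simpa using this
  intro ε hε
  set G : ℝ → ℝ := fun t => q s₀ + ε + (1 + ε) * ∫ r in s₀..t, α r with hG
  have hGc : ContinuousOn G (Set.Icc s₀ s₁) := continuousOn_const.add (continuousOn_const.mul hA)
  have hGmono : ∀ s ∈ Set.Icc s₀ s₁, ∀ t ∈ Set.Icc s₀ s₁, s ≤ t →
      G t - G s = (1 + ε) * ∫ r in s..t, α r := by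
    intro s hs' t ht _
    have hl : s₀ ∈ Set.Icc s₀ s₁ := Set.left_mem_Icc.2 hs
    have := intervalIntegral.integral_add_adjacent_intervals (hsub s₀ hl s hs') (hsub s hs' t ht)
    simp only [hG]; rw [← this]; ring
  have hint0 : ∀ s ∈ Set.Icc s₀ s₁, ∀ t ∈ Set.Icc s₀ s₁, s ≤ t → 0 ≤ ∫ r in s..t, α r :=
    fun s hs' t ht hst => intervalIntegral.integral_nonneg hst fun r hr =>
      hα0 r ⟨hs'.1.trans hr.1, hr.2.trans ht.2⟩
  by_contra! hlt
  -- the first time at which `q` reaches `G`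
  set B : Set ℝ := {t ∈ Set.Icc s₀ s₁ | G t ≤ q t} with hB
  have hBc : IsClosed B := by
    have := hGc.prodMk hq
    have h2 := this.preimage_isClosed_of_isClosed isClosed_Icc
      (isClosed_le continuous_fst continuous_snd)
    exact h2
  have hBne : B.Nonempty := ⟨s₁, Set.right_mem_Icc.2 hs, hlt.le⟩
  have hBbdd : BddBelow B := ⟨s₀, fun t ht => ht.1.1⟩
  set t := sInf B with ht
  have htB : t ∈ B := hBc.csInf_mem hBne hBbdd
  have htlt : ∀ s ∈ Set.Icc s₀ s₁, s < t → q s < G s := fun s hs' hst => by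
    by_contra! hc
    exact absurd (csInf_le hBbdd (show s ∈ B from ⟨hs', hc⟩)) (not_le.2 hst)
  have hts : s₀ < t := by
    rcases htB.1.1.eq_or_lt with h0 | h0
    · have := htB.2
      rw [← h0] at this
      simp [hG] at this
      linarith
    · exact h0
  have hGt : 0 < G t := by
    have := hint0 s₀ (Set.left_mem_Icc.2 hs) t htB.1 hts.le
    have := hq0 s₀ (Set.left_mem_Icc.2 hs)
    simp only [hG]; positivity
  have hcont : ContinuousWithinAt G (Set.Icc s₀ t) t :=
    (hGc t htB.1).mono (Set.Icc_subset_Icc_right htB.1.2)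
  have hev : ∀ᶠ s in 𝓝[Set.Icc s₀ t] t, 2 * G t < (1 + ε) * (G t + G s) := by
    have h1 : Tendsto (fun s => (1 + ε) * (G t + G s)) (𝓝[Set.Icc s₀ t] t)
        (𝓝 ((1 + ε) * (G t + G t))) := (tendsto_const_nhds.add hcont).const_mul _
    exact h1.eventually_const_lt (by nlinarith)
  have hev2 : ∀ᶠ s in 𝓝[<] t, s ∈ Set.Ico s₀ t := Ico_mem_nhdsLT hts
  have hev3 : ∀ᶠ s in 𝓝[<] t, 2 * G t < (1 + ε) * (G t + G s) := by
    refine Filter.Eventually.filter_mono ?_ hev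
    rw [← nhdsWithin_Ico_eq_nhdsLT hts]
    exact nhdsWithin_mono _ Set.Ico_subset_Icc_self
  -- just before `t` the increment of `G²` already exceeds the one allowed to `q²`
  obtain ⟨s, hs1, hs2⟩ := (hev2.and hev3).exists
  have hsm : s ∈ Set.Icc s₀ s₁ := ⟨hs1.1, hs1.2.le.trans htB.1.2⟩
  have hqs := htlt s hsm hs1.2
  have hqs0 := hq0 s hsm
  have h1 := h s hsm t htB.1 hs1.2.le
  have hqt : q t = G t := by
    refine le_antisymm ?_ htB.2
    have hqc : ContinuousWithinAt q (Set.Ico s₀ t) t :=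
      (hq t htB.1).mono fun x hx => ⟨hx.1, hx.2.le.trans htB.1.2⟩
    have hGc' : ContinuousWithinAt G (Set.Ico s₀ t) t := hcont.mono Set.Ico_subset_Icc_self
    unfold ContinuousWithinAt at hqc hGc'
    rw [nhdsWithin_Ico_eq_nhdsLT hts] at hqc hGc'
    refine le_of_tendsto_of_tendsto hqc hGc' ?_
    filter_upwards [hev2] with x hx
    exact (htlt x ⟨hx.1, hx.2.le.trans htB.1.2⟩ hx.2).le
  have hint : ∫ r in s..t, α r * q r ≤ G t * ∫ r in s..t, α r := by
    rw [← intervalIntegral.integral_const_mul]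
    have hsubset : Set.uIcc s t ⊆ Set.Icc s₀ s₁ := Set.uIcc_subset_Icc hsm htB.1
    refine intervalIntegral.integral_mono_on hs1.2.le
      ((hsub s hsm t htB.1).mul_continuousOn (hq.mono hsubset))
      ((hsub s hsm t htB.1).const_mul _) fun r hr => ?_
    have hrm : r ∈ Set.Icc s₀ s₁ := ⟨hsm.1.trans hr.1, hr.2.trans htB.1.2⟩
    have hqr : q r ≤ G t := by
      rcases hr.2.eq_or_lt with h0 | h0
      · rw [h0, hqt]
      · have := hGmono r hrm t htB.1 hr.2
        have h3 := hint0 r hrm t htB.1 hr.2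
        have h4 := htlt r hrm h0
        nlinarith
    rw [mul_comm]
    exact mul_le_mul_of_nonneg_right hqr (hα0 r hrm)
  have hA0 := hint0 s hsm t htB.1 hs1.2.le
  have hGs := hGmono s hsm t htB.1 hs1.2.le
  rw [hqt] at h1
  have h5 : G t ^ 2 - G s ^ 2 = (1 + ε) * (G t + G s) * ∫ r in s..t, α r := by
    rw [sq_sub_sq, hGs]; ring
  nlinarith

/-- Gronwall with a constant `2 β` added to `(q²)'`.  The constant is absorbed by passing from `q²`
to `q² + 2 β (s₁ - t)`. -/
lemma gronwall_sq_add {s₀ s₁ : ℝ} (hs : s₀ ≤ s₁) {q α : ℝ → ℝ} {β : ℝ} (hβ : 0 ≤ β)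
    (hq : ContinuousOn q (Set.Icc s₀ s₁)) (hα : IntervalIntegrable α volume s₀ s₁)
    (hα0 : ∀ t ∈ Set.Icc s₀ s₁, 0 ≤ α t)
    (h : ∀ s ∈ Set.Icc s₀ s₁, ∀ t ∈ Set.Icc s₀ s₁, s ≤ t →
      q t ^ 2 - q s ^ 2 ≤ 2 * (∫ r in s..t, α r * q r) + 2 * β * (t - s)) :
    q s₁ ≤ √(q s₀ ^ 2 + 2 * ((s₁ - s₀) * β)) + ∫ r in s₀..s₁, α r := by
  set Q : ℝ → ℝ := fun t => √(q t ^ 2 + 2 * β * (s₁ - t)) with hQ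
  have hnn : ∀ t ∈ Set.Icc s₀ s₁, 0 ≤ q t ^ 2 + 2 * β * (s₁ - t) := fun t ht => by
    have : 0 ≤ s₁ - t := by linarith [ht.2]
    positivity
  have hQsq : ∀ t ∈ Set.Icc s₀ s₁, Q t ^ 2 = q t ^ 2 + 2 * β * (s₁ - t) := fun t ht =>
    Real.sq_sqrt (hnn t ht)
  have hQc : ContinuousOn Q (Set.Icc s₀ s₁) := ContinuousOn.sqrt (by fun_prop)
  have hqQ : ∀ t ∈ Set.Icc s₀ s₁, q t ≤ Q t := fun t ht => by
    refine Real.le_sqrt_of_sq_le ?_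
    have : 0 ≤ s₁ - t := by linarith [ht.2]
    have : 0 ≤ 2 * β * (s₁ - t) := by positivity
    linarith
  have key := gronwall_sq hs hQc (fun t _ => Real.sqrt_nonneg _) hα hα0 ?_
  · have e1 : q s₁ ≤ Q s₁ := hqQ s₁ (Set.right_mem_Icc.2 hs)
    have e2 : Q s₀ = √(q s₀ ^ 2 + 2 * ((s₁ - s₀) * β)) := by
      simp only [hQ]; congr 1; ring
    rw [← e2]; exact e1.trans key
  · intro s hs' t ht hst
    rw [hQsq s hs', hQsq t ht]
    have h1 := h s hs' t ht hst
    have hsubset : Set.uIcc s t ⊆ Set.Icc s₀ s₁ := Set.uIcc_subset_Icc hs' ht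
    have hα' : IntervalIntegrable α volume s t := hα.mono_set (by rwa [Set.uIcc_of_le hs])
    have h2 : ∫ r in s..t, α r * q r ≤ ∫ r in s..t, α r * Q r :=
      intervalIntegral.integral_mono_on hst (hα'.mul_continuousOn (hq.mono hsubset))
        (hα'.mul_continuousOn (hQc.mono hsubset)) fun r hr =>
        mul_le_mul_of_nonneg_left (hqQ r ⟨hs'.1.trans hr.1, hr.2.trans ht.2⟩)
          (hα0 r ⟨hs'.1.trans hr.1, hr.2.trans ht.2⟩)
    linarith

/-! ### A chain rule for convex functions along absolutely continuous curves -/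

/-- For a convex function `J` with bounded, weak-* continuous subgradient `D`, and a curve `e`
with Bochner integrable derivative `e'`, `J (e t) - J (e s) ≤ ∫ D (e r) (e' r) dr`.  On each cell of
a partition the subgradient inequality at the right end point gives the bound with `D` frozen there,
and dominated convergence removes the freezing. -/
lemma convex_chain_rule {E : Type*} [NormedAddCommGroup E] [NormedSpace ℝ E] [CompleteSpace E]
    {J : E → ℝ} {D : E → E →L[ℝ] ℝ} {R : ℝ}
    (hJ : ∀ a b, J b - J a ≤ D b (b - a)) (hD : ∀ e, ‖D e‖ ≤ R)
    (hDc : ∀ h, Continuous fun e => D e h) {s t : ℝ} (hst : s ≤ t) {e e' : ℝ → E}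
    (he : ContinuousOn e (Set.Icc s t)) (he' : IntervalIntegrable e' volume s t)
    (hee : ∀ a ∈ Set.Icc s t, ∀ b ∈ Set.Icc s t, a ≤ b → e b - e a = ∫ r in a..b, e' r) :
    IntervalIntegrable (fun r => D (e r) (e' r)) volume s t ∧
    J (e t) - J (e s) ≤ ∫ r in s..t, D (e r) (e' r) := by
  rcases hst.eq_or_lt with rfl | hst'
  · simp
  have hR : 0 ≤ R := (norm_nonneg _).trans (hD 0)
  -- `ν m r` is the right end point of the cell of `r` in the uniform partition into `m + 1` cells
  set d : ℕ → ℝ := fun m => (t - s) / (m + 1) with hd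
  have hdpos : ∀ m, 0 < d m := fun m => div_pos (by linarith) (by positivity)
  have hdlim : Tendsto d atTop (𝓝 0) := by
    simpa [hd, div_eq_mul_inv] using (tendsto_one_div_add_atTop_nhds_zero_nat (𝕜 := ℝ)).const_mul
      (t - s)
  set ν : ℕ → ℝ → ℝ := fun m r => s + ⌈(r - s) / d m⌉ * d m with hν
  set F : ℕ → ℝ → ℝ := fun m r => D (e (ν m r)) (e' r) with hF
  have hdm : ∀ m : ℕ, (m + 1 : ℝ) * d m = t - s := fun m => by simp only [hd]; field_simp
  have hνcell : ∀ m (i : ℕ), ∀ r ∈ Set.Ioc (s + i * d m) (s + (i + 1 : ℕ) * d m),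
      ν m r = s + (i + 1 : ℕ) * d m := by
    intro m i r hr
    have : ⌈(r - s) / d m⌉ = ((i + 1 : ℕ) : ℤ) := by
      rw [Int.ceil_eq_iff]
      constructor
      · rw [lt_div_iff₀ (hdpos m)]; push_cast; linarith [hr.1]
      · rw [div_le_iff₀ (hdpos m)]; push_cast; have := hr.2; push_cast at this; linarith
    simp only [hν, this]; push_cast; rfl
  have hνmem : ∀ m, ∀ r ∈ Set.Ioc s t, ν m r ∈ Set.Icc s t ∧ |ν m r - r| ≤ d m := by
    intro m r hr
    have h1 : (r - s) / d m ≤ ⌈(r - s) / d m⌉ := Int.le_ceil _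
    have h2 : (⌈(r - s) / d m⌉ : ℝ) < (r - s) / d m + 1 := Int.ceil_lt_add_one _
    rw [div_le_iff₀ (hdpos m)] at h1
    have h3 : (⌈(r - s) / d m⌉ : ℝ) * d m < r - s + d m := by
      calc _ < ((r - s) / d m + 1) * d m := mul_lt_mul_of_pos_right h2 (hdpos m)
        _ = _ := by rw [add_mul, div_mul_cancel₀ _ (hdpos m).ne', one_mul]
    have h4 : (⌈(r - s) / d m⌉ : ℝ) ≤ (m + 1 : ℕ) := by
      have : ⌈(r - s) / d m⌉ ≤ ((m + 1 : ℕ) : ℤ) := by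
        rw [Int.ceil_le, div_le_iff₀ (hdpos m)]
        push_cast; rw [hdm]; linarith [hr.2]
      exact_mod_cast this
    have h5 : (⌈(r - s) / d m⌉ : ℝ) * d m ≤ t - s := by
      rw [← hdm m]; push_cast at h4; exact mul_le_mul_of_nonneg_right h4 (hdpos m).le
    simp only [hν]
    refine ⟨⟨by linarith [hr.1], by linarith⟩, ?_⟩
    rw [abs_le]; constructor <;> linarith [hdpos m]
  have hsub : ∀ a ∈ Set.Icc s t, ∀ b ∈ Set.Icc s t, IntervalIntegrable e' volume a b :=
    fun a ha b hb => he'.mono_set (by rw [Set.uIcc_of_le hst]; exact Set.uIcc_subset_Icc ha hb)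
  have hpt : ∀ m (i : ℕ), i ≤ m + 1 → s + i * d m ∈ Set.Icc s t := by
    intro m i hi
    have h0 := (hdpos m).le
    refine ⟨by have : 0 ≤ i * d m := by positivity
               linarith, ?_⟩
    have : (i : ℝ) * d m ≤ (m + 1 : ℝ) * d m :=
      mul_le_mul_of_nonneg_right (by exact_mod_cast hi) h0
    rw [hdm] at this; linarith
  have hpiece : ∀ m (i : ℕ), i < m + 1 →
      IntervalIntegrable (F m) volume (s + i * d m) (s + (i + 1 : ℕ) * d m) ∧
      J (e (s + (i + 1 : ℕ) * d m)) - J (e (s + i * d m)) ≤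
        ∫ r in (s + i * d m)..(s + (i + 1 : ℕ) * d m), F m r := by
    intro m i hi
    have ha := hpt m i hi.le
    have hb := hpt m (i + 1) hi
    have hab : s + i * d m ≤ s + (i + 1 : ℕ) * d m := by
      push_cast; linarith [hdpos m]
    set b := s + (i + 1 : ℕ) * d m
    have hii := hsub _ ha _ hb
    have hconst : IntervalIntegrable (fun r => D (e b) (e' r)) volume (s + i * d m) b :=
      ⟨(D (e b)).integrable_comp hii.1, (D (e b)).integrable_comp hii.2⟩
    have hcongr : ∀ r ∈ Set.uIoc (s + i * d m) b, D (e b) (e' r) = F m r := by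
      intro r hr
      rw [Set.uIoc_of_le hab] at hr
      simp only [hF]; rw [hνcell m i r hr]
    refine ⟨hconst.congr (fun r hr => hcongr r hr), ?_⟩
    rw [← intervalIntegral.integral_congr_ae (Eventually.of_forall hcongr),
      ContinuousLinearMap.intervalIntegral_comp_comm _ hii, ← hee _ ha _ hb hab]
    exact hJ _ _
  have hFint : ∀ m, IntervalIntegrable (F m) volume s t ∧
      J (e t) - J (e s) ≤ ∫ r in s..t, F m r := by
    intro m
    have e0 : s + ((0 : ℕ) : ℝ) * d m = s := by simp
    have e1 : s + ((m + 1 : ℕ) : ℝ) * d m = t := by push_cast; rw [hdm]; ring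
    have hI : ∀ k < m + 1, IntervalIntegrable (F m) volume (s + (k : ℕ) * d m)
      (s + (k + 1 : ℕ) * d m) := fun k hk => (hpiece m k hk).1
    constructor
    · have := IntervalIntegrable.trans_iterate (a := fun k : ℕ => s + k * d m) (n := m + 1) hI
      simpa only [e0, e1] using this
    · have := intervalIntegral.sum_integral_adjacent_intervals (a := fun k : ℕ => s + k * d m)
        (n := m + 1) hI
      simp only [e0, e1] at this
      rw [← this]
      have h2 := Finset.sum_range_sub (fun k : ℕ => J (e (s + k * d m))) (m + 1)
      simp only [e0, e1] at h2
      rw [← h2]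
      exact Finset.sum_le_sum fun k hk => (hpiece m k (Finset.mem_range.1 hk)).2
  have hlim : ∀ r ∈ Set.Ioc s t, Tendsto (fun m => F m r) atTop (𝓝 (D (e r) (e' r))) := by
    intro r hr
    have h1 : Tendsto (fun m => ν m r) atTop (𝓝 r) := by
      rw [tendsto_iff_dist_tendsto_zero]
      exact squeeze_zero (fun _ => dist_nonneg) (fun m => (hνmem m r hr).2) hdlim
    have h2 : Tendsto (fun m => ν m r) atTop (𝓝[Set.Icc s t] r) :=
      tendsto_nhdsWithin_iff.2 ⟨h1, Eventually.of_forall fun m => (hνmem m r hr).1⟩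
    exact ((hDc (e' r)).tendsto _).comp ((he r ⟨hr.1.le, hr.2⟩).tendsto.comp h2)
  have hbound : ∀ m r, ‖F m r‖ ≤ R * ‖e' r‖ := fun m r =>
    (ContinuousLinearMap.le_opNorm _ _).trans
      (mul_le_mul_of_nonneg_right (hD _) (norm_nonneg _))
  have hmeas : ∀ m, AEStronglyMeasurable (F m) (volume.restrict (Set.Ioc s t)) := fun m => by
    have := (hFint m).1.1; exact this.aestronglyMeasurable
  have hdom : IntervalIntegrable (fun r => R * ‖e' r‖) volume s t := he'.norm.const_mul R
  have hT := intervalIntegral.tendsto_integral_filter_of_dominated_convergence (μ := volume)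
    (a := s) (b := t) (F := F) (l := atTop) (f := fun r => D (e r) (e' r))
    (fun r => R * ‖e' r‖)
    (Eventually.of_forall fun m => by rw [Set.uIoc_of_le hst]; exact hmeas m)
    (Eventually.of_forall fun m => Eventually.of_forall fun r _ => hbound m r) hdom
    (Eventually.of_forall fun r hr => hlim r (by rwa [Set.uIoc_of_le hst] at hr))
  refine ⟨?_, ge_of_tendsto hT (Eventually.of_forall fun m => (hFint m).2)⟩
  refine hdom.mono_fun ?_ (Eventually.of_forall fun r => ?_)
  · rw [Set.uIoc_of_le hst]
    exact aestronglyMeasurable_of_tendsto_ae atTop hmeas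
      ((ae_restrict_iff' measurableSet_Ioc).2 (Eventually.of_forall fun r hr => hlim r hr))
  · refine ((ContinuousLinearMap.le_opNorm _ _).trans
      (mul_le_mul_of_nonneg_right (hD _) (norm_nonneg _))).trans (le_abs_self _)

/-! ### The truncated `L²` energy on `L¹` -/

section TruncEnergy

variable {α : Type*} [MeasurableSpace α] {μ : Measure α}

lemma abs_clamp_le' (R x : ℝ) : |clamp R x| ≤ |R| := by
  rcases le_total 0 R with h | h
  · rw [abs_of_nonneg h]; exact abs_clamp_le h x
  · have : clamp R x = -R := max_eq_left ((min_le_right _ _).trans (by linarith))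
    rw [this, abs_neg]

lemma integrable_clamp_mul (R : ℝ) {e h : α → ℝ} (he : AEStronglyMeasurable e μ)
    (hh : Integrable h μ) : Integrable (fun x => clamp R (e x) * h x) μ :=
  hh.bdd_mul (c := |R|) ((clamp_continuous R).comp_aestronglyMeasurable he)
    (Eventually.of_forall fun _ => abs_clamp_le' R _)

/-- Testing with `T_R(e)`, as a functional on `L¹`; it is the derivative of `truncEnergy R` at
`e`. -/
noncomputable def truncPair (R : ℝ) (e : Lp ℝ 1 μ) : Lp ℝ 1 μ →L[ℝ] ℝ :=
  LinearMap.mkContinuous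
    { toFun := fun h => ∫ x, clamp R (e x) * h x ∂μ
      map_add' := fun h k => by
        rw [← integral_add (integrable_clamp_mul R (Lp.aestronglyMeasurable e)
          (L1.integrable_coeFn h)) (integrable_clamp_mul R (Lp.aestronglyMeasurable e)
          (L1.integrable_coeFn k))]
        refine integral_congr_ae ?_
        filter_upwards [Lp.coeFn_add h k] with x hx
        rw [hx, Pi.add_apply]; ring
      map_smul' := fun c h => by
        rw [RingHom.id_apply, smul_eq_mul, ← integral_const_mul]
        refine integral_congr_ae ?_
        filter_upwards [Lp.coeFn_smul c h] with x hx
        rw [hx, Pi.smul_apply, smul_eq_mul]; ring } |R| (fun h => by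
      rw [L1.norm_eq_integral_norm, ← integral_const_mul]
      refine (norm_integral_le_integral_norm _).trans (integral_mono_of_nonneg
        (Eventually.of_forall fun x => norm_nonneg _)
        ((L1.integrable_coeFn h).norm.const_mul _) (Eventually.of_forall fun x => ?_))
      simp only [norm_mul, Real.norm_eq_abs]
      exact mul_le_mul_of_nonneg_right (abs_clamp_le' R _) (abs_nonneg _))

lemma truncPair_apply (R : ℝ) (e h : Lp ℝ 1 μ) :
    truncPair R e h = ∫ x, clamp R (e x) * h x ∂μ := rfl

lemma norm_truncPair_le (R : ℝ) (e : Lp ℝ 1 μ) : ‖truncPair R e‖ ≤ |R| :=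
  LinearMap.mkContinuous_norm_le _ (abs_nonneg R) _

lemma continuous_truncPair (R : ℝ) (h : Lp ℝ 1 μ) :
    Continuous fun e : Lp ℝ 1 μ => truncPair R e h := by
  rw [continuous_iff_seqContinuous]
  intro f e hf
  refine tendsto_of_subseq_tendsto fun ns hns => ?_
  have h1 : Tendsto (fun k => f (ns k)) atTop (𝓝 e) := hf.comp hns
  obtain ⟨ms, -, hms⟩ := (tendstoInMeasure_of_tendsto_Lp h1).exists_seq_tendsto_ae
  refine ⟨ms, ?_⟩
  simp only [truncPair_apply]
  refine tendsto_integral_of_dominated_convergence (fun x => |R| * |h x|)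
    (fun k => (integrable_clamp_mul R (Lp.aestronglyMeasurable _)
      (L1.integrable_coeFn h)).aestronglyMeasurable)
    ((L1.integrable_coeFn h).abs.const_mul _)
    (fun k => Eventually.of_forall fun x => ?_) ?_
  · rw [norm_mul, Real.norm_eq_abs, Real.norm_eq_abs]
    exact mul_le_mul_of_nonneg_right (abs_clamp_le' R _) (abs_nonneg _)
  · filter_upwards [hms] with x hx
    exact (((clamp_continuous R).tendsto _).comp hx).mul_const _

/-- The convex function `x²/2` continued linearly outside `[-R, R]`. -/
noncomputable def huber (R x : ℝ) : ℝ := x * clamp R x - clamp R x ^ 2 / 2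

/-- The integral `J_R` of `huber R` over an element of `L¹`: a substitute for half the squared `L²`
norm which is finite on all of `L¹` and has a bounded derivative. -/
noncomputable def truncEnergy (R : ℝ) (e : Lp ℝ 1 μ) : ℝ := ∫ x, huber R (e x) ∂μ

lemma huber_sub_le {R : ℝ} (hR : 0 ≤ R) (a b : ℝ) :
    huber R b - huber R a ≤ clamp R b * (b - a) := by
  have key : (clamp R b - clamp R a) * (a - clamp R a) ≤ 0 := by
    rcases le_total a R with h | h
    · rcases le_total (-R) a with h' | h'
      · have : clamp R a = a := by rw [clamp, min_eq_left h, max_eq_right h']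
        rw [this]; simp
      · have : clamp R a = -R := by rw [clamp, min_eq_left h, max_eq_left h']
        rw [this]
        have := (abs_le.1 (abs_clamp_le hR b)).1
        exact mul_nonpos_of_nonneg_of_nonpos (by linarith) (by linarith)
    · have : clamp R a = R := by rw [clamp, min_eq_right h, max_eq_right (by linarith)]
      rw [this]
      have := (abs_le.1 (abs_clamp_le hR b)).2
      exact mul_nonpos_of_nonpos_of_nonneg (by linarith) (by linarith)
  unfold huber
  nlinarith [sq_nonneg (clamp R b - clamp R a)]

lemma clamp_sq_le_huber {R : ℝ} (hR : 0 ≤ R) (x : ℝ) : clamp R x ^ 2 ≤ 2 * huber R x := by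
  have := huber_sub_le hR x 0
  have h0 : clamp R 0 = 0 := by
    have := abs_clamp_le_abs hR 0
    simpa using this
  have h1 : clamp R x * clamp R x ≤ x * clamp R x := by
    have h2 := abs_clamp_le_abs hR x
    have h3 := clamp_mono R
    rcases le_total 0 x with h | h
    · have := h3 h; rw [h0] at this
      rw [abs_of_nonneg this, abs_of_nonneg h] at h2
      exact mul_le_mul_of_nonneg_right h2 this
    · have := h3 h; rw [h0] at this
      rw [abs_of_nonpos this, abs_of_nonpos h] at h2
      exact mul_le_mul_of_nonpos_right (by linarith) this
  unfold huber; nlinarith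

lemma two_mul_huber_le (R x : ℝ) : 2 * huber R x ≤ x ^ 2 := by
  unfold huber; nlinarith [sq_nonneg (x - clamp R x)]

lemma integrable_huber [IsFiniteMeasure μ] (R : ℝ) {e : α → ℝ} (he : Integrable e μ) :
    Integrable (fun x => huber R (e x)) μ := by
  refine Integrable.sub ?_ ?_
  · simpa only [mul_comm] using integrable_clamp_mul R he.aestronglyMeasurable he
  · refine (Integrable.of_bound (C := |R| ^ 2)
      (((clamp_continuous R).pow 2).comp_aestronglyMeasurable he.aestronglyMeasurable)
      (Eventually.of_forall fun x => ?_)).div_const 2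
    rw [Real.norm_eq_abs, Pi.pow_apply, abs_pow]
    exact pow_le_pow_left₀ (abs_nonneg _) (abs_clamp_le' R _) 2

lemma truncEnergy_sub_le [IsFiniteMeasure μ] {R : ℝ} (hR : 0 ≤ R) (a b : Lp ℝ 1 μ) :
    truncEnergy R b - truncEnergy R a ≤ truncPair R b (b - a) := by
  rw [truncEnergy, truncEnergy, ← integral_sub (integrable_huber R (L1.integrable_coeFn b))
    (integrable_huber R (L1.integrable_coeFn a)), truncPair_apply]
  refine integral_mono_ae ((integrable_huber R (L1.integrable_coeFn b)).sub
    (integrable_huber R (L1.integrable_coeFn a))) (integrable_clamp_mul R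
    (Lp.aestronglyMeasurable _) (L1.integrable_coeFn _)) ?_
  filter_upwards [Lp.coeFn_sub b a] with x hx
  rw [hx]; exact huber_sub_le hR _ _

lemma truncEnergy_nonneg {R : ℝ} (hR : 0 ≤ R) (e : Lp ℝ 1 μ) : 0 ≤ truncEnergy R e :=
  integral_nonneg fun x => by
    have := clamp_sq_le_huber hR (e x)
    show 0 ≤ huber R (e x)
    nlinarith [sq_nonneg (clamp R (e x))]

lemma continuous_truncEnergy [IsFiniteMeasure μ] {R : ℝ} (hR : 0 ≤ R) :
    Continuous (truncEnergy R : Lp ℝ 1 μ → ℝ) := by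
  have key : ∀ a b : Lp ℝ 1 μ, truncEnergy R b - truncEnergy R a ≤ |R| * ‖b - a‖ := fun a b =>
    (truncEnergy_sub_le hR a b).trans ((le_abs_self _).trans
      ((ContinuousLinearMap.le_opNorm _ _).trans
        (mul_le_mul_of_nonneg_right (norm_truncPair_le R b) (norm_nonneg _))))
  refine (LipschitzWith.of_dist_le' (K := |R|) fun a b => ?_).continuous
  rw [Real.dist_eq, dist_eq_norm, abs_le]
  constructor
  · have := key a b; rw [norm_sub_rev] at this; linarith
  · exact key b a

/-- Testing against `T_R(e)` costs at most the `L²` norm times `√(2 J_R(e))`. -/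
lemma integral_mul_clamp_le [IsFiniteMeasure μ] {R : ℝ} (hR : 0 ≤ R) (e : Lp ℝ 1 μ) {h : α → ℝ}
    (hh : MemLp h 2 μ) : ∫ x, clamp R (e x) * h x ∂μ ≤
      (eLpNorm h 2 μ).toReal * √(2 * truncEnergy R e) := by
  have hT : MemLp (fun x => clamp R (e x)) 2 μ :=
    MemLp.of_bound ((clamp_continuous R).comp_aestronglyMeasurable (Lp.aestronglyMeasurable e))
      |R| (Eventually.of_forall fun x => abs_clamp_le' R _)
  have h22 : ENNReal.ofReal 2 = 2 := by simp
  have h1 := integral_mul_le_Lp_mul_Lq_of_nonneg (μ := μ) (f := fun x => |h x|)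
    (g := fun x => |clamp R (e x)|) Real.HolderConjugate.two_two
    (Eventually.of_forall fun x => abs_nonneg _) (Eventually.of_forall fun x => abs_nonneg _)
    (by rw [h22]; exact hh.abs) (by rw [h22]; exact hT.abs)
  have h2 : ∫ x, clamp R (e x) * h x ∂μ ≤ ∫ x, |h x| * |clamp R (e x)| ∂μ := by
    refine integral_mono_ae (integrable_clamp_mul R (Lp.aestronglyMeasurable e)
      (hh.integrable (by norm_num))) (hh.abs.integrable_mul hT.abs)
      (Eventually.of_forall fun x => ?_)
    simp only
    rw [mul_comm, ← abs_mul]; exact le_abs_self _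
  refine h2.trans (h1.trans (mul_le_mul ?_ ?_ (by positivity) (by positivity)))
  · rw [hh.eLpNorm_eq_integral_rpow_norm (by norm_num) (by norm_num),
      ENNReal.toReal_ofReal (by positivity)]
    simp
  · rw [← Real.sqrt_eq_rpow]
    refine Real.sqrt_le_sqrt ?_
    rw [truncEnergy, ← integral_const_mul]
    refine integral_mono_of_nonneg (Eventually.of_forall fun x => by positivity)
      ((integrable_huber R (L1.integrable_coeFn e)).const_mul 2) (Eventually.of_forall fun x => ?_)
    simpa using clamp_sq_le_huber hR (e x)

/-- `2 J_R(e) ≤ ‖e‖₂²`. -/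
lemma sqrt_truncEnergy_le {R : ℝ} (e : Lp ℝ 1 μ) (he : MemLp e 2 μ) :
    √(2 * truncEnergy R e) ≤ (eLpNorm e 2 μ).toReal := by
  rw [he.eLpNorm_eq_integral_rpow_norm (by norm_num) (by norm_num),
      ENNReal.toReal_ofReal (by positivity)]
  have e1 : ((2 : ℝ≥0∞).toReal)⁻¹ = 1 / 2 := by norm_num
  rw [e1, ← Real.sqrt_eq_rpow]
  refine Real.sqrt_le_sqrt ?_
  have hi : Integrable (fun x => ‖e x‖ ^ (2 : ℝ≥0∞).toReal) μ :=
    he.integrable_norm_rpow (by norm_num) (by norm_num)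
  rw [truncEnergy, ← integral_const_mul]
  by_cases hh : Integrable (fun x => 2 * huber R (e x)) μ
  · refine integral_mono hh hi fun x => ?_
    simpa using two_mul_huber_le R (e x)
  · rw [integral_undef hh]; positivity

/-- The `L²` norm is recovered from the truncated energies. -/
lemma eLpNorm_le_of_truncEnergy_le [IsFiniteMeasure μ] {e : Lp ℝ 1 μ} {c : ℝ}
    (h : ∀ R : ℝ, 0 ≤ R → √(2 * truncEnergy R e) ≤ c) : eLpNorm e 2 μ ≤ ENNReal.ofReal c := by
  have hlim : ∀ x : α, Tendsto (fun m : ℕ => clamp m (e x)) atTop (𝓝 (e x)) := fun x => by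
    refine tendsto_const_nhds.congr' ?_
    filter_upwards [eventually_ge_atTop ⌈|e x|⌉₊] with m hm
    have := abs_le.1 (Nat.ceil_le.1 hm)
    rw [clamp, min_eq_left this.2, max_eq_right this.1]
  refine (Lp.eLpNorm_lim_le_liminf_eLpNorm (f := fun (m : ℕ) x => clamp m (e x)) (fun m =>
    (clamp_continuous _).comp_aestronglyMeasurable (Lp.aestronglyMeasurable e)) _
    (Eventually.of_forall hlim)).trans ?_
  refine (liminf_le_liminf (v := fun _ => ENNReal.ofReal c)
    (Eventually.of_forall fun m => ?_)).trans
    (by simp)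
  have hm : (0 : ℝ) ≤ m := Nat.cast_nonneg m
  have hT : MemLp (fun x => clamp m (e x)) 2 μ :=
    MemLp.of_bound ((clamp_continuous _).comp_aestronglyMeasurable (Lp.aestronglyMeasurable e))
      |(m : ℝ)| (Eventually.of_forall fun x => abs_clamp_le' _ _)
  rw [hT.eLpNorm_eq_integral_rpow_norm (by norm_num) (by norm_num)]
  refine ENNReal.ofReal_le_ofReal (le_trans ?_ (h m hm))
  have e1 : ((2 : ℝ≥0∞).toReal)⁻¹ = 1 / 2 := by norm_num
  rw [e1, ← Real.sqrt_eq_rpow]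
  refine Real.sqrt_le_sqrt ?_
  rw [truncEnergy, ← integral_const_mul]
  refine integral_mono_of_nonneg (Eventually.of_forall fun x => by positivity)
      ((integrable_huber m (L1.integrable_coeFn e)).const_mul 2) (Eventually.of_forall fun x => ?_)
  simpa using clamp_sq_le_huber hm (e x)

end TruncEnergy

/-! ### Cells, cell averages and piecewise constant functions -/

lemma measurableSet_cell (n : ℕ) (i : Fin n) : MeasurableSet (cell n i) := measurableSet_Ioc

lemma cell_subset (i : Fin n) : cell n i ⊆ Set.Ioc 0 1 := by
  have hn : (0 : ℝ) < n := by exact_mod_cast i.pos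
  refine Set.Ioc_subset_Ioc (by positivity) ?_
  rw [div_le_one hn]
  exact_mod_cast i.isLt

lemma volume_cell (i : Fin n) : volume (cell n i) = (n : ℝ≥0∞)⁻¹ := by
  have hn : (0 : ℝ) < n := by exact_mod_cast i.pos
  rw [cell, Real.volume_Ioc, ← sub_div, add_sub_cancel_left, one_div,
    ENNReal.ofReal_inv_of_pos hn, ENNReal.ofReal_natCast]

lemma cell_unique {i j : Fin n} {x : ℝ} (hi : x ∈ cell n i) (hj : x ∈ cell n j) : i = j := by
  have hn : (0 : ℝ) < n := by exact_mod_cast i.pos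
  have h1 : ((i : ℕ) : ℝ) < (j : ℕ) + 1 := (div_lt_div_iff_of_pos_right hn).1 (hi.1.trans_le hj.2)
  have h2 : ((j : ℕ) : ℝ) < (i : ℕ) + 1 := (div_lt_div_iff_of_pos_right hn).1 (hj.1.trans_le hi.2)
  have h1' : (i : ℕ) < j + 1 := by exact_mod_cast h1
  have h2' : (j : ℕ) < i + 1 := by exact_mod_cast h2
  exact Fin.ext (by omega)

lemma exists_cell (hn : 0 < n) {x : ℝ} (hx : x ∈ Set.Ioc (0 : ℝ) 1) : ∃ i, x ∈ cell n i := by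
  have hn' : (0 : ℝ) < n := by exact_mod_cast hn
  have h0 : 0 < (n : ℝ) * x := mul_pos hn' hx.1
  have h1 : 0 < ⌈(n : ℝ) * x⌉₊ := Nat.ceil_pos.2 h0
  have h2 : ⌈(n : ℝ) * x⌉₊ ≤ n := Nat.ceil_le.2 (by nlinarith [hx.2])
  refine ⟨⟨⌈(n : ℝ) * x⌉₊ - 1, by omega⟩, ?_, ?_⟩
  · rw [div_lt_iff₀ hn']
    have := Nat.ceil_lt_add_one h0.le
    push_cast [Nat.cast_sub h1]
    linarith
  · rw [le_div_iff₀ hn']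
    have := Nat.le_ceil ((n : ℝ) * x)
    push_cast [Nat.cast_sub h1]
    linarith

lemma iUnion_cell (hn : 0 < n) : ⋃ i : Fin n, cell n i = Set.Ioc (0 : ℝ) 1 := by
  ext x
  simp only [Set.mem_iUnion]
  exact ⟨fun ⟨i, hi⟩ => cell_subset i hi, exists_cell hn⟩

lemma leb_eq_sum (hn : 0 < n) :
    leb = Measure.sum fun i : Fin n => volume.restrict (cell n i) := by
  rw [← Measure.restrict_iUnion (fun i j hij => Set.disjoint_left.2 fun x hi hj =>
    hij (cell_unique hi hj)) (fun i => measurableSet_cell n i), iUnion_cell hn]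
  exact Measure.restrict_congr_set Ioc_ae_eq_Icc.symm

lemma leb_prod_eq_sum (hn : 0 < n) : leb.prod leb = Measure.sum fun ij : Fin n × Fin n =>
    volume.restrict (cell n ij.1 ×ˢ cell n ij.2) := by
  nth_rw 1 [leb_eq_sum hn]
  nth_rw 1 [leb_eq_sum hn]
  rw [Measure.prod_sum]
  congr 1; funext ij
  rw [Measure.prod_restrict]; rfl

lemma lintegral_leb (hn : 0 < n) (F : ℝ → ℝ≥0∞) :
    ∫⁻ x, F x ∂leb = ∑ i : Fin n, ∫⁻ x in cell n i, F x := by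
  rw [leb_eq_sum hn, lintegral_sum_measure, tsum_fintype]

lemma integral_leb (hn : 0 < n) {F : ℝ → ℝ} (hF : Integrable F leb) :
    ∫ x, F x ∂leb = ∑ i : Fin n, ∫ x in cell n i, F x := by
  rw [leb_eq_sum hn] at hF ⊢
  rw [integral_sum_measure hF, tsum_fintype]

lemma integral_leb_prod (hn : 0 < n) {F : ℝ × ℝ → ℝ} (hF : Integrable F (leb.prod leb)) :
    ∫ z, F z ∂(leb.prod leb) = ∑ i : Fin n, ∑ j : Fin n, ∫ z in cell n i ×ˢ cell n j, F z := by
  rw [leb_prod_eq_sum hn] at hF ⊢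
  rw [integral_sum_measure hF, tsum_fintype, Fintype.sum_prod_type]

lemma restrict_cell_le (i : Fin n) : volume.restrict (cell n i) ≤ leb :=
  Measure.restrict_mono ((cell_subset i).trans Set.Ioc_subset_Icc_self) le_rfl

lemma ae_leb_exists_cell (hn : 0 < n) : ∀ᵐ x ∂leb, ∃ i, x ∈ cell n i := by
  have : leb = volume.restrict (Set.Ioc 0 1) := Measure.restrict_congr_set Ioc_ae_eq_Icc.symm
  rw [this, ae_restrict_iff' measurableSet_Ioc]
  exact Eventually.of_forall fun x hx => exists_cell hn hx

lemma inj_apply (v : Fin n → ℝ) {i : Fin n} {x : ℝ} (hx : x ∈ cell n i) : inj n v x = v i := by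
  rw [inj, Finset.sum_eq_single i]
  · exact Set.indicator_of_mem hx _
  · exact fun j _ hj => Set.indicator_of_notMem (fun h => hj (cell_unique h hx)) _
  · simp

lemma injK_apply (A : Fin n → Fin n → ℝ) {i j : Fin n} {x y : ℝ} (hx : x ∈ cell n i)
    (hy : y ∈ cell n j) : injK n A x y = A i j := by
  rw [injK, Finset.sum_eq_single i, Finset.sum_eq_single j]
  · exact Set.indicator_of_mem (Set.mk_mem_prod hx hy) _
  · exact fun k _ hk => Set.indicator_of_notMem (fun h => hk (cell_unique h.2 hy)) _
  · simp
  · refine fun k _ hk => Finset.sum_eq_zero fun l _ => ?_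
    exact Set.indicator_of_notMem (fun h => hk (cell_unique h.1 hx)) _
  · simp

lemma measurable_inj (v : Fin n → ℝ) : Measurable (inj n v) := by
  unfold inj
  exact Finset.measurable_sum _ fun i _ => measurable_const.indicator (measurableSet_cell n i)

lemma measurable_injK (A : Fin n → Fin n → ℝ) :
    Measurable fun z : ℝ × ℝ => injK n A z.1 z.2 := by
  unfold injK
  exact Finset.measurable_sum _ fun i _ => Finset.measurable_sum _ fun j _ =>
    measurable_const.indicator ((measurableSet_cell n i).prod (measurableSet_cell n j))

lemma abs_inj_le (v : Fin n → ℝ) (x : ℝ) : |inj n v x| ≤ ∑ i, |v i| := by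
  refine (Finset.abs_sum_le_sum_abs _ _).trans (Finset.sum_le_sum fun i _ => ?_)
  by_cases h : x ∈ cell n i
  · rw [Set.indicator_of_mem h]
  · rw [Set.indicator_of_notMem h]; simp

lemma abs_injK_le (A : Fin n → Fin n → ℝ) (x y : ℝ) : |injK n A x y| ≤ ∑ i, ∑ j, |A i j| := by
  refine (Finset.abs_sum_le_sum_abs _ _).trans (Finset.sum_le_sum fun i _ =>
    (Finset.abs_sum_le_sum_abs _ _).trans (Finset.sum_le_sum fun j _ => ?_))
  by_cases h : (x, y) ∈ cell n i ×ˢ cell n j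
  · rw [Set.indicator_of_mem h]
  · rw [Set.indicator_of_notMem h]; simp

lemma memLp_inj (v : Fin n → ℝ) (q : ℝ≥0∞) : MemLp (inj n v) q leb :=
  MemLp.of_bound (measurable_inj v).aestronglyMeasurable (∑ i, |v i|)
    (Eventually.of_forall (abs_inj_le v))

lemma lintegral_comp_inj (hn : 0 < n) (v : Fin n → ℝ) (φ : ℝ → ℝ≥0∞) :
    ∫⁻ x, φ (inj n v x) ∂leb = (n : ℝ≥0∞)⁻¹ * ∑ i, φ (v i) := by
  rw [lintegral_leb hn, Finset.mul_sum]
  refine Finset.sum_congr rfl fun i _ => ?_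
  rw [setLIntegral_congr_fun (g := fun _ => φ (v i)) (measurableSet_cell n i)
    (fun x hx => by simp only [inj_apply v hx]), setLIntegral_const, volume_cell, mul_comm]

lemma eLpNorm_inj (hn : 0 < n) (v : Fin n → ℝ) {q : ℝ} (hq : 0 < q) :
    eLpNorm (inj n v) (ENNReal.ofReal q) leb = ENNReal.ofReal (lq q v) := by
  have hn' : (0 : ℝ) < n := by exact_mod_cast hn
  rw [eLpNorm_eq_lintegral_rpow_enorm_toReal (by simpa using hq) ENNReal.ofReal_ne_top,
    ENNReal.toReal_ofReal hq.le, lintegral_comp_inj hn v (fun r => ‖r‖ₑ ^ q), lq,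
    ← ENNReal.ofReal_rpow_of_nonneg (mul_nonneg (by positivity)
      (Finset.sum_nonneg fun _ _ => by positivity)) (by positivity),
    ENNReal.ofReal_mul (by positivity), ENNReal.ofReal_inv_of_pos hn', ENNReal.ofReal_natCast,
    ENNReal.ofReal_sum_of_nonneg fun _ _ => by positivity]
  have e : ∀ i, ‖v i‖ₑ ^ q = ENNReal.ofReal (|v i| ^ q) := fun i => by
    rw [← ENNReal.ofReal_rpow_of_nonneg (abs_nonneg _) hq.le, Real.enorm_eq_ofReal_abs]
  simp only [e]

lemma lq_two (v : Fin n → ℝ) : lq 2 v = l2 v := by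
  rw [lq, l2, Real.sqrt_eq_rpow]
  simp

lemma eLpNorm_inj_two (hn : 0 < n) (v : Fin n → ℝ) :
    eLpNorm (inj n v) 2 leb = ENNReal.ofReal (l2 v) := by
  rw [← lq_two, ← eLpNorm_inj hn v two_pos]; simp

lemma integral_mul_inj (hn : 0 < n) {h : ℝ → ℝ} (hh : Integrable h leb) (ψ : Fin n → ℝ) :
    ∫ x, h x * inj n ψ x ∂leb = (n : ℝ)⁻¹ * ∑ i, proj n h i * ψ i := by
  have hn' : (n : ℝ) ≠ 0 := by exact_mod_cast hn.ne'
  have hi : Integrable (fun x => h x * inj n ψ x) leb :=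
    hh.mul_bdd (c := ∑ i, |ψ i|) (measurable_inj ψ).aestronglyMeasurable
      (Eventually.of_forall (abs_inj_le ψ))
  rw [integral_leb hn hi, Finset.mul_sum]
  refine Finset.sum_congr rfl fun i _ => ?_
  rw [setIntegral_congr_fun (g := fun x => h x * ψ i) (measurableSet_cell n i)
    (fun x hx => by simp only [inj_apply ψ hx]), integral_mul_const, proj]
  field_simp

/-- Cell averaging is a contraction in `L^q`, in dual form. -/
lemma ofReal_mean_proj_mul_le (hn : 0 < n) {q q' : ℝ} (hq : q.HolderConjugate q') {h : ℝ → ℝ}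
    (hh : Integrable h leb) (ψ : Fin n → ℝ) :
    ENNReal.ofReal ((n : ℝ)⁻¹ * ∑ i, proj n h i * ψ i) ≤
      eLpNorm h (ENNReal.ofReal q) leb * ENNReal.ofReal (lq q' ψ) := by
  rw [← integral_mul_inj hn hh, ← eLpNorm_inj hn ψ hq.symm.pos]
  refine (ENNReal.ofReal_le_ofReal (le_abs_self _)).trans ?_
  rw [← Real.enorm_eq_ofReal_abs]
  refine (enorm_integral_le_lintegral_enorm _).trans ?_
  have := ENNReal.lintegral_mul_le_Lp_mul_Lq leb hq (f := fun x => ‖h x‖ₑ)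
    (g := fun x => ‖inj n ψ x‖ₑ) hh.aestronglyMeasurable.enorm (measurable_inj ψ).enorm.aemeasurable
  rw [eLpNorm_eq_lintegral_rpow_enorm_toReal (by simpa using hq.pos) ENNReal.ofReal_ne_top,
    eLpNorm_eq_lintegral_rpow_enorm_toReal (by simpa using hq.symm.pos) ENNReal.ofReal_ne_top,
    ENNReal.toReal_ofReal hq.nonneg, ENNReal.toReal_ofReal hq.symm.nonneg]
  simpa [enorm_mul] using this

lemma lq_proj_le (hn : 0 < n) {q q' : ℝ} (hq : q.HolderConjugate q') {h : ℝ → ℝ}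
    (hh : MemLp h (ENNReal.ofReal q) leb) :
    lq q (proj n h) ≤ (eLpNorm h (ENNReal.ofReal q) leb).toReal := by
  refine lq_le_of_dual hq ENNReal.toReal_nonneg ?_
  have hi : Integrable h leb := hh.integrable (by
    rw [ENNReal.one_le_ofReal]; exact hq.lt.le)
  have := ofReal_mean_proj_mul_le hn hq hi (fun i => Psi q (proj n h i))
  have h2 := ENNReal.toReal_mono (ENNReal.mul_ne_top hh.2.ne ENNReal.ofReal_ne_top) this
  rw [ENNReal.toReal_mul, ENNReal.toReal_ofReal (lq_nonneg _ _)] at h2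
  refine le_trans ?_ h2
  simp only [mul_Psi hq.lt]
  exact le_of_eq (ENNReal.toReal_ofReal (mul_nonneg (by positivity)
    (Finset.sum_nonneg fun _ _ => by positivity))).symm

lemma l2_proj_le (hn : 0 < n) {h : ℝ → ℝ} (hh : MemLp h 2 leb) :
    l2 (proj n h) ≤ (eLpNorm h 2 leb).toReal := by
  have := lq_proj_le hn Real.HolderConjugate.two_two (h := h) (by simpa using hh)
  rw [lq_two] at this
  simpa using this

lemma proj_sub {h k : ℝ → ℝ} (hh : Integrable h leb) (hk : Integrable k leb) (i : Fin n) :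
    proj n (fun x => h x - k x) i = proj n h i - proj n k i := by
  rw [proj, proj, proj, integral_sub (hh.mono_measure (restrict_cell_le i))
    (hk.mono_measure (restrict_cell_le i)), mul_sub]

lemma enorm_proj_le (h : ℝ → ℝ) (i : Fin n) : ‖proj n h i‖ₑ ≤ eLpNorm h ∞ leb := by
  have hn : (0 : ℝ) < n := by exact_mod_cast i.pos
  rw [proj, enorm_mul]
  have h1 : ‖∫ x in cell n i, h x‖ₑ ≤ eLpNorm h ∞ leb * (n : ℝ≥0∞)⁻¹ := by
    refine (enorm_integral_le_lintegral_enorm _).trans ?_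
    rw [← volume_cell i, ← setLIntegral_const]
    refine lintegral_mono_ae ?_
    refine Filter.Eventually.filter_mono (ae_mono (restrict_cell_le i)) ?_
    rw [eLpNorm_exponent_top]
    exact ae_le_eLpNormEssSup
  calc ‖(n : ℝ)‖ₑ * ‖∫ x in cell n i, h x‖ₑ ≤ n * (eLpNorm h ∞ leb * (n : ℝ≥0∞)⁻¹) := by
        rw [show ‖(n : ℝ)‖ₑ = (n : ℝ≥0∞) by simp]
        gcongr
    _ = eLpNorm h ∞ leb := by
        rw [mul_comm, mul_assoc, ENNReal.inv_mul_cancel (by simpa using i.pos.ne') (by simp),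
          mul_one]

/-! ### Time integrals of cell averages -/

lemma measurable_proj {h : ℝ → ℝ → ℝ} (hm : Measurable fun z : ℝ × ℝ => h z.1 z.2) (i : Fin n) :
    Measurable fun r => proj n (h r) i := by
  unfold proj
  exact (hm.stronglyMeasurable.integral_prod_right
    (ν := volume.restrict (cell n i))).measurable.const_mul _

lemma enorm_proj_le_two (h : ℝ → ℝ) (hm : AEStronglyMeasurable h leb) (i : Fin n) :
    ‖proj n h i‖ₑ ≤ n * eLpNorm h 2 leb := by
  rw [proj, enorm_mul, show ‖(n : ℝ)‖ₑ = (n : ℝ≥0∞) by simp]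
  gcongr
  refine (enorm_integral_le_lintegral_enorm _).trans
    ((lintegral_mono' (restrict_cell_le i) le_rfl).trans ?_)
  rw [← eLpNorm_one_eq_lintegral_enorm]
  have : IsProbabilityMeasure leb := ⟨by simp⟩
  exact eLpNorm_le_eLpNorm_of_exponent_le (by norm_num) hm

/-- Uniform `L²` bounds make the cell averages integrable in time. -/
lemma intervalIntegrable_proj {h : ℝ → ℝ → ℝ} (hm : Measurable fun z : ℝ × ℝ => h z.1 z.2)
    {a b C : ℝ} (hab : a ≤ b) (hC : ∀ r ∈ Set.Icc a b, eLpNorm (h r) 2 leb ≤ ENNReal.ofReal C)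
    (i : Fin n) : IntervalIntegrable (fun r => proj n (h r) i) volume a b := by
  rw [intervalIntegrable_iff_integrableOn_Icc_of_le hab]
  refine Measure.integrableOn_of_bounded (M := n * |C|) (by simp)
    (measurable_proj hm i).aestronglyMeasurable ?_
  refine (ae_restrict_iff' measurableSet_Icc).2 (Eventually.of_forall fun r hr => ?_)
  have h1 := (enorm_proj_le_two (h r) (hm.comp measurable_prodMk_left).aestronglyMeasurable i).trans
    (mul_le_mul_right (hC r hr) (n : ℝ≥0∞))
  have h2 := ENNReal.toReal_mono (by finiteness) h1
  rw [toReal_enorm, ENNReal.toReal_mul, ENNReal.toReal_natCast, ENNReal.toReal_ofReal'] at h2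
  refine h2.trans (mul_le_mul_of_nonneg_left (max_le (le_abs_self _) (abs_nonneg _))
    (Nat.cast_nonneg _))

lemma mean_integral_proj_mul_le (hn : 0 < n) {q q' : ℝ} (hq : q.HolderConjugate q')
    {h : ℝ → ℝ → ℝ} (hm : Measurable fun z : ℝ × ℝ => h z.1 z.2) {a b C : ℝ} (hab : a ≤ b)
    (hC : ∀ r ∈ Set.Icc a b, eLpNorm (h r) 2 leb ≤ ENNReal.ofReal C)
    (hfin : ∫⁻ r in Set.Ioc a b, eLpNorm (h r) (ENNReal.ofReal q) leb ≠ ∞) (ψ : Fin n → ℝ) :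
    (n : ℝ)⁻¹ * ∑ i, (∫ r in a..b, proj n (h r) i) * ψ i ≤
      (∫⁻ r in Set.Ioc a b, eLpNorm (h r) (ENNReal.ofReal q) leb).toReal * lq q' ψ := by
  have hii := fun i : Fin n => intervalIntegrable_proj hm hab hC i
  have e : (n : ℝ)⁻¹ * ∑ i, (∫ r in a..b, proj n (h r) i) * ψ i =
      ∫ r in a..b, (n : ℝ)⁻¹ * ∑ i, proj n (h r) i * ψ i := by
    rw [intervalIntegral.integral_const_mul, intervalIntegral.integral_finsetSum
      fun i _ => (hii i).mul_const _]
    simp only [intervalIntegral.integral_mul_const]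
  rw [e, intervalIntegral.integral_of_le hab]
  have hGi : IntegrableOn (fun r => (n : ℝ)⁻¹ * ∑ i, proj n (h r) i * ψ i) (Set.Ioc a b) := by
    refine Integrable.const_mul (integrable_finsetSum _ fun i _ => ?_) _
    exact (hii i).1.mul_const _
  have h1 : ∫ r in Set.Ioc a b, (n : ℝ)⁻¹ * ∑ i, proj n (h r) i * ψ i ≤
      (∫⁻ r in Set.Ioc a b, ENNReal.ofReal ((n : ℝ)⁻¹ * ∑ i, proj n (h r) i * ψ i)).toReal := by
    rw [integral_eq_lintegral_pos_part_sub_lintegral_neg_part hGi]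
    linarith [ENNReal.toReal_nonneg (a := ∫⁻ r in Set.Ioc a b,
      ENNReal.ofReal (-((n : ℝ)⁻¹ * ∑ i, proj n (h r) i * ψ i)))]
  refine h1.trans ?_
  rw [← ENNReal.toReal_ofReal (lq_nonneg q' ψ), ← ENNReal.toReal_mul,
    ← lintegral_mul_const' _ _ ENNReal.ofReal_ne_top]
  refine ENNReal.toReal_mono ?_ (setLIntegral_mono' measurableSet_Ioc fun r hr => ?_)
  · rw [lintegral_mul_const' _ _ ENNReal.ofReal_ne_top]
    exact ENNReal.mul_ne_top hfin ENNReal.ofReal_ne_top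
  · refine ofReal_mean_proj_mul_le hn hq ?_ ψ
    have : MemLp (h r) 2 leb := ⟨(hm.comp measurable_prodMk_left).aestronglyMeasurable,
      (hC r ⟨hr.1.le, hr.2⟩).trans_lt ENNReal.ofReal_lt_top⟩
    exact this.integrable (by norm_num)

/-- Minkowski's inequality for the time integral of cell averages. -/
lemma l2_integral_proj_le (hn : 0 < n)
    {h : ℝ → ℝ → ℝ} (hm : Measurable fun z : ℝ × ℝ => h z.1 z.2) {a b c : ℝ} (hab : a ≤ b)
    (hc : 0 ≤ c) (hC : ∀ r ∈ Set.Icc a b, eLpNorm (h r) 2 leb ≤ ENNReal.ofReal c) :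
    l2 (fun i : Fin n => ∫ r in a..b, proj n (h r) i) ≤ (b - a) * c := by
  have h2 : ENNReal.ofReal 2 = 2 := by simp
  have hle : ∫⁻ r in Set.Ioc a b, eLpNorm (h r) (ENNReal.ofReal 2) leb ≤
      ENNReal.ofReal ((b - a) * c) := by
    rw [h2, mul_comm, ENNReal.ofReal_mul hc, ← Real.volume_Ioc, ← setLIntegral_const]
    exact setLIntegral_mono' measurableSet_Ioc fun r hr => hC r ⟨hr.1.le, hr.2⟩
  have := mean_integral_proj_mul_le hn Real.HolderConjugate.two_two hm hab hC
    (ne_top_of_le_ne_top ENNReal.ofReal_ne_top hle) (fun i => ∫ r in a..b, proj n (h r) i)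
  have hnn : 0 ≤ (b - a) * c := mul_nonneg (by linarith) hc
  refine l2_le_of_sq_le hnn ?_
  rw [lq_two] at this
  rw [l2_sq]
  simp only [← sq] at this
  refine this.trans (mul_le_mul_of_nonneg_right ?_ (l2_nonneg _))
  have := ENNReal.toReal_mono ENNReal.ofReal_ne_top hle
  rwa [ENNReal.toReal_ofReal hnn] at this

/-! ### Kernels and their cell averages -/

instance isProbabilityMeasure_leb : IsProbabilityMeasure leb := ⟨by simp⟩

/-- Cauchy–Schwarz in squared form. -/
lemma sq_lintegral_mul_le {α : Type*} [MeasurableSpace α] {μ : Measure α} {f h : α → ℝ}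
    (hf : AEStronglyMeasurable f μ) (hh : AEStronglyMeasurable h μ) :
    (∫⁻ y, ‖f y‖ₑ * ‖h y‖ₑ ∂μ) ^ 2 ≤ eLpNorm f 2 μ ^ 2 * ∫⁻ y, ‖h y‖ₑ ^ 2 ∂μ := by
  have h1 := ENNReal.lintegral_mul_le_Lp_mul_Lq μ Real.HolderConjugate.two_two
    (f := fun x => ‖f x‖ₑ) (g := fun x => ‖h x‖ₑ) hf.enorm hh.enorm
  have h2 := pow_le_pow_left₀ (zero_le) h1 2
  have e : ∀ k : α → ℝ, ((∫⁻ y, ‖k y‖ₑ ^ (2 : ℝ) ∂μ) ^ (1 / (2 : ℝ))) ^ 2 =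
      ∫⁻ y, ‖k y‖ₑ ^ 2 ∂μ := by
    intro k
    rw [← ENNReal.rpow_natCast, ← ENNReal.rpow_mul]
    norm_num
  have e2 : eLpNorm f 2 μ ^ 2 = ∫⁻ y, ‖f y‖ₑ ^ 2 ∂μ := by
    rw [← e f, eLpNorm_eq_lintegral_rpow_enorm_toReal (by norm_num) (by norm_num)]
    norm_num
  rw [mul_pow, e f, e h] at h2
  rw [e2]
  exact h2

lemma eLpNorm_two_sq {α : Type*} [MeasurableSpace α] {μ : Measure α} (f : α → ℝ) :
    eLpNorm f 2 μ ^ 2 = ∫⁻ y, ‖f y‖ₑ ^ 2 ∂μ := by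
  rw [eLpNorm_eq_lintegral_rpow_enorm_toReal (by norm_num) (by norm_num), ← ENNReal.rpow_natCast,
    ← ENNReal.rpow_mul]
  norm_num

lemma ae_eLpNorm_le_normLinf (q : ℝ≥0∞) (F : ℝ → ℝ → ℝ) :
    ∀ᵐ x ∂leb, eLpNorm (F x) q leb ≤ normLinf q F := ae_le_essSup

lemma normL2sq_sq {F : ℝ → ℝ → ℝ} (hF : Measurable fun z : ℝ × ℝ => F z.1 z.2) :
    normL2sq F ^ 2 = ∫⁻ x, eLpNorm (F x) 2 leb ^ 2 ∂leb := by
  simp only [eLpNorm_two_sq]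
  rw [normL2sq, eLpNorm_two_sq, lintegral_prod _ (hF.enorm.pow_const 2).aemeasurable]

lemma normL2sq_le_normLinf {F : ℝ → ℝ → ℝ} (hF : Measurable fun z : ℝ × ℝ => F z.1 z.2) :
    normL2sq F ≤ normLinf 2 F := by
  rw [← ENNReal.pow_le_pow_left_iff (two_ne_zero), normL2sq_sq hF]
  calc ∫⁻ x, eLpNorm (F x) 2 leb ^ 2 ∂leb ≤ ∫⁻ _, normLinf 2 F ^ 2 ∂leb := by
        refine lintegral_mono_ae ?_
        filter_upwards [ae_eLpNorm_le_normLinf 2 F] with x hx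
        exact pow_le_pow_left₀ zero_le hx 2
    _ = _ := by simp

lemma IsKernel.memLp {K : ℝ → ℝ → ℝ} (hK : IsKernel K) :
    MemLp (fun z : ℝ × ℝ => K z.1 z.2) 2 (leb.prod leb) :=
  ⟨hK.measurable.aestronglyMeasurable, (normL2sq_le_normLinf hK.measurable).trans_lt hK.bounded⟩

lemma IsKernel.integrable {K : ℝ → ℝ → ℝ} (hK : IsKernel K) :
    Integrable (fun z : ℝ × ℝ => K z.1 z.2) (leb.prod leb) :=
  hK.memLp.integrable (by norm_num)

lemma IsKernel.ae_nonneg_symm {K : ℝ → ℝ → ℝ} (hK : IsKernel K) :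
    ∀ᵐ z : ℝ × ℝ ∂(leb.prod leb), 0 ≤ K z.1 z.2 ∧ K z.2 z.1 = K z.1 z.2 := by
  rw [Measure.prod_restrict, ae_restrict_iff' (measurableSet_Icc.prod measurableSet_Icc)]
  exact Eventually.of_forall fun z hz =>
    ⟨hK.nonneg _ hz.1 _ hz.2, hK.symm _ hz.2 _ hz.1⟩

lemma cell_subset_Icc (i : Fin n) : cell n i ⊆ Set.Icc 0 1 :=
  (cell_subset i).trans Set.Ioc_subset_Icc_self

lemma IsKernel.projK_nonneg {K : ℝ → ℝ → ℝ} (hK : IsKernel K) (i j : Fin n) :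
    0 ≤ projK n K i j := by
  refine mul_nonneg (by positivity) (setIntegral_nonneg
    ((measurableSet_cell n i).prod (measurableSet_cell n j)) fun z hz => ?_)
  exact hK.nonneg _ (cell_subset_Icc i hz.1) _ (cell_subset_Icc j hz.2)

lemma IsKernel.projK_symm {K : ℝ → ℝ → ℝ} (hK : IsKernel K) (i j : Fin n) :
    projK n K i j = projK n K j i := by
  unfold projK
  congr 1
  rw [Measure.volume_eq_prod, ← Measure.prod_restrict, ← Measure.prod_restrict,
    ← integral_prod_swap]
  simp only [Prod.fst_swap, Prod.snd_swap]
  rw [Measure.prod_restrict]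
  refine setIntegral_congr_fun ((measurableSet_cell n j).prod (measurableSet_cell n i))
    fun z hz => ?_
  exact hK.symm _ (cell_subset_Icc i hz.2) _ (cell_subset_Icc j hz.1)

/-- The row sums of the averaged kernel are bounded by the `L^{∞,1}` norm, hence by the `L^{∞,2}`
norm. -/
lemma IsKernel.mean_projK_le {K : ℝ → ℝ → ℝ} (hK : IsKernel K) (i : Fin n) :
    (n : ℝ)⁻¹ * ∑ j, projK n K i j ≤ (normLinf 2 K).toReal := by
  have hn : 0 < n := i.pos
  have hn' : (n : ℝ) ≠ 0 := by exact_mod_cast hn.ne'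
  have e : (n : ℝ)⁻¹ * ∑ j, projK n K i j = n * ∑ j, ∫ z in cell n i ×ˢ cell n j, K z.1 z.2 := by
    rw [Finset.mul_sum, Finset.mul_sum]
    refine Finset.sum_congr rfl fun j _ => ?_
    rw [projK]; field_simp
  rw [e]
  have h1 : ∀ j : Fin n, ‖∫ z in cell n i ×ˢ cell n j, K z.1 z.2‖ₑ ≤
      ∫⁻ x in cell n i, ∫⁻ y in cell n j, ‖K x y‖ₑ := fun j => by
    refine (enorm_integral_le_lintegral_enorm _).trans (le_of_eq ?_)
    rw [Measure.volume_eq_prod, ← Measure.prod_restrict,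
      lintegral_prod _ hK.measurable.enorm.aemeasurable]
  have h2 : ∑ j, ‖∫ z in cell n i ×ˢ cell n j, K z.1 z.2‖ₑ ≤ normLinf 2 K * (n : ℝ≥0∞)⁻¹ := by
    refine (Finset.sum_le_sum fun j _ => h1 j).trans ?_
    rw [← lintegral_finsetSum _ fun j _ => hK.measurable.enorm.lintegral_prod_right',
      ← volume_cell i, ← setLIntegral_const]
    refine lintegral_mono_ae ?_
    filter_upwards [Filter.Eventually.filter_mono (ae_mono (restrict_cell_le i))
      (ae_eLpNorm_le_normLinf 2 K)] with x hx
    rw [← lintegral_leb hn fun y => ‖K x y‖ₑ, ← eLpNorm_one_eq_lintegral_enorm]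
    exact (eLpNorm_le_eLpNorm_of_exponent_le (by norm_num)
      (hK.measurable.comp measurable_prodMk_left).aestronglyMeasurable).trans hx
  have h3 : ‖(n : ℝ) * ∑ j, ∫ z in cell n i ×ˢ cell n j, K z.1 z.2‖ₑ ≤ normLinf 2 K := by
    rw [enorm_mul, show ‖(n : ℝ)‖ₑ = (n : ℝ≥0∞) by simp]
    calc (n : ℝ≥0∞) * ‖∑ j, ∫ z in cell n i ×ˢ cell n j, K z.1 z.2‖ₑ
        ≤ n * (normLinf 2 K * (n : ℝ≥0∞)⁻¹) := by
          gcongr; exact (enorm_sum_le _ _).trans h2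
      _ = _ := by
        rw [mul_comm, mul_assoc, ENNReal.inv_mul_cancel (by simpa using hn.ne') (by simp), mul_one]
  have h4 := ENNReal.toReal_mono hK.bounded.ne h3
  rw [toReal_enorm, Real.norm_eq_abs] at h4
  exact (le_abs_self _).trans h4

/-- Against piecewise constant functions a kernel may be replaced by its cell averages. -/
lemma integral_mul_injK (hn : 0 < n) {F : ℝ → ℝ → ℝ}
    (hF : Integrable (fun z : ℝ × ℝ => F z.1 z.2) (leb.prod leb)) (A : Fin n → Fin n → ℝ) :
    Integrable (fun z : ℝ × ℝ => F z.1 z.2 * injK n A z.1 z.2) (leb.prod leb) ∧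
    ∫ z, F z.1 z.2 * injK n A z.1 z.2 ∂(leb.prod leb) =
      (n : ℝ)⁻¹ * ∑ i, (n : ℝ)⁻¹ * ∑ j, projK n F i j * A i j := by
  have hn' : (n : ℝ) ≠ 0 := by exact_mod_cast hn.ne'
  have hi : Integrable (fun z : ℝ × ℝ => F z.1 z.2 * injK n A z.1 z.2) (leb.prod leb) :=
    hF.mul_bdd (c := ∑ i, ∑ j, |A i j|) (measurable_injK A).aestronglyMeasurable
      (Eventually.of_forall fun z => abs_injK_le A _ _)
  refine ⟨hi, ?_⟩
  rw [integral_leb_prod hn hi, Finset.mul_sum]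
  refine Finset.sum_congr rfl fun i _ => ?_
  rw [← mul_assoc, Finset.mul_sum]
  refine Finset.sum_congr rfl fun j _ => ?_
  rw [setIntegral_congr_fun (g := fun z : ℝ × ℝ => F z.1 z.2 * A i j)
    ((measurableSet_cell n i).prod (measurableSet_cell n j))
    (fun z hz => by simp only [injK_apply A hz.1 hz.2]), integral_mul_const, projK]
  field_simp

/-- The weights of the deterministic scheme: cell averages of the kernel, divided by `n`, so that
sums over cells become integrals. -/
noncomputable def avgWeight (n : ℕ) (K : ℝ → ℝ → ℝ) (i j : Fin n) : ℝ := (n : ℝ)⁻¹ * projK n K i j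

lemma IsKernel.avgWeight_nonneg {K : ℝ → ℝ → ℝ} (hK : IsKernel K) (i j : Fin n) :
    0 ≤ avgWeight n K i j := mul_nonneg (by positivity) (hK.projK_nonneg i j)

lemma IsKernel.avgWeight_symm {K : ℝ → ℝ → ℝ} (hK : IsKernel K) (i j : Fin n) :
    avgWeight n K i j = avgWeight n K j i := by rw [avgWeight, hK.projK_symm, avgWeight]

lemma IsKernel.sum_avgWeight_le {K : ℝ → ℝ → ℝ} (hK : IsKernel K) (i : Fin n) :
    ∑ j, avgWeight n K i j ≤ (normLinf 2 K).toReal := by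
  have := hK.mean_projK_le i
  rwa [Finset.mul_sum] at this

/-! ### Consistency errors -/

/-- The consistency error: a bound, in `L²`, for the effect on the nonlocal operator at `w` of
perturbing the kernel by `D`. -/
noncomputable def consErr (p : ℝ) (D : ℝ → ℝ → ℝ) (w : ℝ → ℝ) : ℝ≥0∞ :=
  (∫⁻ x, (∫⁻ y, ‖D x y‖ₑ * ‖Psi p (w y - w x)‖ₑ ∂leb) ^ 2 ∂leb) ^ (1 / 2 : ℝ)

lemma consErr_sq (p : ℝ) (D : ℝ → ℝ → ℝ) (w : ℝ → ℝ) : consErr p D w ^ 2 =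
    ∫⁻ x, (∫⁻ y, ‖D x y‖ₑ * ‖Psi p (w y - w x)‖ₑ ∂leb) ^ 2 ∂leb := by
  rw [consErr, ← ENNReal.rpow_natCast, ← ENNReal.rpow_mul]; norm_num

lemma eLpNorm_le_consErr {p : ℝ} {D : ℝ → ℝ → ℝ} {w h : ℝ → ℝ}
    (hh : ∀ᵐ x ∂leb, ‖h x‖ₑ ≤ ∫⁻ y, ‖D x y‖ₑ * ‖Psi p (w y - w x)‖ₑ ∂leb) :
    eLpNorm h 2 leb ≤ consErr p D w := by
  rw [← ENNReal.pow_le_pow_left_iff two_ne_zero, consErr_sq, eLpNorm_two_sq]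
  refine lintegral_mono_ae ?_
  filter_upwards [hh] with x hx
  exact pow_le_pow_left₀ zero_le hx 2

lemma consErr_le_of_sq_mean {p : ℝ} (hp : 1 < p) {D : ℝ → ℝ → ℝ}
    (hD : Measurable fun z : ℝ × ℝ => D z.1 z.2) {w : ℝ → ℝ} (hw : Measurable w) {M : ℝ}
    (hM : ∫⁻ x, ∫⁻ y, ‖Psi p (w y - w x)‖ₑ ^ 2 ∂leb ∂leb ≤ ENNReal.ofReal M ^ 2) :
    consErr p D w ≤ ENNReal.ofReal M * normLinf 2 D := by
  rw [← ENNReal.pow_le_pow_left_iff two_ne_zero, consErr_sq, mul_pow]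
  have hΨ : ∀ x, AEStronglyMeasurable (fun y => Psi p (w y - w x)) leb := fun x =>
    ((Psi_continuous hp).measurable.comp (hw.sub_const _)).aestronglyMeasurable
  have hm : Measurable fun x => ∫⁻ y, ‖Psi p (w y - w x)‖ₑ ^ 2 ∂leb := by
    refine Measurable.lintegral_prod_right' (f := fun z : ℝ × ℝ => ‖Psi p (w z.2 - w z.1)‖ₑ ^ 2) ?_
    exact ((Psi_continuous hp).measurable.comp
      ((hw.comp measurable_snd).sub (hw.comp measurable_fst))).enorm.pow_const 2
  calc ∫⁻ x, (∫⁻ y, ‖D x y‖ₑ * ‖Psi p (w y - w x)‖ₑ ∂leb) ^ 2 ∂leb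
      ≤ ∫⁻ x, normLinf 2 D ^ 2 * ∫⁻ y, ‖Psi p (w y - w x)‖ₑ ^ 2 ∂leb ∂leb := by
        refine lintegral_mono_ae ?_
        filter_upwards [ae_eLpNorm_le_normLinf 2 D] with x hx
        refine (sq_lintegral_mul_le (hD.comp measurable_prodMk_left).aestronglyMeasurable
          (hΨ x)).trans ?_
        gcongr
        exact hx
    _ = normLinf 2 D ^ 2 * ∫⁻ x, ∫⁻ y, ‖Psi p (w y - w x)‖ₑ ^ 2 ∂leb ∂leb :=
        lintegral_const_mul _ hm
    _ ≤ _ := by rw [mul_comm]; gcongr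

lemma consErr_le_of_bounded {p : ℝ} (hp : 1 < p) {D : ℝ → ℝ → ℝ}
    (hD : Measurable fun z : ℝ × ℝ => D z.1 z.2) {w : ℝ → ℝ} (hw : Measurable w) {M : ℝ}
    (hM : ∀ x y, |Psi p (w y - w x)| ≤ M) :
    consErr p D w ≤ ENNReal.ofReal M * normL2sq D := by
  rw [← ENNReal.pow_le_pow_left_iff two_ne_zero, consErr_sq, mul_pow, normL2sq_sq hD]
  have hΨ : ∀ x, AEStronglyMeasurable (fun y => Psi p (w y - w x)) leb := fun x =>
    ((Psi_continuous hp).measurable.comp (hw.sub_const _)).aestronglyMeasurable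
  rw [← lintegral_const_mul' _ _ (by finiteness)]
  refine lintegral_mono fun x => ?_
  refine (sq_lintegral_mul_le (hD.comp measurable_prodMk_left).aestronglyMeasurable
          (hΨ x)).trans ?_
  rw [mul_comm]
  refine mul_le_mul' ?_ le_rfl
  calc ∫⁻ y, ‖Psi p (w y - w x)‖ₑ ^ 2 ∂leb ≤ ∫⁻ _, ENNReal.ofReal M ^ 2 ∂leb := by
        refine lintegral_mono fun y => ?_
        rw [Real.enorm_eq_ofReal_abs]
        gcongr
        exact hM x y
    _ = _ := by simp

/-- The vector of `A`-consistency errors of the averaged kernel. -/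
lemma measurable_kernelErr {K : ℝ → ℝ → ℝ} (hK : IsKernel K) :
    Measurable fun z : ℝ × ℝ => kernelErr n K z.1 z.2 :=
  (measurable_injK _).sub hK.measurable

lemma integral_injK_mul (hn : 0 < n) (A : Fin n → Fin n → ℝ) (p : ℝ) (w : Fin n → ℝ) {i : Fin n}
    {x : ℝ} (hx : x ∈ cell n i) :
    Integrable (fun y => injK n A x y * Psi p (inj n w y - inj n w x)) leb ∧
    ∫ y, injK n A x y * Psi p (inj n w y - inj n w x) ∂leb =
      gen p (fun i j => (n : ℝ)⁻¹ * A i j) w i := by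
  have e : ∀ᵐ y ∂leb, injK n A x y * Psi p (inj n w y - inj n w x) =
      1 * inj n (fun j => A i j * Psi p (w j - w i)) y := by
    filter_upwards [ae_leb_exists_cell hn] with y ⟨j, hj⟩
    rw [injK_apply A hx hj, inj_apply w hx, inj_apply w hj, inj_apply _ hj, one_mul]
  refine ⟨?_, ?_⟩
  · refine Integrable.congr ?_ (e.mono fun y hy => hy.symm)
    simpa using (memLp_inj (fun j => A i j * Psi p (w j - w i)) 1).integrable le_rfl
  rw [integral_congr_ae e, integral_mul_inj hn (integrable_const 1), gen, Finset.mul_sum]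
  refine Finset.sum_congr rfl fun j _ => ?_
  have hn' : (n : ℝ) ≠ 0 := by exact_mod_cast hn.ne'
  have : proj n (fun _ => (1 : ℝ)) j = 1 := by
    simp [proj, Measure.real, volume_cell, hn']
  rw [this]; ring

/-! ### Comparison of one time step with the continuum solution -/

lemma integral_antisymm_mul {H : ℝ × ℝ → ℝ} (hH : Integrable H (leb.prod leb))
    (hanti : ∀ᵐ z ∂(leb.prod leb), H z.swap = -H z) {φ : ℝ → ℝ}
    (hφ : AEStronglyMeasurable φ leb) {R : ℝ} (hb : ∀ x, |φ x| ≤ R) :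
    ∫ z, H z * φ z.1 ∂(leb.prod leb) =
      1 / 2 * ∫ z, H z * (φ z.1 - φ z.2) ∂(leb.prod leb) := by
  have i1 : Integrable (fun z => H z * φ z.1) (leb.prod leb) :=
    hH.mul_bdd (c := R) hφ.comp_fst (Eventually.of_forall fun z => hb _)
  have i2 : Integrable (fun z => H z * φ z.2) (leb.prod leb) :=
    hH.mul_bdd (c := R) hφ.comp_snd (Eventually.of_forall fun z => hb _)
  have h2 : ∫ z, H z * φ z.2 ∂(leb.prod leb) = -∫ z, H z * φ z.1 ∂(leb.prod leb) := by
    rw [← integral_prod_swap, ← integral_neg]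
    refine integral_congr_ae ?_
    filter_upwards [hanti] with z hz
    rw [hz, Prod.snd_swap]; ring
  simp only [mul_sub]
  rw [integral_sub i1 i2, h2]; ring

lemma ae_prod_exists_cell (hn : 0 < n) : ∀ᵐ z : ℝ × ℝ ∂(leb.prod leb),
    ∃ i j : Fin n, z.1 ∈ cell n i ∧ z.2 ∈ cell n j := by
  have h := ae_leb_exists_cell hn
  filter_upwards [Measure.quasiMeasurePreserving_fst.ae h,
    Measure.quasiMeasurePreserving_snd.ae h] with z ⟨i, hi⟩ ⟨j, hj⟩
  exact ⟨i, j, hi, hj⟩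

lemma defect_eq {p : ℝ} {W : Fin n → Fin n → ℝ} (hW : ∀ i j, W i j = W j i) (w w' : Fin n → ℝ) :
    defect p W w w' = 1 / 2 * ((n : ℝ)⁻¹ * ∑ i, ∑ j, W i j *
      ((Psi p (w j - w i) - Psi p (w' j - w' i)) * ((w j - w i) - (w' j - w' i)))) := by
  have h := sum_gen_sub_mul (p := p) hW w w'
  have e : ∑ i, (gen p W w' i - gen p W w i) * (w i - w' i) =
      -∑ i, (gen p W w i - gen p W w' i) * (w i - w' i) := by
    rw [← Finset.sum_neg_distrib]; exact Finset.sum_congr rfl fun i _ => by ring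
  rw [defect, e, h]; ring

lemma integrable_kernel_mul_Psi_inj {p : ℝ} {K : ℝ → ℝ → ℝ} (hK : IsKernel K)
    (hn : 0 < n) (w : Fin n → ℝ) :
    Integrable (fun z : ℝ × ℝ => K z.1 z.2 * Psi p (inj n w z.2 - inj n w z.1))
      (leb.prod leb) := by
  refine (integral_mul_injK hn hK.integrable (fun i j => Psi p (w j - w i))).1.congr ?_
  filter_upwards [ae_prod_exists_cell hn] with z ⟨i, j, hi, hj⟩
  rw [injK_apply _ hi hj, inj_apply w hi, inj_apply w hj]

/-- The monotonicity estimate between a piecewise constant function `w₁` and an arbitrary function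
`u` in the domain, tested with the truncation of `wt - u`, where `wt` lies between `w₀` and `w₁`.
The outcome depends on the vectors `w₀` and `w₁` alone. -/
lemma flux_le_defect {p : ℝ} (hp : 1 < p) {K : ℝ → ℝ → ℝ} (hK : IsKernel K) (hn : 0 < n)
    {w₀ w₁ wt : Fin n → ℝ}
    (h1 : ∀ i j, min (w₁ j - w₁ i) (w₀ j - w₀ i) ≤ wt j - wt i)
    (h2 : ∀ i j, wt j - wt i ≤ max (w₁ j - w₁ i) (w₀ j - w₀ i))
    {u : ℝ → ℝ} (hu : InDom p K u) {R : ℝ} (hR : 0 ≤ R) :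
    ∫ x, clamp R (inj n wt x - u x) * (∫ y, (K x y * Psi p (inj n w₁ y - inj n w₁ x) -
      K x y * Psi p (u y - u x)) ∂leb) ∂leb ≤ defect p (avgWeight n K) w₁ w₀ := by
  set φ : ℝ → ℝ := fun x => clamp R (inj n wt x - u x) with hφdef
  have hφ : AEStronglyMeasurable φ leb := (clamp_continuous R).comp_aestronglyMeasurable
    ((measurable_inj wt).aestronglyMeasurable.sub hu.1.aestronglyMeasurable)
  have hφb : ∀ x, |φ x| ≤ R := fun x => abs_clamp_le hR _
  set H : ℝ × ℝ → ℝ := fun z => K z.1 z.2 * Psi p (inj n w₁ z.2 - inj n w₁ z.1) -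
      K z.1 z.2 * Psi p (u z.2 - u z.1) with hHdef
  have hH : Integrable H (leb.prod leb) := (integrable_kernel_mul_Psi_inj hK hn w₁).sub hu.2
  have hanti : ∀ᵐ z ∂(leb.prod leb), H z.swap = -H z := by
    filter_upwards [hK.ae_nonneg_symm] with z hz
    simp only [hHdef, Prod.fst_swap, Prod.snd_swap]
    rw [hz.2, ← neg_sub (inj n w₁ z.2), ← neg_sub (u z.2), Psi_neg, Psi_neg]; ring
  have hHφ : Integrable (fun z => H z * φ z.1) (leb.prod leb) :=
    hH.mul_bdd (c := R) hφ.comp_fst (Eventually.of_forall fun z => hφb _)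
  have e1 : ∫ x, φ x * (∫ y, (K x y * Psi p (inj n w₁ y - inj n w₁ x) -
      K x y * Psi p (u y - u x)) ∂leb) ∂leb = ∫ z, H z * φ z.1 ∂(leb.prod leb) := by
    rw [integral_prod _ hHφ]
    refine integral_congr_ae (Eventually.of_forall fun x => ?_)
    simp only [hHdef]
    rw [integral_mul_const, mul_comm]
  rw [e1, integral_antisymm_mul hH hanti hφ hφb]
  set A : Fin n → Fin n → ℝ := fun i j => (Psi p (w₁ j - w₁ i) - Psi p (w₀ j - w₀ i)) *
    ((w₁ j - w₁ i) - (w₀ j - w₀ i))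
  obtain ⟨iA, eA⟩ := integral_mul_injK hn hK.integrable A
  have e2 : defect p (avgWeight n K) w₁ w₀ =
      1 / 2 * ∫ z, K z.1 z.2 * injK n A z.1 z.2 ∂(leb.prod leb) := by
    rw [eA, defect_eq hK.avgWeight_symm]
    congr 2
    refine Finset.sum_congr rfl fun i _ => ?_
    rw [Finset.mul_sum]
    exact Finset.sum_congr rfl fun j _ => by rw [avgWeight, mul_assoc]
  rw [e2]
  refine mul_le_mul_of_nonneg_left (integral_mono_ae ?_ iA ?_) (by norm_num)
  · exact hH.mul_bdd (c := R + R) (hφ.comp_fst.sub hφ.comp_snd)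
      (Eventually.of_forall fun z => (norm_sub_le _ _).trans (add_le_add (hφb _) (hφb _)))
  filter_upwards [hK.ae_nonneg_symm, ae_prod_exists_cell hn] with z hz ⟨i, j, hi, hj⟩
  rw [injK_apply A hi hj]
  have key := monotone_cross_le (Psi_mono hp) (a := w₁ j - w₁ i) (c := w₀ j - w₀ i)
    (c' := wt j - wt i) (u := u z.2 - u z.1) (d := φ z.2 - φ z.1) (h1 i j) (h2 i j) ?_ ?_
  · have : H z * (φ z.1 - φ z.2) = K z.1 z.2 * ((Psi p (u z.2 - u z.1) - Psi p (w₁ j - w₁ i)) *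
        (φ z.2 - φ z.1)) := by
      simp only [hHdef, inj_apply w₁ hi, inj_apply w₁ hj]; ring
    rw [this]
    exact mul_le_mul_of_nonneg_left key hz.1
  all_goals
    simp only [hφdef, inj_apply wt hi, inj_apply wt hj]
    rcases le_total (wt j - u z.2) (wt i - u z.1) with h | h
    · have a1 := clamp_mono R h
      have a2 := clamp_sub_le (R := R) h
      first
      | exact (min_le_right _ _).trans (by linarith)
      | exact le_trans (by linarith) (le_max_left _ _)
    · have a1 := clamp_mono R h
      have a2 := clamp_sub_le (R := R) h
      first
      | exact (min_le_left _ _).trans (by linarith)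
      | exact le_trans (by linarith) (le_max_right _ _)

/-- The piecewise constant extension as an element of `L¹`. -/
noncomputable def injL (v : Fin n → ℝ) : Lp ℝ 1 leb := (memLp_inj v 1).toLp (inj n v)

lemma coeFn_injL (v : Fin n → ℝ) : injL v =ᵐ[leb] inj n v := MemLp.coeFn_toLp _

lemma inj_add_mul (v c : Fin n → ℝ) (t x : ℝ) :
    inj n (fun i => v i + t * c i) x = inj n v x + t * inj n c x := by
  unfold inj
  rw [Finset.mul_sum, ← Finset.sum_add_distrib]
  refine Finset.sum_congr rfl fun i _ => ?_
  by_cases h : x ∈ cell n i <;> simp [h]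

lemma injL_add_mul (v c : Fin n → ℝ) (t : ℝ) :
    injL (fun i => v i + t * c i) = injL v + t • injL c := by
  refine Lp.ext ?_
  filter_upwards [coeFn_injL (fun i => v i + t * c i), coeFn_injL v, coeFn_injL c,
    Lp.coeFn_add (injL v) (t • injL c), Lp.coeFn_smul t (injL c)] with x h1 h2 h3 h4 h5
  rw [h1, h4, Pi.add_apply, h5, Pi.smul_apply, h2, h3, inj_add_mul]; rfl

lemma measurable_eLpNorm_two {h : ℝ → ℝ → ℝ} (hm : Measurable fun z : ℝ × ℝ => h z.1 z.2) :
    Measurable fun r => eLpNorm (h r) 2 leb := by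
  have : (fun r => eLpNorm (h r) 2 leb) =
      fun r => (∫⁻ x, ‖h r x‖ₑ ^ (2 : ℝ) ∂leb) ^ (1 / 2 : ℝ) := by
    funext r
    rw [eLpNorm_eq_lintegral_rpow_enorm_toReal (by norm_num) (by norm_num)]
    norm_num
  rw [this]
  exact (Measurable.lintegral_prod_right' (f := fun z : ℝ × ℝ => ‖h z.1 z.2‖ₑ ^ (2 : ℝ))
    (hm.enorm.pow_const 2)).pow_const _

/-- The rate at which errors other than the defect enter at time `r` of a step: discretization of
the source and consistency of the averaged kernel. -/
noncomputable def errRate (p : ℝ) (K f : ℝ → ℝ → ℝ) (F w : Fin n → ℝ) (r : ℝ) : ℝ :=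
  (eLpNorm (fun x => inj n F x - f r x) 2 leb).toReal + (consErr p (kernelErr n K) (inj n w)).toReal

lemma memLp_source {f : ℝ → ℝ → ℝ} (hfm : Measurable fun z : ℝ × ℝ => f z.1 z.2)
    {r C : ℝ} (hC : eLpNorm (f r) 2 leb ≤ ENNReal.ofReal C) : MemLp (f r) 2 leb :=
  ⟨(hfm.comp measurable_prodMk_left).aestronglyMeasurable, hC.trans_lt ENNReal.ofReal_lt_top⟩

lemma intervalIntegrable_sourceErr {f : ℝ → ℝ → ℝ}
    (hfm : Measurable fun z : ℝ × ℝ => f z.1 z.2) {a b C : ℝ} (hab : a ≤ b)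
    (hC : ∀ r ∈ Set.Icc a b, eLpNorm (f r) 2 leb ≤ ENNReal.ofReal C) (F : Fin n → ℝ) :
    IntervalIntegrable (fun r => (eLpNorm (fun x => inj n F x - f r x) 2 leb).toReal)
      volume a b := by
  rw [intervalIntegrable_iff_integrableOn_Icc_of_le hab]
  refine Measure.integrableOn_of_bounded
    (M := (eLpNorm (inj n F) 2 leb + ENNReal.ofReal C).toReal) (by simp) ?_ ?_
  · exact (measurable_eLpNorm_two (h := fun r x => inj n F x - f r x)
      (((measurable_inj F).comp measurable_snd).sub hfm)).ennreal_toReal.aestronglyMeasurable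
  · refine (ae_restrict_iff' measurableSet_Icc).2 (Eventually.of_forall fun r hr => ?_)
    rw [Real.norm_eq_abs, abs_of_nonneg ENNReal.toReal_nonneg]
    refine ENNReal.toReal_mono (ENNReal.add_ne_top.2 ⟨(memLp_inj F 2).2.ne, by simp⟩) ?_
    refine (eLpNorm_sub_le (memLp_inj F 2).1 (memLp_source hfm (hC r hr)).1 (by norm_num)).trans ?_
    gcongr
    exact hC r hr

lemma consErr_kernelErr_ne_top {p : ℝ} (hp : 1 < p) {K : ℝ → ℝ → ℝ} (hK : IsKernel K)
    (w : Fin n → ℝ) : consErr p (kernelErr n K) (inj n w) ≠ ∞ := by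
  have hb : ∀ x y, |Psi p (inj n w y - inj n w x)| ≤ (2 * ∑ i, |w i|) ^ (p - 1) := fun x y => by
    rw [abs_Psi hp]
    refine Real.rpow_le_rpow (abs_nonneg _) ?_ (by linarith)
    have := abs_sub (inj n w y) (inj n w x)
    linarith [abs_inj_le w x, abs_inj_le w y]
  have h := consErr_le_of_bounded hp (measurable_kernelErr (n := n) hK) (measurable_inj w) hb
  refine ne_top_of_le_ne_top (ENNReal.mul_ne_top ENNReal.ofReal_ne_top ?_) h
  have : MemLp (fun z : ℝ × ℝ => injK n (projK n K) z.1 z.2) 2 (leb.prod leb) :=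
    MemLp.of_bound (measurable_injK _).aestronglyMeasurable _
      (Eventually.of_forall fun z => abs_injK_le (projK n K) z.1 z.2)
  exact (this.sub hK.memLp).2.ne

/-- The differential inequality for the truncated energy of the error.  The residual of the
interpolant `wt` splits into the source error, the consistency error of the averaged kernel, and a
difference of fluxes which is estimated by monotonicity. -/
lemma truncPair_rate_le {p : ℝ} (hp : 1 < p) {K : ℝ → ℝ → ℝ} (hK : IsKernel K) (hn : 0 < n)
    {f : ℝ → ℝ → ℝ} (hfm : Measurable fun z : ℝ × ℝ => f z.1 z.2) {r C : ℝ}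
    (hC : eLpNorm (f r) 2 leb ≤ ENNReal.ofReal C) {w₀ w₁ wt F : Fin n → ℝ}
    (h1 : ∀ i j, min (w₁ j - w₁ i) (w₀ j - w₀ i) ≤ wt j - wt i)
    (h2 : ∀ i j, wt j - wt i ≤ max (w₁ j - w₁ i) (w₀ j - w₀ i))
    {u v : Lp ℝ 1 leb} (hu : InDom p K u)
    (hv : (v : ℝ → ℝ) =ᵐ[leb] fun x => -pLap p K u x + f r x) {R : ℝ} (hR : 0 ≤ R) :
    truncPair R (injL wt - u) (injL (fun i => gen p (avgWeight n K) w₁ i + F i) - v) ≤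
      errRate p K f F w₁ r * √(2 * truncEnergy R (injL wt - u)) +
        defect p (avgWeight n K) w₁ w₀ := by
  set e : Lp ℝ 1 leb := injL wt - u
  have he : e =ᵐ[leb] fun x => inj n wt x - u x := by
    filter_upwards [Lp.coeFn_sub (injL wt) u, coeFn_injL wt] with x hx hx2
    rw [hx, Pi.sub_apply, hx2]
  -- the flux of the piecewise constant function, the flux of `u`, and their difference
  set a : ℝ → ℝ := fun x => ∫ y, K x y * Psi p (inj n w₁ y - inj n w₁ x) ∂leb with ha
  set b : ℝ → ℝ := fun x => ∫ y, (K x y * Psi p (inj n w₁ y - inj n w₁ x) -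
      K x y * Psi p (u y - u x)) ∂leb with hb
  set hs : ℝ → ℝ := fun x => inj n F x - f r x with hhs
  set hc : ℝ → ℝ := fun x => inj n (gen p (avgWeight n K) w₁) x - a x with hhc
  have iw := integrable_kernel_mul_Psi_inj (p := p) hK hn w₁
  have ia : Integrable a leb := iw.integral_prod_left
  have ib : Integrable b leb := (iw.sub hu.2).integral_prod_left
  have ms : MemLp hs 2 leb := (memLp_inj F 2).sub (memLp_source hfm hC)
  have hcle : eLpNorm hc 2 leb ≤ consErr p (kernelErr n K) (inj n w₁) := by
    refine eLpNorm_le_consErr ?_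
    filter_upwards [iw.prod_right_ae, ae_leb_exists_cell hn] with x hx ⟨i, hi⟩
    obtain ⟨j1, j2⟩ := integral_injK_mul hn (projK n K) p w₁ hi
    have : hc x = ∫ y, kernelErr n K x y * Psi p (inj n w₁ y - inj n w₁ x) ∂leb := by
      simp only [hhc, ha, kernelErr, sub_mul]
      rw [integral_sub j1 hx, j2, inj_apply _ hi]; rfl
    rw [this]
    refine (enorm_integral_le_lintegral_enorm _).trans (le_of_eq ?_)
    simp only [enorm_mul]
  have mc : MemLp hc 2 leb := ⟨(measurable_inj _).aestronglyMeasurable.sub ia.aestronglyMeasurable,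
    hcle.trans_lt (consErr_kernelErr_ne_top hp hK w₁).lt_top⟩
  have hsum : (injL (fun i => gen p (avgWeight n K) w₁ i + F i) - v : Lp ℝ 1 leb) =ᵐ[leb]
      fun x => (hs x + hc x) + b x := by
    filter_upwards [Lp.coeFn_sub (injL (fun i => gen p (avgWeight n K) w₁ i + F i)) v,
      coeFn_injL (fun i => gen p (avgWeight n K) w₁ i + F i), hv, iw.prod_right_ae,
      hu.2.prod_right_ae] with x g1 g2 g3 g4 g5
    have e1 := inj_add_mul (gen p (avgWeight n K) w₁) F 1 x
    simp only [one_mul] at e1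
    have e2 : b x = a x + pLap p K u x := by
      simp only [hb, ha, pLap]
      rw [integral_sub g4 g5]; ring
    rw [g1, Pi.sub_apply, g2, g3, e1, e2]
    simp only [hhs, hhc]; ring
  have is := ms.integrable (by norm_num)
  have ic := mc.integrable (by norm_num)
  have me := Lp.aestronglyMeasurable e
  have hsplit : truncPair R e (injL (fun i => gen p (avgWeight n K) w₁ i + F i) - v) =
      (∫ x, clamp R (e x) * hs x ∂leb) + (∫ x, clamp R (e x) * hc x ∂leb) +
        ∫ x, clamp R (e x) * b x ∂leb := by
    have isc : Integrable (fun x => clamp R (e x) * hs x + clamp R (e x) * hc x) leb :=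
      (integrable_clamp_mul R me is).add (integrable_clamp_mul R me ic)
    rw [truncPair_apply, ← integral_add (integrable_clamp_mul R me is)
      (integrable_clamp_mul R me ic), ← integral_add isc (integrable_clamp_mul R me ib)]
    refine integral_congr_ae ?_
    filter_upwards [hsum] with x hx
    rw [hx]; ring
  have t1 := integral_mul_clamp_le hR e ms
  have t2 := (integral_mul_clamp_le hR e mc).trans (mul_le_mul_of_nonneg_right
    (ENNReal.toReal_mono (consErr_kernelErr_ne_top hp hK w₁) hcle) (Real.sqrt_nonneg _))
  have t3 : ∫ x, clamp R (e x) * b x ∂leb ≤ defect p (avgWeight n K) w₁ w₀ := by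
    refine le_of_eq_of_le (integral_congr_ae ?_) (flux_le_defect hp hK hn h1 h2 hu hR)
    filter_upwards [he] with x hx
    rw [hx]
  rw [hsplit, errRate, add_mul]
  linarith

/-- The error estimate over one time step `[s₀, s₁]`, for the affine interpolation between `w₀`
and `w₁`. -/
lemma step_error_le {p T : ℝ} (hp : 1 < p) {K : ℝ → ℝ → ℝ} (hK : IsKernel K) (hn : 0 < n)
    {g : ℝ → ℝ} {f : ℝ → ℝ → ℝ} (hfm : Measurable fun z : ℝ × ℝ => f z.1 z.2) {C : ℝ}
    (hC : ∀ r ∈ Set.Icc 0 T, eLpNorm (f r) 2 leb ≤ ENNReal.ofReal C)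
    {u : ℝ → Lp ℝ 1 leb} (hu : IsSolution p T K g f u) {s₀ s₁ : ℝ} (h0 : 0 ≤ s₀) (h01 : s₀ < s₁)
    (h1T : s₁ ≤ T) {w₀ w₁ F : Fin n → ℝ}
    (hw : ∀ i, w₁ i = w₀ i + (s₁ - s₀) * (gen p (avgWeight n K) w₁ i + F i)) {R : ℝ} (hR : 0 ≤ R)
    {t : ℝ} (ht : t ∈ Set.Icc s₀ s₁) :
    √(2 * truncEnergy R
      (injL (fun i => w₀ i + (t - s₀) * (gen p (avgWeight n K) w₁ i + F i)) - u t)) ≤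
      √(√(2 * truncEnergy R (injL w₀ - u s₀)) ^ 2 +
        2 * ((s₁ - s₀) * defect p (avgWeight n K) w₁ w₀)) +
      ∫ r in s₀..s₁, errRate p K f F w₁ r := by
  obtain ⟨huc, -, v, hvi, huv, hae⟩ := hu
  set c : Fin n → ℝ := fun i => gen p (avgWeight n K) w₁ i + F i with hc
  set wt : ℝ → Fin n → ℝ := fun r i => w₀ i + (r - s₀) * c i with hwt
  set e : ℝ → Lp ℝ 1 leb := fun r => injL (wt r) - u r with he
  set β := defect p (avgWeight n K) w₁ w₀ with hβdef
  have hβ : 0 ≤ β := by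
    rw [hβdef, defect]
    have := sum_gen_sub_mul_nonpos hp hK.avgWeight_symm hK.avgWeight_nonneg w₁ w₀
    refine mul_nonneg (by positivity) ?_
    rw [← neg_nonneg, ← Finset.sum_neg_distrib] at this
    exact this.trans_eq (Finset.sum_congr rfl fun i _ => by ring)
  have hsubT : Set.Icc s₀ s₁ ⊆ Set.Icc 0 T := Set.Icc_subset_Icc h0 h1T
  have hei : ∀ r, e r = injL w₀ + (r - s₀) • injL c - u r := fun r => by
    simp only [he, hwt]; rw [injL_add_mul]
  have hec : ContinuousOn e (Set.Icc s₀ s₁) := by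
    have : e = fun r => injL w₀ + (r - s₀) • injL c - u r := funext hei
    rw [this]
    exact ContinuousOn.sub (by fun_prop) (huc.mono hsubT)
  have hvT : IntervalIntegrable v volume 0 T := by
    rw [intervalIntegrable_iff_integrableOn_Ioo_of_le (by linarith)]
    exact hvi
  have hvsub : ∀ a ∈ Set.Icc 0 T, ∀ b ∈ Set.Icc 0 T, IntervalIntegrable v volume a b :=
    fun a ha b hb => hvT.mono_set (by
      rw [Set.uIcc_of_le (by linarith : (0 : ℝ) ≤ T)]; exact Set.uIcc_subset_Icc ha hb)
  have hee : ∀ a ∈ Set.Icc s₀ s₁, ∀ b ∈ Set.Icc s₀ s₁, a ≤ b →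
      e b - e a = ∫ r in a..b, (injL c - v r) := by
    intro a ha b hb _
    have ha' := hsubT ha
    have hb' := hsubT hb
    have hz : (0 : ℝ) ∈ Set.Icc 0 T := ⟨le_rfl, by linarith⟩
    rw [intervalIntegral.integral_sub (by simp) (hvsub a ha' b hb'),
      intervalIntegral.integral_const, hei, hei, huv b hb', huv a ha',
      ← intervalIntegral.integral_add_adjacent_intervals (hvsub 0 hz a ha') (hvsub a ha' b hb')]
    module
  set q : ℝ → ℝ := fun r => √(2 * truncEnergy R (e r)) with hq
  have hqc : ContinuousOn q (Set.Icc s₀ s₁) :=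
    (continuousOn_const.mul ((continuous_truncEnergy hR).comp_continuousOn hec)).sqrt
  have hqsq : ∀ r, q r ^ 2 = 2 * truncEnergy R (e r) := fun r =>
    Real.sq_sqrt (mul_nonneg two_pos.le (truncEnergy_nonneg hR _))
  set α := errRate p K f F w₁ with hα
  have hα0 : ∀ r, 0 ≤ α r := fun r => add_nonneg ENNReal.toReal_nonneg ENNReal.toReal_nonneg
  have hαi : IntervalIntegrable α volume s₀ s₁ :=
    (intervalIntegrable_sourceErr hfm h01.le (fun r hr => hC r (hsubT hr)) F).add
      (by simp)
  have hkey : ∀ s ∈ Set.Icc s₀ s₁, ∀ t ∈ Set.Icc s₀ s₁, s ≤ t →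
      q t ^ 2 - q s ^ 2 ≤ 2 * (∫ r in s..t, α r * q r) + 2 * β * (t - s) := by
    intro s hs t ht hst
    have hsub : Set.Icc s t ⊆ Set.Icc s₀ s₁ := Set.Icc_subset_Icc hs.1 ht.2
    obtain ⟨hi, hle⟩ := convex_chain_rule (J := truncEnergy R) (D := truncPair R)
      (truncEnergy_sub_le hR) (norm_truncPair_le R) (continuous_truncPair R) hst
      (hec.mono hsub) (e' := fun r => injL c - v r)
      ((by simp : IntervalIntegrable (fun _ => injL c) volume s t).sub
        (hvsub s (hsubT hs) t (hsubT ht)))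
      (fun a ha b hb hab => hee a (hsub ha) b (hsub hb) hab)
    have hαst : IntervalIntegrable (fun r => α r * q r) volume s t := by
      refine (hαi.mono_set ?_).mul_continuousOn (hqc.mono ?_)
      · rw [Set.uIcc_of_le h01.le, Set.uIcc_of_le hst]; exact hsub
      · rw [Set.uIcc_of_le hst]; exact hsub
    have hmono : ∫ r in s..t, truncPair R (e r) (injL c - v r) ≤
        ∫ r in s..t, (α r * q r + β) := by
      refine intervalIntegral.integral_mono_ae_restrict hst hi (hαst.add (by simp)) ?_
      have hae' : ∀ᵐ r ∂(volume.restrict (Set.Icc s t)), InDom p K (u r) ∧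
          (v r : ℝ → ℝ) =ᵐ[leb] fun x => -pLap p K (u r) x + f r x := by
        rw [← restrict_Ioo_eq_restrict_Icc]
        exact ae_restrict_of_ae_restrict_of_subset
          (Set.Ioo_subset_Ioo (hsubT hs).1 (hsubT ht).2) hae
      filter_upwards [hae', ae_restrict_mem measurableSet_Icc] with r hr hrm
      have hrm' := hsub hrm
      refine truncPair_rate_le hp hK hn hfm (hC r (hsubT hrm')) (fun i j => ?_) (fun i j => ?_)
        hr.1 hr.2 hR
      all_goals
        rw [hw i, hw j]
        simp only [hwt, hc]
        set ci := gen p (avgWeight n K) w₁ i + F i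
        set cj := gen p (avgWeight n K) w₁ j + F j
        have g1 : 0 ≤ r - s₀ := by linarith [hrm'.1]
        have g2 : 0 ≤ s₁ - r := by linarith [hrm'.2]
        rcases le_total ci cj with h | h
        · have k1 := mul_nonneg g1 (sub_nonneg.2 h)
          have k2 := mul_nonneg g2 (sub_nonneg.2 h)
          first
          | exact (min_le_right _ _).trans (by linarith)
          | exact le_trans (by linarith) (le_max_left _ _)
        · have k1 := mul_nonneg g1 (sub_nonneg.2 h)
          have k2 := mul_nonneg g2 (sub_nonneg.2 h)
          first
          | exact (min_le_left _ _).trans (by linarith)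
          | exact le_trans (by linarith) (le_max_right _ _)
    rw [intervalIntegral.integral_add hαst (by simp), intervalIntegral.integral_const,
      smul_eq_mul] at hmono
    rw [hqsq, hqsq]
    linarith
  have hsub : Set.Icc s₀ t ⊆ Set.Icc s₀ s₁ := Set.Icc_subset_Icc_right ht.2
  have hfin := gronwall_sq_add ht.1 hβ (hqc.mono hsub)
    (hαi.mono_set (by rw [Set.uIcc_of_le h01.le, Set.uIcc_of_le ht.1]; exact hsub))
    (fun r _ => hα0 r) (fun s hs r hr hsr => hkey s (hsub hs) r (hsub hr) hsr)
  have e0 : q s₀ = √(2 * truncEnergy R (injL w₀ - u s₀)) := by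
    simp only [hq, he, hwt, sub_self, zero_mul, add_zero]
  rw [e0] at hfin
  refine hfin.trans (add_le_add (Real.sqrt_le_sqrt ?_) ?_)
  · have := mul_le_mul_of_nonneg_right (by linarith [ht.2] : t - s₀ ≤ s₁ - s₀) hβ
    linarith
  · exact intervalIntegral.integral_mono_interval le_rfl ht.1 ht.2
      (Eventually.of_forall hα0) hαi

/-! ### Sources of bounded variation -/

/-- A source of bounded variation is controlled by a monotone function of time, namely its
variation `V t` on `[0, t]`. -/
lemma MemBV.exists_monotone {T : ℝ} (hT : 0 < T) {f : ℝ → ℝ → ℝ} (hf : MemBV T 2 f) :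
    ∃ V : ℝ → ℝ, MonotoneOn V (Set.Icc 0 T) ∧ ∀ s ∈ Set.Icc 0 T, ∀ t ∈ Set.Icc 0 T, s ≤ t →
      eLpNorm (fun x => f t x - f s x) 2 leb ≤ ENNReal.ofReal (V t - V s) := by
  obtain ⟨hm, h0, hV⟩ := hf
  have hmt : ∀ t, AEStronglyMeasurable (f t) leb := fun t =>
    (hm.comp measurable_prodMk_left).aestronglyMeasurable
  have hz : (0 : ℝ) ∈ Set.Icc 0 T := ⟨le_rfl, hT.le⟩
  have hmem : ∀ t ∈ Set.Icc 0 T, MemLp (f t) 2 leb := by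
    intro t ht
    have h1 : eLpNorm (fun x => f t x - f 0 x) 2 leb ≤ timeVar T 2 f := by
      let u : ℕ → ℝ := fun i => if i = 0 then 0 else t
      have hu : Monotone u ∧ ∀ i, u i ∈ Set.Icc 0 T := by
        constructor
        · intro i j hij
          by_cases hi : i = 0
          · by_cases hj : j = 0 <;> simp [u, hi, hj, ht.1]
          · have hj : j ≠ 0 := by omega
            simp [u, hi, hj]
        · intro i; by_cases hi : i = 0 <;> simp [u, hi, hT.le, ht.1, ht.2]
      refine le_trans ?_ (le_iSup₂ (f := fun (N : ℕ)
        (t : {t : ℕ → ℝ // Monotone t ∧ ∀ i, t i ∈ Set.Icc 0 T}) =>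
        ∑ i ∈ Finset.range N, eLpNorm (fun x => f (t.1 (i + 1)) x - f (t.1 i) x) 2 leb) 1 ⟨u, hu⟩)
      simp [u]
    have h2 : MemLp (fun x => f t x - f 0 x) 2 leb := ⟨(hmt t).sub (hmt 0), h1.trans_lt hV⟩
    have := h2.add h0
    refine this.ae_eq (Eventually.of_forall fun x => ?_)
    simp
  classical
  let F : ℝ → Lp ℝ 2 leb := fun t => if h : MemLp (f t) 2 leb then h.toLp else 0
  have hF : ∀ s ∈ Set.Icc 0 T, ∀ t ∈ Set.Icc 0 T,
      edist (F t) (F s) = eLpNorm (fun x => f t x - f s x) 2 leb := by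
    intro s hs t ht
    simp only [F, dif_pos (hmem s hs), dif_pos (hmem t ht)]
    rw [Lp.edist_toLp_toLp]; rfl
  have hvar : eVariationOn F (Set.Icc 0 T) ≤ timeVar T 2 f := by
    refine iSup_le fun ⟨N, u⟩ => ?_
    refine le_trans (le_of_eq ?_) (le_iSup₂ (f := fun (N : ℕ)
        (t : {t : ℕ → ℝ // Monotone t ∧ ∀ i, t i ∈ Set.Icc 0 T}) =>
        ∑ i ∈ Finset.range N, eLpNorm (fun x => f (t.1 (i + 1)) x - f (t.1 i) x) 2 leb) N u)
    exact Finset.sum_congr rfl fun i _ => hF _ (u.2.2 i) _ (u.2.2 (i + 1))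
  have hfin : ∀ t ∈ Set.Icc 0 T, eVariationOn F (Set.Icc 0 t) ≠ ∞ := fun t ht =>
    ne_top_of_le_ne_top hV.ne ((eVariationOn.mono F (Set.Icc_subset_Icc_right ht.2)).trans hvar)
  refine ⟨fun t => (eVariationOn F (Set.Icc 0 t)).toReal, fun s hs t ht hst =>
    ENNReal.toReal_mono (hfin t ht) (eVariationOn.mono F (Set.Icc_subset_Icc_right hst)),
    fun s hs t ht hst => ?_⟩
  have hadd := eVariationOn.Icc_add_Icc F (s := Set.univ) hs.1 hst (Set.mem_univ s)
  simp only [Set.univ_inter] at hadd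
  have hfs : eVariationOn F (Set.Icc s t) ≠ ∞ :=
    ne_top_of_le_ne_top (hfin t ht) (eVariationOn.mono F (Set.Icc_subset_Icc_left hs.1))
  beta_reduce
  rw [← hF s hs t ht, ← hadd, ENNReal.toReal_add (hfin s hs) hfs, add_sub_cancel_left,
    ENNReal.ofReal_toReal hfs]
  exact eVariationOn.edist_le F ⟨hst, le_rfl⟩ ⟨le_rfl, hst⟩

/-- A time grid `0 = s 0 < ⋯ < s N = T` with `N` steps. It is a sequence on `ℕ`, so that sums over
steps range over `Finset.range`; beyond `N` it is only required to be monotone. -/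
structure IsGrid (T : ℝ) (N : ℕ) (s : ℕ → ℝ) : Prop where
  zero : s 0 = 0
  last : s N = T
  mono : Monotone s
  lt : ∀ k < N, s k < s (k + 1)

lemma IsGrid.mem {T : ℝ} {N : ℕ} {s : ℕ → ℝ} (h : IsGrid T N s) {k : ℕ} (hk : k ≤ N) :
    s k ∈ Set.Icc 0 T := ⟨h.zero ▸ h.mono (Nat.zero_le k), h.last ▸ h.mono hk⟩

/-- The discrete source along a grid, with the value at time `0` prepended. -/
noncomputable def gridSource (n : ℕ) (f : ℝ → ℝ → ℝ) (s : ℕ → ℝ) : ℕ → Fin n → ℝ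
  | 0 => proj n (f 0)
  | k + 1 => fun i => (s (k + 1) - s k)⁻¹ * ∫ r in s k..s (k + 1), proj n (f r) i

lemma sum_setLIntegral_grid (F : ℝ → ℝ≥0∞) {s : ℕ → ℝ} (hs : Monotone s) (N : ℕ) :
    ∑ k ∈ Finset.range N, ∫⁻ r in Set.Ioc (s k) (s (k + 1)), F r =
      ∫⁻ r in Set.Ioc (s 0) (s N), F r := by
  induction N with
  | zero => simp
  | succ N ih =>
    rw [Finset.sum_range_succ, ih, ← lintegral_union measurableSet_Ioc,
      Set.Ioc_union_Ioc_eq_Ioc (hs (Nat.zero_le N)) (hs (Nat.le_succ N))]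
    exact Set.disjoint_left.2 fun x hx hy => absurd hx.2 (not_le.2 hy.1)

lemma sum_setLIntegral_grid_le {T : ℝ} {N : ℕ} {s : ℕ → ℝ} (h : IsGrid T N s) (F : ℝ → ℝ≥0∞) :
    ∑ k ∈ Finset.range N, ∫⁻ r in Set.Ioc (s k) (s (k + 1)), F r ≤ ∫⁻ r in Set.Icc 0 T, F r := by
  rw [sum_setLIntegral_grid F h.mono, h.zero, h.last]
  exact lintegral_mono_set Set.Ioc_subset_Icc_self

section BV

variable {T : ℝ} {f : ℝ → ℝ → ℝ} {V : ℝ → ℝ}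

/-- The source is bounded in `L²`, uniformly in time. -/
lemma exists_source_bound (hT : 0 < T) (hf : MemBV T 2 f) :
    ∃ C : ℝ, ∀ r ∈ Set.Icc 0 T, eLpNorm (f r) 2 leb ≤ ENNReal.ofReal C := by
  obtain ⟨V, hV, hfV⟩ := hf.exists_monotone hT
  have hz : (0 : ℝ) ∈ Set.Icc 0 T := ⟨le_rfl, hT.le⟩
  have hT' : T ∈ Set.Icc 0 T := ⟨hT.le, le_rfl⟩
  refine ⟨(eLpNorm (f 0) 2 leb).toReal + (V T - V 0), fun r hr => ?_⟩
  have hmt : ∀ t, AEStronglyMeasurable (f t) leb := fun t =>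
    (hf.1.comp measurable_prodMk_left).aestronglyMeasurable
  have e : f r = fun x => f 0 x + (f r x - f 0 x) := by funext x; ring
  rw [ENNReal.ofReal_add ENNReal.toReal_nonneg (sub_nonneg.2 (hV hz hT' hT.le)),
    ENNReal.ofReal_toReal hf.2.1.2.ne, e]
  refine (eLpNorm_add_le (hmt 0) ((hmt r).sub (hmt 0)) (by norm_num)).trans ?_
  gcongr
  refine (hfV 0 hz r hr hr.1).trans (ENNReal.ofReal_le_ofReal ?_)
  linarith [hV hr hT' hr.2]

/-- The average of the source over a time step differs from its value at any time `a` of the step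
by at most the variation over the step. -/
lemma l2_gridSource_sub_proj_le (hn : 0 < n) (hfm : Measurable fun z : ℝ × ℝ => f z.1 z.2)
    {C : ℝ} (hC : ∀ r ∈ Set.Icc 0 T, eLpNorm (f r) 2 leb ≤ ENNReal.ofReal C)
    (hV : MonotoneOn V (Set.Icc 0 T)) (hfV : ∀ s ∈ Set.Icc 0 T, ∀ t ∈ Set.Icc 0 T, s ≤ t →
      eLpNorm (fun x => f t x - f s x) 2 leb ≤ ENNReal.ofReal (V t - V s))
    {N : ℕ} {s : ℕ → ℝ} (hs : IsGrid T N s) {k : ℕ} (hk : k < N) {a : ℝ}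
    (ha : a ∈ Set.Icc (s k) (s (k + 1))) :
    l2 (fun i : Fin n => gridSource n f s (k + 1) i - proj n (f a) i) ≤
      V (s (k + 1)) - V (s k) := by
  have hlt := hs.lt k hk
  have hm0 := hs.mem hk.le
  have hm1 := hs.mem (show k + 1 ≤ N from hk)
  have hsub : Set.Icc (s k) (s (k + 1)) ⊆ Set.Icc 0 T := Set.Icc_subset_Icc hm0.1 hm1.2
  have haT := hsub ha
  have hpos : 0 < s (k + 1) - s k := by linarith
  have hint : ∀ r ∈ Set.Icc 0 T, Integrable (f r) leb := fun r hr =>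
    (memLp_source hfm (hC r hr)).integrable (by norm_num)
  have e : (fun i : Fin n => gridSource n f s (k + 1) i - proj n (f a) i) = fun i =>
      (s (k + 1) - s k)⁻¹ * ∫ r in s k..s (k + 1), proj n (fun x => f r x - f a x) i := by
    funext i
    have hi := intervalIntegrable_proj hfm hlt.le (fun r hr => hC r (hsub hr)) i
    have : ∫ r in s k..s (k + 1), proj n (fun x => f r x - f a x) i =
        ∫ r in s k..s (k + 1), (proj n (f r) i - proj n (f a) i) := by
      refine intervalIntegral.integral_congr fun r hr => ?_
      rw [Set.uIcc_of_le hlt.le] at hr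
      exact proj_sub (hint r (hsub hr)) (hint a haT) i
    rw [this, intervalIntegral.integral_sub hi (by simp), intervalIntegral.integral_const,
      gridSource, smul_eq_mul]
    field_simp
  have hVm := hV hm0 hm1 hlt.le
  have key := l2_integral_proj_le hn (h := fun r x => f r x - f a x)
    (hfm.sub ((hfm.comp (measurable_const (a := a) |>.prodMk measurable_snd)))) hlt.le
    (sub_nonneg.2 hVm) (fun r hr => ?_)
  · rw [e, l2_smul, abs_of_pos (inv_pos.2 hpos), inv_mul_le_iff₀ hpos]
    exact key
  · have hrT := hsub hr
    rcases le_total a r with h | h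
    · refine (hfV a haT r hrT h).trans (ENNReal.ofReal_le_ofReal ?_)
      linarith [hV hm0 haT ha.1, hV hrT hm1 hr.2]
    · have : eLpNorm (fun x => f r x - f a x) 2 leb = eLpNorm (fun x => f a x - f r x) 2 leb :=
        eLpNorm_sub_comm (f r) (f a) 2 leb
      rw [this]
      refine (hfV r hrT a haT h).trans (ENNReal.ofReal_le_ofReal ?_)
      linarith [hV hm0 hrT hr.1, hV haT hm1 ha.2]

/-- The total variation of the discrete source is bounded by that of the source. Both differences
of averages are taken through the value at the common grid point `s k`. For `k = 0` the truncated
subtraction gives `s (k - 1) = s 0`, and `gridSource` at `0` is the average of `f 0`, so the first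
increment is bounded by the variation over the first step alone. -/
lemma gridSource_variation (hn : 0 < n) (hfm : Measurable fun z : ℝ × ℝ => f z.1 z.2)
    {C : ℝ} (hC : ∀ r ∈ Set.Icc 0 T, eLpNorm (f r) 2 leb ≤ ENNReal.ofReal C)
    (hV : MonotoneOn V (Set.Icc 0 T)) (hfV : ∀ s ∈ Set.Icc 0 T, ∀ t ∈ Set.Icc 0 T, s ≤ t →
      eLpNorm (fun x => f t x - f s x) 2 leb ≤ ENNReal.ofReal (V t - V s))
    {N : ℕ} {s : ℕ → ℝ} (hs : IsGrid T N s) :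
    (∀ k < N, l2 (fun i : Fin n => gridSource n f s (k + 1) i - gridSource n f s k i) ≤
      V (s (k + 1)) - V (s (k - 1))) ∧
    ∑ k ∈ Finset.range N, (V (s (k + 1)) - V (s (k - 1))) ≤ 2 * (V T - V 0) := by
  constructor
  · intro k hk
    cases k with
    | zero =>
      have h := l2_gridSource_sub_proj_le (n := n) hn hfm hC hV hfV hs hk (a := s 0)
        ⟨le_rfl, (hs.lt 0 hk).le⟩
      simpa [gridSource, hs.zero] using h
    | succ k =>
      have h1 := l2_gridSource_sub_proj_le (n := n) hn hfm hC hV hfV hs hk (a := s (k + 1))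
        ⟨le_rfl, (hs.lt _ hk).le⟩
      have h2 := l2_gridSource_sub_proj_le (n := n) hn hfm hC hV hfV hs (k := k) (by omega)
        (a := s (k + 1)) ⟨(hs.lt k (by omega)).le, le_rfl⟩
      have h3 := l2_add_le (fun i : Fin n => gridSource n f s (k + 1 + 1) i -
        proj n (f (s (k + 1))) i) (fun i => -(gridSource n f s (k + 1) i -
        proj n (f (s (k + 1))) i))
      rw [l2_neg] at h3
      have e : (fun i : Fin n => gridSource n f s (k + 1 + 1) i - gridSource n f s (k + 1) i) =
          fun i => (gridSource n f s (k + 1 + 1) i - proj n (f (s (k + 1))) i) +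
            -(gridSource n f s (k + 1) i - proj n (f (s (k + 1))) i) := by
        funext i; ring
      rw [e, Nat.add_sub_cancel]
      linarith
  · have key : ∀ M, ∑ k ∈ Finset.range M, (V (s (k + 1)) - V (s (k - 1))) =
        V (s M) + V (s (M - 1)) - 2 * V (s 0) := by
      intro M
      induction M with
      | zero => simp; ring
      | succ M ih => rw [Finset.sum_range_succ, ih, Nat.add_sub_cancel]; ring
    rw [key, hs.last, hs.zero]
    have := hV (hs.mem (Nat.sub_le N 1)) (hs.last ▸ hs.mem le_rfl)
      (hs.mem (Nat.sub_le N 1)).2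
    linarith

/-- The time part of the discretization error of the source is of first order. -/
lemma sum_lintegral_gridSource_sub_le (hn : 0 < n) (hfm : Measurable fun z : ℝ × ℝ => f z.1 z.2)
    {C : ℝ} (hC : ∀ r ∈ Set.Icc 0 T, eLpNorm (f r) 2 leb ≤ ENNReal.ofReal C)
    (hV : MonotoneOn V (Set.Icc 0 T)) (hfV : ∀ s ∈ Set.Icc 0 T, ∀ t ∈ Set.Icc 0 T, s ≤ t →
      eLpNorm (fun x => f t x - f s x) 2 leb ≤ ENNReal.ofReal (V t - V s))
    {N : ℕ} {s : ℕ → ℝ} (hs : IsGrid T N s) {τm : ℝ} (hτ : ∀ k < N, s (k + 1) - s k ≤ τm) :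
    ∑ k ∈ Finset.range N, ∫⁻ r in Set.Ioc (s k) (s (k + 1)),
      eLpNorm (fun x => inj n (gridSource n f s (k + 1)) x - f r x) 2 leb ≤
    (∫⁻ r in Set.Icc 0 T, eLpNorm (fun x => inj n (proj n (f r)) x - f r x) 2 leb) +
      ENNReal.ofReal (τm * (V T - V 0)) := by
  have hfmt : ∀ t, AEStronglyMeasurable (f t) leb := fun t =>
    (hfm.comp measurable_prodMk_left).aestronglyMeasurable
  have hV' : ∀ k < N, 0 ≤ V (s (k + 1)) - V (s k) := fun k hk =>
    sub_nonneg.2 (hV (hs.mem hk.le) (hs.mem (show k + 1 ≤ N from hk)) (hs.lt k hk).le)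
  have hterm : ∀ k ∈ Finset.range N, ∫⁻ r in Set.Ioc (s k) (s (k + 1)),
      eLpNorm (fun x => inj n (gridSource n f s (k + 1)) x - f r x) 2 leb ≤
      ENNReal.ofReal (τm * (V (s (k + 1)) - V (s k))) + ∫⁻ r in Set.Ioc (s k) (s (k + 1)),
        eLpNorm (fun x => inj n (proj n (f r)) x - f r x) 2 leb := by
    intro k hk
    have hk := Finset.mem_range.1 hk
    have hb : ∀ r ∈ Set.Ioc (s k) (s (k + 1)),
        eLpNorm (fun x => inj n (gridSource n f s (k + 1)) x - f r x) 2 leb ≤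
        ENNReal.ofReal (V (s (k + 1)) - V (s k)) +
          eLpNorm (fun x => inj n (proj n (f r)) x - f r x) 2 leb := by
      intro r hr
      have h1 := l2_gridSource_sub_proj_le (n := n) hn hfm hC hV hfV hs hk (a := r)
        ⟨hr.1.le, hr.2⟩
      have e : (fun x => inj n (gridSource n f s (k + 1)) x - f r x) = fun x =>
          inj n (fun i => gridSource n f s (k + 1) i - proj n (f r) i) x +
            (inj n (proj n (f r)) x - f r x) := by
        funext x
        have := inj_add_mul (gridSource n f s (k + 1)) (proj n (f r)) (-1) x
        have e2 : (fun i => gridSource n f s (k + 1) i - proj n (f r) i) =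
          fun i => gridSource n f s (k + 1) i + -1 * proj n (f r) i := by funext i; ring
        rw [e2, this]; ring
      rw [e]
      refine (eLpNorm_add_le (measurable_inj _).aestronglyMeasurable
        ((measurable_inj _).aestronglyMeasurable.sub (hfmt r)) (by norm_num)).trans ?_
      rw [eLpNorm_inj_two hn]
      exact add_le_add (ENNReal.ofReal_le_ofReal h1) le_rfl
    refine (setLIntegral_mono' measurableSet_Ioc hb).trans ?_
    rw [lintegral_add_left measurable_const, setLIntegral_const, Real.volume_Ioc,
      ← ENNReal.ofReal_mul (hV' k hk)]
    refine add_le_add (ENNReal.ofReal_le_ofReal ?_) le_rfl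
    rw [mul_comm]
    exact mul_le_mul_of_nonneg_right (hτ k hk) (hV' k hk)
  refine (Finset.sum_le_sum hterm).trans ?_
  rw [Finset.sum_add_distrib, add_comm]
  refine add_le_add (sum_setLIntegral_grid_le hs _) ?_
  rcases Nat.eq_zero_or_pos N with h0 | h0
  · simp [h0]
  have hτ0 : 0 ≤ τm := by linarith [hτ 0 h0, hs.lt 0 h0]
  rw [← ENNReal.ofReal_sum_of_nonneg fun k hk =>
    mul_nonneg hτ0 (hV' k (Finset.mem_range.1 hk)), ← Finset.mul_sum,
    Finset.sum_range_sub (fun k => V (s k)), hs.last, hs.zero]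

end BV

/-! ### Moments of the discrete solution -/

/-- The moment of order `2 (p - 1)`, which controls all consistency errors. -/
noncomputable def moment (p : ℝ) (w : Fin n → ℝ) : ℝ := (n : ℝ)⁻¹ * ∑ i, |w i| ^ (2 * (p - 1))

lemma moment_nonneg (p : ℝ) (w : Fin n → ℝ) : 0 ≤ moment p w :=
  mul_nonneg (by positivity) (Finset.sum_nonneg fun _ _ => by positivity)

lemma sq_Psi_sub_le {p : ℝ} (hp : 1 < p) (a b : ℝ) :
    Psi p (b - a) ^ 2 ≤ 2 ^ (2 * (p - 1)) * (|a| ^ (2 * (p - 1)) + |b| ^ (2 * (p - 1))) := by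
  have hq : 0 ≤ 2 * (p - 1) := by linarith
  have e : Psi p (b - a) ^ 2 = |b - a| ^ (2 * (p - 1)) := by
    rw [← sq_abs, abs_Psi hp, ← Real.rpow_natCast, ← Real.rpow_mul (abs_nonneg _)]
    congr 1; push_cast; ring
  have h1 : |b - a| ≤ 2 * max |a| |b| := by
    have := abs_sub b a
    linarith [le_max_left |a| |b|, le_max_right |a| |b|]
  rw [e]
  calc |b - a| ^ (2 * (p - 1)) ≤ (2 * max |a| |b|) ^ (2 * (p - 1)) :=
        Real.rpow_le_rpow (abs_nonneg _) h1 hq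
    _ = 2 ^ (2 * (p - 1)) * max |a| |b| ^ (2 * (p - 1)) :=
        Real.mul_rpow (by norm_num) (le_max_of_le_left (abs_nonneg _))
    _ ≤ _ := by
        refine mul_le_mul_of_nonneg_left ?_ (by positivity)
        rcases max_cases |a| |b| with ⟨h, _⟩ | ⟨h, _⟩ <;> rw [h]
        · linarith [Real.rpow_nonneg (abs_nonneg b) (2 * (p - 1))]
        · linarith [Real.rpow_nonneg (abs_nonneg a) (2 * (p - 1))]

/-- Weighted second moments of the flux, for weights with bounded row sums. -/
lemma mean_weight_sq_Psi_le {p : ℝ} (hp : 1 < p) {W : Fin n → Fin n → ℝ}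
    (hW : ∀ i j, W i j = W j i) (hW0 : ∀ i j, 0 ≤ W i j) {κ : ℝ} (hκ : ∀ i, ∑ j, W i j ≤ κ)
    (w : Fin n → ℝ) : (n : ℝ)⁻¹ * ∑ i, ∑ j, W i j * Psi p (w j - w i) ^ 2 ≤
      2 * 2 ^ (2 * (p - 1)) * κ * moment p w := by
  set q := 2 * (p - 1)
  have h1 : ∑ i, ∑ j, W i j * Psi p (w j - w i) ^ 2 ≤
      ∑ i, ∑ j, W i j * (2 ^ q * (|w i| ^ q + |w j| ^ q)) :=
    Finset.sum_le_sum fun i _ => Finset.sum_le_sum fun j _ =>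
      mul_le_mul_of_nonneg_left (sq_Psi_sub_le hp _ _) (hW0 i j)
  have e1 : ∑ i, ∑ j, W i j * (2 ^ q * (|w i| ^ q + |w j| ^ q)) =
      2 * 2 ^ q * ∑ i, (∑ j, W i j) * |w i| ^ q := by
    have e2 : ∑ i, ∑ j, W i j * |w j| ^ q = ∑ i, ∑ j, W i j * |w i| ^ q := by
      rw [Finset.sum_comm]
      exact Finset.sum_congr rfl fun i _ => Finset.sum_congr rfl fun j _ => by rw [hW]
    have e3 : ∑ i, ∑ j, W i j * (2 ^ q * (|w i| ^ q + |w j| ^ q)) =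
        2 ^ q * (∑ i, ∑ j, W i j * |w i| ^ q + ∑ i, ∑ j, W i j * |w j| ^ q) := by
      rw [← Finset.sum_add_distrib, Finset.mul_sum]
      refine Finset.sum_congr rfl fun i _ => ?_
      rw [← Finset.sum_add_distrib, Finset.mul_sum]
      exact Finset.sum_congr rfl fun j _ => by ring
    rw [e3, e2]; simp only [Finset.sum_mul]; ring
  have h2 : ∑ i, (∑ j, W i j) * |w i| ^ q ≤ κ * ∑ i, |w i| ^ q := by
    rw [Finset.mul_sum]
    exact Finset.sum_le_sum fun i _ => mul_le_mul_of_nonneg_right (hκ i) (by positivity)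
  calc (n : ℝ)⁻¹ * ∑ i, ∑ j, W i j * Psi p (w j - w i) ^ 2
      ≤ (n : ℝ)⁻¹ * (2 * 2 ^ q * (κ * ∑ i, |w i| ^ q)) := by
        refine mul_le_mul_of_nonneg_left ?_ (by positivity)
        rw [e1] at h1
        exact h1.trans (mul_le_mul_of_nonneg_left h2 (by positivity))
    _ = _ := by rw [moment]; ring

lemma l2_gen_le {p : ℝ} (hp : 1 < p) {W : Fin n → Fin n → ℝ}
    (hW : ∀ i j, W i j = W j i) (hW0 : ∀ i j, 0 ≤ W i j) {κ : ℝ} (hκ0 : 0 ≤ κ)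
    (hκ : ∀ i, ∑ j, W i j ≤ κ) (w : Fin n → ℝ) :
    l2 (gen p W w) ≤ √(κ * (2 * 2 ^ (2 * (p - 1)) * κ * moment p w)) := by
  refine Real.le_sqrt_of_sq_le ?_
  rw [l2_sq]
  have h1 : ∀ i, gen p W w i ^ 2 ≤ κ * ∑ j, W i j * Psi p (w j - w i) ^ 2 := by
    intro i
    have := Finset.sum_mul_sq_le_sq_mul_sq Finset.univ (fun j => √(W i j))
      (fun j => √(W i j) * Psi p (w j - w i))
    simp only [mul_pow, Real.sq_sqrt (hW0 i _), ← mul_assoc, Real.mul_self_sqrt (hW0 i _)] at this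
    exact this.trans (mul_le_mul_of_nonneg_right (hκ i)
      (Finset.sum_nonneg fun j _ => mul_nonneg (hW0 i j) (sq_nonneg _)))
  calc (n : ℝ)⁻¹ * ∑ i, gen p W w i ^ 2
      ≤ (n : ℝ)⁻¹ * ∑ i, κ * ∑ j, W i j * Psi p (w j - w i) ^ 2 :=
        mul_le_mul_of_nonneg_left (Finset.sum_le_sum fun i _ => h1 i) (by positivity)
    _ = κ * ((n : ℝ)⁻¹ * ∑ i, ∑ j, W i j * Psi p (w j - w i) ^ 2) := by
        rw [← Finset.mul_sum]; ring
    _ ≤ _ := mul_le_mul_of_nonneg_left (mean_weight_sq_Psi_le hp hW hW0 hκ w) hκ0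

lemma lintegral_sq_Psi_inj_le {p : ℝ} (hp : 1 < p) (hn : 0 < n) (w : Fin n → ℝ) :
    ∫⁻ x, ∫⁻ y, ‖Psi p (inj n w y - inj n w x)‖ₑ ^ 2 ∂leb ∂leb ≤
      ENNReal.ofReal √(2 * 2 ^ (2 * (p - 1)) * moment p w) ^ 2 := by
  have hn' : (0 : ℝ) < n := by exact_mod_cast hn
  have e1 : ∀ x, ∫⁻ y, ‖Psi p (inj n w y - inj n w x)‖ₑ ^ 2 ∂leb =
      (n : ℝ≥0∞)⁻¹ * ∑ j, ‖Psi p (w j - inj n w x)‖ₑ ^ 2 := fun x =>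
    lintegral_comp_inj hn w fun s => ‖Psi p (s - inj n w x)‖ₑ ^ 2
  simp only [e1]
  rw [lintegral_comp_inj hn w fun s => (n : ℝ≥0∞)⁻¹ * ∑ j, ‖Psi p (w j - s)‖ₑ ^ 2]
  have e2 : ∀ r : ℝ, ‖r‖ₑ ^ 2 = ENNReal.ofReal (r ^ 2) := fun r => by
    rw [Real.enorm_eq_ofReal_abs, ← ENNReal.ofReal_pow (abs_nonneg _), sq_abs]
  have e3 : (n : ℝ≥0∞)⁻¹ = ENNReal.ofReal (n : ℝ)⁻¹ := by
    rw [ENNReal.ofReal_inv_of_pos hn', ENNReal.ofReal_natCast]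
  have h := mean_weight_sq_Psi_le hp (W := fun _ _ : Fin n => (n : ℝ)⁻¹) (fun _ _ => rfl)
    (fun _ _ => by positivity) (κ := 1) (fun _ => by simp [hn'.ne']) w
  rw [← ENNReal.ofReal_pow (Real.sqrt_nonneg _), Real.sq_sqrt (mul_nonneg (by positivity)
    (moment_nonneg p w))]
  simp only [e2, e3]
  simp only [← ENNReal.ofReal_sum_of_nonneg fun (j : Fin n) (_ : j ∈ Finset.univ) =>
    sq_nonneg (Psi p (w j - _)), ← ENNReal.ofReal_mul (inv_nonneg.2 hn'.le)]
  rw [← ENNReal.ofReal_sum_of_nonneg fun i _ => mul_nonneg (by positivity)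
    (Finset.sum_nonneg fun j _ => sq_nonneg _), ← ENNReal.ofReal_mul (by positivity)]
  refine ENNReal.ofReal_le_ofReal ?_
  simp only [Finset.mul_sum] at h ⊢
  simpa using h

/-! ### A priori bounds in the three regimes -/

lemma grid_mul_source {f : ℝ → ℝ → ℝ} {T : ℝ} {N : ℕ} {s : ℕ → ℝ} (hs : IsGrid T N s) {k : ℕ}
    (hk : k < N) (i : Fin n) : (s (k + 1) - s k) * gridSource n f s (k + 1) i =
      ∫ r in s k..s (k + 1), proj n (f r) i := by
  have : s (k + 1) - s k ≠ 0 := by linarith [hs.lt k hk]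
  rw [gridSource]; field_simp

/-- `L^q` bounds for the deterministic scheme, uniform in the mesh and in `n`: the diffusion is
accretive in `L^q`, so the data alone bound the solution. -/
lemma lq_scheme_le {p : ℝ} (hp : 1 < p) {K : ℝ → ℝ → ℝ} (hK : IsKernel K) {q : ℝ} (hq : 1 < q)
    {T : ℝ} {g : ℝ → ℝ} (hg : MemLp g (ENNReal.ofReal q) leb) {f : ℝ → ℝ → ℝ}
    (hf : MemL1t T (ENNReal.ofReal q) f) {C : ℝ}
    (hC : ∀ r ∈ Set.Icc 0 T, eLpNorm (f r) 2 leb ≤ ENNReal.ofReal C) (hn : 0 < n)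
    {N : ℕ} {s : ℕ → ℝ} (hs : IsGrid T N s) {w : ℕ → Fin n → ℝ} (hw0 : w 0 = proj n g)
    (hw : Solves p (avgWeight n K) N (fun k => s (k + 1) - s k) (gridSource n f s) w) :
    ∀ k ≤ N, lq q (w k) ≤ (eLpNorm g (ENNReal.ofReal q) leb).toReal +
      (normL1t T (ENNReal.ofReal q) f).toReal := by
  obtain ⟨q', hq'⟩ : ∃ q', q.HolderConjugate q' := ⟨_, Real.HolderConjugate.conjExponent hq⟩
  set M : ℕ → ℝ≥0∞ := fun k =>
    ∫⁻ r in Set.Ioc (s k) (s (k + 1)), eLpNorm (f r) (ENNReal.ofReal q) leb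
  have hMsum : ∑ k ∈ Finset.range N, M k ≤ normL1t T (ENNReal.ofReal q) f :=
    sum_setLIntegral_grid_le hs _
  have hMle : ∀ k < N, M k ≠ ∞ := fun k hk => ne_top_of_le_ne_top hf.2.ne
    ((Finset.single_le_sum (f := M) (fun _ _ => zero_le) (Finset.mem_range.2 hk)).trans hMsum)
  intro k hk
  have h := lq_le_of_solves hp hK.avgWeight_symm hK.avgWeight_nonneg hq'
    (fun k => sub_nonneg.2 (hs.mono (Nat.le_succ k))) hw (M := fun k => (M k).toReal)
    (fun k _ => ENNReal.toReal_nonneg) (fun k hk ψ => ?_) k hk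
  · refine h.trans (add_le_add ?_ ?_)
    · rw [hw0]; exact lq_proj_le hn hq' hg
    · rw [← ENNReal.toReal_sum fun j hj => hMle j (by have := Finset.mem_range.1 hj; omega)]
      exact ENNReal.toReal_mono hf.2.ne ((Finset.sum_le_sum_of_subset
        (Finset.range_mono hk)).trans hMsum)
  · simp only [grid_mul_source hs hk]
    refine mean_integral_proj_mul_le hn hq' hf.1 (hs.lt k hk).le (C := C) (fun r hr => hC r ?_)
      (hMle k hk) ψ
    exact Set.Icc_subset_Icc (hs.mem hk.le).1 (hs.mem (show k + 1 ≤ N from hk)).2 hr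

/-- The counterpart of `lq_scheme_le` in the supremum norm. -/
lemma sup_scheme_le {p : ℝ} (hp : 1 < p) {K : ℝ → ℝ → ℝ} (hK : IsKernel K)
    {T : ℝ} {g : ℝ → ℝ} (hg : MemLp g ∞ leb) {f : ℝ → ℝ → ℝ}
    (hf : MemL1t T ∞ f) {N : ℕ} {s : ℕ → ℝ} (hs : IsGrid T N s) {w : ℕ → Fin n → ℝ}
    (hw0 : w 0 = proj n g)
    (hw : Solves p (avgWeight n K) N (fun k => s (k + 1) - s k) (gridSource n f s) w) :
    ∀ k ≤ N, ∀ i, |w k i| ≤ (eLpNorm g ∞ leb).toReal + (normL1t T ∞ f).toReal := by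
  set M : ℕ → ℝ≥0∞ := fun k => ∫⁻ r in Set.Ioc (s k) (s (k + 1)), eLpNorm (f r) ∞ leb
  have hMsum : ∑ k ∈ Finset.range N, M k ≤ normL1t T ∞ f := sum_setLIntegral_grid_le hs _
  have hMle : ∀ k < N, M k ≠ ∞ := fun k hk => ne_top_of_le_ne_top hf.2.ne
    ((Finset.single_le_sum (f := M) (fun _ _ => zero_le) (Finset.mem_range.2 hk)).trans hMsum)
  intro k hk i
  have h := abs_le_of_solves hp hK.avgWeight_nonneg
    (fun k => sub_nonneg.2 (hs.mono (Nat.le_succ k))) hw (A := (eLpNorm g ∞ leb).toReal)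
    (M := fun k => (M k).toReal) (fun i => ?_) (fun k hk i => ?_) k hk i
  · refine h.trans (add_le_add le_rfl ?_)
    rw [← ENNReal.toReal_sum fun j hj => hMle j (by have := Finset.mem_range.1 hj; omega)]
    exact ENNReal.toReal_mono hf.2.ne ((Finset.sum_le_sum_of_subset
      (Finset.range_mono hk)).trans hMsum)
  · rw [hw0, ← Real.norm_eq_abs, ← toReal_enorm]
    exact ENNReal.toReal_mono hg.2.ne (enorm_proj_le g i)
  · rw [grid_mul_source hs hk, ← Real.norm_eq_abs, ← toReal_enorm,
      intervalIntegral.integral_of_le (hs.lt k hk).le]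
    refine ENNReal.toReal_mono (hMle k hk) ((enorm_integral_le_lintegral_enorm _).trans ?_)
    exact lintegral_mono fun r => enorm_proj_le (f r) i

/-- In each regime the deterministic scheme has bounded moments, and the consistency error of a
perturbation of the kernel is controlled by the norm of that regime. -/
lemma Regime.exists_bound {p T : ℝ} (hp : 1 < p) {K : ℝ → ℝ → ℝ} (hK : IsKernel K) {g : ℝ → ℝ}
    {f : ℝ → ℝ → ℝ} {C : ℝ} (hC : ∀ r ∈ Set.Icc 0 T, eLpNorm (f r) 2 leb ≤ ENNReal.ofReal C)
    (R : Regime) (hR : R.Holds p T g f) : ∃ M : ℝ, 0 ≤ M ∧ ∀ n : ℕ, 0 < n → ∀ (N : ℕ) (s : ℕ → ℝ),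
      IsGrid T N s → ∀ w : ℕ → Fin n → ℝ, w 0 = proj n g →
      Solves p (avgWeight n K) N (fun k => s (k + 1) - s k) (gridSource n f s) w → ∀ k ≤ N,
      moment p (w k) ≤ M ∧ ∀ D : ℝ → ℝ → ℝ, Measurable (fun z : ℝ × ℝ => D z.1 z.2) →
        consErr p D (inj n (w k)) ≤ ENNReal.ofReal M * R.kernelNorm D := by
  -- a bound on the moments suffices when kernels are measured in `L^{∞,2}`
  have hab : ∀ A : ℝ, 0 ≤ A → ∃ M : ℝ, 0 ≤ M ∧ ∀ (n : ℕ) (w : Fin n → ℝ), 0 < n →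
      moment p w ≤ A → moment p w ≤ M ∧ ∀ D : ℝ → ℝ → ℝ, Measurable (fun z : ℝ × ℝ => D z.1 z.2) →
        consErr p D (inj n w) ≤ ENNReal.ofReal M * normLinf 2 D := by
    intro A hA
    refine ⟨max A √(2 * 2 ^ (2 * (p - 1)) * A), le_max_of_le_left hA, fun n w hn hw =>
      ⟨hw.trans (le_max_left _ _), fun D hD => ?_⟩⟩
    refine consErr_le_of_sq_mean hp hD (measurable_inj w)
      ((lintegral_sq_Psi_inj_le hp hn w).trans ?_)
    gcongr
    refine le_max_of_le_right (Real.sqrt_le_sqrt ?_)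
    gcongr
  cases R with
  | a =>
    obtain ⟨hp2, hg, hf⟩ := hR
    set A := (eLpNorm g (ENNReal.ofReal 2) leb).toReal + (normL1t T (ENNReal.ofReal 2) f).toReal
    have hA : 0 ≤ A := add_nonneg ENNReal.toReal_nonneg ENNReal.toReal_nonneg
    obtain ⟨M, hM, hMA⟩ := hab (1 + A ^ 2) (by positivity)
    refine ⟨M, hM, fun n hn N s hs w hw0 hw k hk => hMA n (w k) hn ?_⟩
    have h := lq_scheme_le hp hK one_lt_two (by simpa using hg) (by simpa using hf) hC hn hs hw0
      hw k hk
    rw [lq_two] at h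
    have h2 := pow_le_pow_left₀ (l2_nonneg _) h 2
    rw [l2_sq] at h2
    have hn' : (n : ℝ) ≠ 0 := by exact_mod_cast hn.ne'
    -- `2 * (p - 1) ≤ 2`, so the power is dominated by `1 + w ^ 2`
    have h3 : ∑ i, |w k i| ^ (2 * (p - 1)) ≤ ∑ i, (1 + w k i ^ 2) := by
      refine Finset.sum_le_sum fun i _ => ?_
      rcases le_total |w k i| 1 with h1 | h1
      · have := Real.rpow_le_one (abs_nonneg (w k i)) h1 (by linarith : 0 ≤ 2 * (p - 1))
        nlinarith [sq_nonneg (w k i)]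
      · have := Real.rpow_le_rpow_of_exponent_le h1 (by linarith : 2 * (p - 1) ≤ 2)
        rw [Real.rpow_two, sq_abs] at this
        linarith
    calc moment p (w k) ≤ (n : ℝ)⁻¹ * ∑ i, (1 + w k i ^ 2) :=
          mul_le_mul_of_nonneg_left h3 (by positivity)
      _ = 1 + (n : ℝ)⁻¹ * ∑ i, w k i ^ 2 := by
          rw [Finset.sum_add_distrib, mul_add]; simp [hn']
      _ ≤ _ := by linarith
  | b =>
    obtain ⟨hp2, hg, hf⟩ := hR
    set q := 2 * (p - 1) with hq
    set A := (eLpNorm g (ENNReal.ofReal q) leb).toReal + (normL1t T (ENNReal.ofReal q) f).toReal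
    have hA : 0 ≤ A := add_nonneg ENNReal.toReal_nonneg ENNReal.toReal_nonneg
    obtain ⟨M, hM, hMA⟩ := hab (A ^ q) (by positivity)
    refine ⟨M, hM, fun n hn N s hs w hw0 hw k hk => hMA n (w k) hn ?_⟩
    have h := lq_scheme_le hp hK (q := q) (by linarith) hg hf hC hn hs hw0 hw k hk
    rw [moment, ← hq, ← lq_rpow (by linarith : q ≠ 0)]
    exact Real.rpow_le_rpow (lq_nonneg _ _) h (by linarith)
  | c =>
    obtain ⟨hg, hf⟩ := hR
    set A := (eLpNorm g ∞ leb).toReal + (normL1t T ∞ f).toReal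
    have hA : 0 ≤ A := add_nonneg ENNReal.toReal_nonneg ENNReal.toReal_nonneg
    have hsum : 0 ≤ A ^ (2 * (p - 1)) := by positivity
    refine ⟨max (A ^ (2 * (p - 1))) ((2 * A) ^ (p - 1)), le_max_of_le_left hsum,
      fun n hn N s hs w hw0 hw k hk => ?_⟩
    have h := sup_scheme_le hp hK hg hf hs hw0 hw k hk
    have hn' : (n : ℝ) ≠ 0 := by exact_mod_cast hn.ne'
    constructor
    · refine le_max_of_le_left ?_
      calc moment p (w k) ≤ (n : ℝ)⁻¹ * ∑ _i : Fin n, A ^ (2 * (p - 1)) :=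
            mul_le_mul_of_nonneg_left (Finset.sum_le_sum fun i _ =>
              Real.rpow_le_rpow (abs_nonneg _) (h i) (by linarith)) (by positivity)
        _ = _ := by simp [hn']
    · intro D hD
      refine (consErr_le_of_bounded hp hD (measurable_inj (w k))
        (M := (2 * A) ^ (p - 1)) fun x y => ?_).trans ?_
      · rw [abs_Psi hp]
        refine Real.rpow_le_rpow (abs_nonneg _) ?_ (by linarith)
        have hb : ∀ x, |inj n (w k) x| ≤ A := fun x => by
          by_cases hx : ∃ i, x ∈ cell n i
          · obtain ⟨i, hi⟩ := hx
            rw [inj_apply _ hi]; exact h i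
          · push Not at hx
            have : inj n (w k) x = 0 := Finset.sum_eq_zero fun i _ =>
              Set.indicator_of_notMem (hx i) _
            rw [this, abs_zero]; exact hA
        have := abs_sub (inj n (w k) y) (inj n (w k) x)
        linarith [hb x, hb y]
      · gcongr
        exacts [le_max_right _ _, le_rfl]

/-! ### The deterministic scheme and the continuum solution -/

lemma sqrt_add_sq_le {S A b Q B : ℝ} (hS : 0 ≤ S) (hA : 0 ≤ A) (hb : 0 ≤ b) (hQ0 : 0 ≤ Q)
    (hQ : Q ≤ √S + A) : √(Q ^ 2 + 2 * b) + B ≤ √(S + 2 * b) + (A + B) := by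
  have h1 : √S ≤ √(S + 2 * b) := Real.sqrt_le_sqrt (by linarith)
  have h2 : √(Q ^ 2 + 2 * b) ≤ √(S + 2 * b) + A := by
    refine Real.sqrt_le_iff.2 ⟨by positivity, ?_⟩
    have e1 := Real.sq_sqrt hS
    have e2 := Real.sq_sqrt (by linarith : 0 ≤ S + 2 * b)
    have e3 := pow_le_pow_left₀ hQ0 hQ 2
    have e4 := mul_le_mul_of_nonneg_right h1 hA
    nlinarith
  linarith

lemma defect_nonneg {p : ℝ} (hp : 1 < p) {K : ℝ → ℝ → ℝ} (hK : IsKernel K) (w w' : Fin n → ℝ) :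
    0 ≤ defect p (avgWeight n K) w w' := by
  have := sum_gen_sub_mul_nonpos hp hK.avgWeight_symm hK.avgWeight_nonneg w w'
  refine mul_nonneg (by positivity) ?_
  rw [← neg_nonneg, ← Finset.sum_neg_distrib] at this
  exact this.trans_eq (Finset.sum_congr rfl fun i _ => by ring)

section

variable {p T : ℝ} {K : ℝ → ℝ → ℝ} {g : ℝ → ℝ} {f : ℝ → ℝ → ℝ} {C : ℝ} {u : ℝ → Lp ℝ 1 leb}
  {N : ℕ} {s : ℕ → ℝ} {w : ℕ → Fin n → ℝ}

lemma errRate_nonneg (F v : Fin n → ℝ) (r : ℝ) : 0 ≤ errRate p K f F v r :=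
  add_nonneg ENNReal.toReal_nonneg ENNReal.toReal_nonneg

/-- The truncated energies of the error at the grid points, by accumulation of the one-step
estimates. -/
lemma grid_truncEnergy_le (hp : 1 < p) (hK : IsKernel K) (hn : 0 < n)
    (hfm : Measurable fun z : ℝ × ℝ => f z.1 z.2)
    (hC : ∀ r ∈ Set.Icc 0 T, eLpNorm (f r) 2 leb ≤ ENNReal.ofReal C) (hg : MemLp g 2 leb)
    (hu : IsSolution p T K g f u) (hs : IsGrid T N s) (hw0 : w 0 = proj n g)
    (hw : Solves p (avgWeight n K) N (fun k => s (k + 1) - s k) (gridSource n f s) w)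
    {R : ℝ} (hR : 0 ≤ R) : ∀ k ≤ N, √(2 * truncEnergy R (injL (w k) - u (s k))) ≤
      √((eLpNorm (fun x => inj n (proj n g) x - g x) 2 leb).toReal ^ 2 +
        2 * ∑ j ∈ Finset.range k, (s (j + 1) - s j) * defect p (avgWeight n K) (w (j + 1)) (w j)) +
      ∑ j ∈ Finset.range k, ∫ r in s j..s (j + 1),
        errRate p K f (gridSource n f s (j + 1)) (w (j + 1)) r := by
  intro k
  induction k with
  | zero =>
    intro _
    have he : (injL (w 0) - u (s 0) : Lp ℝ 1 leb) =ᵐ[leb]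
        fun x => inj n (proj n g) x - g x := by
      filter_upwards [Lp.coeFn_sub (injL (w 0)) (u (s 0)), coeFn_injL (w 0), hu.2.1]
        with x h1 h2 h3
      rw [h1, Pi.sub_apply, h2, hw0, hs.zero, h3]
    have hm : MemLp (fun x => inj n (proj n g) x - g x) 2 leb := (memLp_inj _ 2).sub hg
    have := sqrt_truncEnergy_le (R := R) _ ((memLp_congr_ae he).2 hm)
    rw [eLpNorm_congr_ae he] at this
    simpa [Real.sqrt_sq ENNReal.toReal_nonneg] using this
  | succ k ih =>
    intro hk
    have hlt := hs.lt k (by omega)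
    have hpos : ∀ j, 0 ≤ s (j + 1) - s j := fun j => sub_nonneg.2 (hs.mono (Nat.le_succ j))
    have h := step_error_le hp hK hn hfm hC hu (hs.mem (show k ≤ N by omega)).1 hlt (hs.mem hk).2
      (fun i => hw k (by omega) i) hR (t := s (k + 1)) ⟨hlt.le, le_rfl⟩
    have e : (fun i => w k i + (s (k + 1) - s k) * (gen p (avgWeight n K) (w (k + 1)) i +
        gridSource n f s (k + 1) i)) = w (k + 1) := by
      funext i; rw [← hw k (by omega) i]
    rw [e] at h
    have h0 : 0 ≤ ∑ j ∈ Finset.range k,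
        (s (j + 1) - s j) * defect p (avgWeight n K) (w (j + 1)) (w j) :=
      Finset.sum_nonneg fun j _ => mul_nonneg (hpos j) (defect_nonneg hp hK _ _)
    have h2 := sqrt_add_sq_le (B := ∫ r in s k..s (k + 1),
      errRate p K f (gridSource n f s (k + 1)) (w (k + 1)) r) (by positivity)
      (Finset.sum_nonneg fun j _ => intervalIntegral.integral_nonneg (by linarith [hpos j])
        fun r _ => errRate_nonneg _ _ r)
      (mul_nonneg (hpos k) (defect_nonneg hp hK (w (k + 1)) (w k))) (Real.sqrt_nonneg _)
      (ih (by omega))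
    rw [add_assoc, ← mul_add, ← Finset.sum_range_succ, ← Finset.sum_range_succ] at h2
    exact h.trans h2

/-- The error of the deterministic scheme, with explicit contributions. -/
lemma deterministic_error (hp : 1 < p) (hK : IsKernel K) (hn : 0 < n)
    (hfm : Measurable fun z : ℝ × ℝ => f z.1 z.2)
    (hC : ∀ r ∈ Set.Icc 0 T, eLpNorm (f r) 2 leb ≤ ENNReal.ofReal C) (hg : MemLp g 2 leb)
    (hu : IsSolution p T K g f u) (hs : IsGrid T N s) (hw0 : w 0 = proj n g)
    (hw : Solves p (avgWeight n K) N (fun k => s (k + 1) - s k) (gridSource n f s) w)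
    {τm : ℝ} (hτ : ∀ k < N, s (k + 1) - s k ≤ τm) {L B : ℝ} (hL : 0 ≤ L)
    (hinc : ∀ k < N, l2 (fun i => w (k + 1) i - w k i) ≤ (s (k + 1) - s k) * L)
    (hB : ∑ j ∈ Finset.range N, (s (j + 1) - s j) *
      defect p (avgWeight n K) (w (j + 1)) (w j) ≤ τm ^ 2 * B)
    {ρ : ℝ≥0∞} (hρ : ∀ k < N, consErr p (kernelErr n K) (inj n (w (k + 1))) ≤ ρ) :
    ∀ k < N, ∀ t ∈ Set.Ioc (s k) (s (k + 1)),
      eLpNorm (fun x => inj n (w (k + 1)) x - u t x) 2 leb ≤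
        eLpNorm (fun x => inj n (proj n g) x - g x) 2 leb +
        (∑ k ∈ Finset.range N, ∫⁻ r in Set.Ioc (s k) (s (k + 1)),
          eLpNorm (fun x => inj n (gridSource n f s (k + 1)) x - f r x) 2 leb) +
        ENNReal.ofReal T * ρ + ENNReal.ofReal (τm * (√(2 * B) + L)) := by
  intro k hk t ht
  have hlt := hs.lt k hk
  have hpos : ∀ j, 0 ≤ s (j + 1) - s j := fun j => sub_nonneg.2 (hs.mono (Nat.le_succ j))
  have hτ0 : 0 ≤ τm := (hpos k).trans (hτ k hk)
  have htm : t ∈ Set.Icc (s k) (s (k + 1)) := ⟨ht.1.le, ht.2⟩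
  have hb0 : ∀ j, 0 ≤ (s (j + 1) - s j) * defect p (avgWeight n K) (w (j + 1)) (w j) :=
    fun j => mul_nonneg (hpos j) (defect_nonneg hp hK _ _)
  set E₀ := (eLpNorm (fun x => inj n (proj n g) x - g x) 2 leb).toReal with hE₀
  have hE₀0 : 0 ≤ E₀ := ENNReal.toReal_nonneg
  have hmg : MemLp (fun x => inj n (proj n g) x - g x) 2 leb := (memLp_inj _ 2).sub hg
  set A : ℕ → ℝ := fun j => ∫ r in s j..s (j + 1),
        errRate p K f (gridSource n f s (j + 1)) (w (j + 1)) r with hA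
  have hA0 : ∀ j, 0 ≤ A j := fun j => intervalIntegral.integral_nonneg (by linarith [hpos j])
        fun r _ => errRate_nonneg _ _ r
  set wt : Fin n → ℝ := fun i => w k i + (t - s k) * (gen p (avgWeight n K) (w (k + 1)) i +
        gridSource n f s (k + 1) i) with hwt
  -- the interpolant and the continuum solution
  have h1 : eLpNorm (injL wt - u t : Lp ℝ 1 leb) 2 leb ≤
      ENNReal.ofReal (E₀ + τm * √(2 * B) + ∑ j ∈ Finset.range N, A j) := by
    refine eLpNorm_le_of_truncEnergy_le fun R hR => ?_
    have hg1 := grid_truncEnergy_le hp hK hn hfm hC hg hu hs hw0 hw hR k hk.le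
    have hst := step_error_le hp hK hn hfm hC hu (hs.mem hk.le).1 hlt (hs.mem hk).2
      (fun i => hw k hk i) hR htm
    have hsum0 : 0 ≤ ∑ j ∈ Finset.range k,
          (s (j + 1) - s j) * defect p (avgWeight n K) (w (j + 1)) (w j) :=
        Finset.sum_nonneg fun j _ => hb0 j
    have h2 := sqrt_add_sq_le (B := A k) (by positivity) (Finset.sum_nonneg fun j _ => hA0 j)
      (hb0 k) (Real.sqrt_nonneg _) hg1
    rw [add_assoc, ← mul_add, ← Finset.sum_range_succ, ← Finset.sum_range_succ] at h2
    refine hst.trans (h2.trans ?_)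
    have hkN : Finset.range (k + 1) ⊆ Finset.range N := Finset.range_mono hk
    have h3 := Finset.sum_le_sum_of_subset_of_nonneg hkN fun j _ _ => hA0 j
    have h4 := (Finset.sum_le_sum_of_subset_of_nonneg hkN fun j _ _ => hb0 j).trans hB
    have h5 : √(E₀ ^ 2 + 2 * ∑ j ∈ Finset.range (k + 1), (s (j + 1) - s j) *
        defect p (avgWeight n K) (w (j + 1)) (w j)) ≤ E₀ + τm * √(2 * B) := by
      have hB0 : 0 ≤ τm ^ 2 * B :=
        (Finset.sum_nonneg fun j _ => hb0 j).trans hB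
      have e1 : (τm * √(2 * B)) ^ 2 = 2 * (τm ^ 2 * B) := by
        rcases hτ0.eq_or_lt with h | h
        · rw [← h]; ring
        · have : 0 ≤ B := nonneg_of_mul_nonneg_right hB0 (by positivity)
          rw [mul_pow, Real.sq_sqrt (by positivity)]; ring
      refine Real.sqrt_le_iff.2 ⟨by positivity, ?_⟩
      have : 0 ≤ E₀ * (τm * √(2 * B)) := by positivity
      nlinarith
    linarith
  -- the interpolant and the nodal value
  have h2 : eLpNorm (inj n (fun i => w (k + 1) i - wt i)) 2 leb ≤ ENNReal.ofReal (τm * L) := by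
    rw [eLpNorm_inj_two hn]
    refine ENNReal.ofReal_le_ofReal ?_
    have e : (fun i => w (k + 1) i - wt i) = fun i =>
        ((s (k + 1) - t) / (s (k + 1) - s k)) * (w (k + 1) i - w k i) := by
      funext i
      have h3 := hw k hk i
      have h4 : s (k + 1) - s k ≠ 0 := by linarith
      have h5 : w (k + 1) i - w k i = (s (k + 1) - s k) * (gen p (avgWeight n K) (w (k + 1)) i +
        gridSource n f s (k + 1) i) := by linarith
      rw [h5, ← mul_assoc, div_mul_cancel₀ _ h4, hwt]
      simp only
      linarith
    have h6 : (s (k + 1) - t) / (s (k + 1) - s k) ≤ 1 := by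
      rw [div_le_one (by linarith)]; linarith [ht.1]
    have h7 : 0 ≤ (s (k + 1) - t) / (s (k + 1) - s k) :=
      div_nonneg (by linarith [ht.2]) (hpos k)
    rw [e, l2_smul, abs_of_nonneg h7]
    calc _ ≤ 1 * l2 (fun i => w (k + 1) i - w k i) :=
          mul_le_mul_of_nonneg_right h6 (l2_nonneg _)
      _ ≤ τm * L := by
          rw [one_mul]
          exact (hinc k hk).trans (mul_le_mul_of_nonneg_right (hτ k hk) hL)
  have h3 : eLpNorm (fun x => inj n (w (k + 1)) x - u t x) 2 leb ≤
      ENNReal.ofReal (τm * L) +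
        ENNReal.ofReal (E₀ + τm * √(2 * B) + ∑ j ∈ Finset.range N, A j) := by
    have e : (fun x => inj n (w (k + 1)) x - u t x) =ᵐ[leb] fun x =>
        inj n (fun i => w (k + 1) i - wt i) x + (injL wt - u t : Lp ℝ 1 leb) x := by
      filter_upwards [Lp.coeFn_sub (injL wt) (u t), coeFn_injL wt] with x g1 g2
      have := inj_add_mul (w (k + 1)) wt (-1) x
      have e2 : (fun i => w (k + 1) i - wt i) = fun i => w (k + 1) i + -1 * wt i := by
        funext i; ring
      rw [g1, Pi.sub_apply, g2, e2, this]; ring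
    rw [eLpNorm_congr_ae e]
    exact (eLpNorm_add_le (measurable_inj _).aestronglyMeasurable
      (Lp.aestronglyMeasurable _) (by norm_num)).trans (add_le_add h2 h1)
  -- the accumulated rates
  have h4 : ENNReal.ofReal (∑ j ∈ Finset.range N, A j) ≤
      (∑ k ∈ Finset.range N, ∫⁻ r in Set.Ioc (s k) (s (k + 1)),
          eLpNorm (fun x => inj n (gridSource n f s (k + 1)) x - f r x) 2 leb) +
        ENNReal.ofReal T * ρ := by
    rw [ENNReal.ofReal_sum_of_nonneg fun j _ => hA0 j]
    have hterm : ∀ j ∈ Finset.range N, ENNReal.ofReal (A j) ≤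
        (∫⁻ r in Set.Ioc (s j) (s (j + 1)),
          eLpNorm (fun x => inj n (gridSource n f s (j + 1)) x - f r x) 2 leb) +
        ENNReal.ofReal (s (j + 1) - s j) * ρ := by
      intro j hj
      have hj := Finset.mem_range.1 hj
      have hsub : Set.Icc (s j) (s (j + 1)) ⊆ Set.Icc 0 T :=
        Set.Icc_subset_Icc (hs.mem hj.le).1 (hs.mem (show j + 1 ≤ N from hj)).2
      have hi := intervalIntegrable_sourceErr hfm (hs.lt j hj).le (fun r hr => hC r (hsub hr))
        (gridSource n f s (j + 1))
      have e1 : A j = (∫ r in s j..s (j + 1),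
          (eLpNorm (fun x => inj n (gridSource n f s (j + 1)) x - f r x) 2 leb).toReal) +
          (s (j + 1) - s j) * (consErr p (kernelErr n K) (inj n (w (j + 1)))).toReal := by
        simp only [hA, errRate]
        rw [intervalIntegral.integral_add hi (by simp), intervalIntegral.integral_const,
          smul_eq_mul]
      rw [e1]
      refine ENNReal.ofReal_add_le.trans (add_le_add ?_ ?_)
      · rw [intervalIntegral.integral_of_le (hs.lt j hj).le,
          ofReal_integral_eq_lintegral_ofReal hi.1
            (Eventually.of_forall fun r => ENNReal.toReal_nonneg)]
        exact lintegral_mono fun r => ENNReal.ofReal_toReal_le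
      · rw [ENNReal.ofReal_mul (hpos j), ENNReal.ofReal_toReal (consErr_kernelErr_ne_top hp hK _)]
        gcongr
        exact hρ j hj
    refine (Finset.sum_le_sum hterm).trans (le_of_eq ?_)
    rw [Finset.sum_add_distrib, ← Finset.sum_mul,
      ← ENNReal.ofReal_sum_of_nonneg fun j _ => hpos j, Finset.sum_range_sub, hs.last, hs.zero,
      sub_zero]
  refine h3.trans ?_
  have hAs : 0 ≤ ∑ j ∈ Finset.range N, A j := Finset.sum_nonneg fun j _ => hA0 j
  have hx : 0 ≤ τm * √(2 * B) := by positivity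
  rw [ENNReal.ofReal_add (add_nonneg hE₀0 hx) hAs, ENNReal.ofReal_add hE₀0 hx,
    hE₀, ENNReal.ofReal_toReal hmg.2.ne, mul_add τm, ENNReal.ofReal_add hx (by positivity)]
  calc _ ≤ ENNReal.ofReal (τm * L) + (eLpNorm (fun x => inj n (proj n g) x - g x) 2 leb +
        ENNReal.ofReal (τm * √(2 * B)) + ((∑ k ∈ Finset.range N, ∫⁻ r in Set.Ioc (s k) (s (k + 1)),
          eLpNorm (fun x => inj n (gridSource n f s (k + 1)) x - f r x) 2 leb) +
        ENNReal.ofReal T * ρ)) := by gcongr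
    _ = _ := by ring

end

lemma Regime.memLp_two {p T : ℝ} {g : ℝ → ℝ} {f : ℝ → ℝ → ℝ} (R : Regime)
    (hR : R.Holds p T g f) : MemLp g 2 leb := by
  cases R with
  | a => exact hR.2.1
  | b =>
    refine hR.2.1.mono_exponent ?_
    have h := hR.1
    rw [show (2 : ℝ≥0∞) = ENNReal.ofReal 2 by simp]
    exact ENNReal.ofReal_le_ofReal (by linarith)
  | c => exact hR.1.mono_exponent le_top

/-! ### Second moments of sums over the edges of the random graph -/

lemma integral_indicator_sub_mul {Ω : Type*} [MeasurableSpace Ω] {P : Measure Ω}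
    [IsProbabilityMeasure P] {A B : Set Ω} (hA : MeasurableSet A) (hB : MeasurableSet B) :
    ∫ ω, (A.indicator 1 ω - P.real A) * (B.indicator 1 ω - P.real B) ∂P =
      P.real (A ∩ B) - P.real A * P.real B := by
  have iA : Integrable (A.indicator (1 : Ω → ℝ)) P := (integrable_const 1).indicator hA
  have iB : Integrable (B.indicator (1 : Ω → ℝ)) P := (integrable_const 1).indicator hB
  have iAB : Integrable ((A ∩ B).indicator (1 : Ω → ℝ)) P :=
    (integrable_const 1).indicator (hA.inter hB)
  have e : ∀ ω, (A.indicator (1 : Ω → ℝ) ω - P.real A) * (B.indicator 1 ω - P.real B) =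
      (A ∩ B).indicator 1 ω - P.real B * A.indicator 1 ω - P.real A * B.indicator 1 ω +
        P.real A * P.real B := by
    intro ω
    rw [Set.inter_indicator_one, Pi.mul_apply]; ring
  have i1 : Integrable (fun ω => (A ∩ B).indicator (1 : Ω → ℝ) ω -
      P.real B * A.indicator 1 ω) P := iAB.sub (iA.const_mul _)
  have i2 : Integrable (fun ω => (A ∩ B).indicator (1 : Ω → ℝ) ω - P.real B * A.indicator 1 ω -
      P.real A * B.indicator 1 ω) P := i1.sub (iB.const_mul _)
  simp only [e]
  rw [integral_add i2 (integrable_const _), integral_sub i1 (iB.const_mul _),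
    integral_sub iAB (iA.const_mul _),
    integral_const_mul, integral_const_mul, integral_indicator_one hA, integral_indicator_one hB,
    integral_indicator_one (hA.inter hB), integral_const]
  simp; ring

lemma integral_sq_sum_indicator_le {Ω ι : Type*} [MeasurableSpace Ω] {P : Measure Ω}
    [IsProbabilityMeasure P] (s : Finset ι) (A : ι → Set Ω)
    (hA : ∀ j ∈ s, MeasurableSet (A j)) (c : ι → ℝ)
    (hind : ∀ j ∈ s, ∀ l ∈ s, j ≠ l → P (A j ∩ A l) = P (A j) * P (A l)) :
    Integrable (fun ω => (∑ j ∈ s, c j * ((A j).indicator 1 ω - P.real (A j))) ^ 2) P ∧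
    ∫ ω, (∑ j ∈ s, c j * ((A j).indicator 1 ω - P.real (A j))) ^ 2 ∂P ≤
      ∑ j ∈ s, c j ^ 2 * P.real (A j) := by
  classical
  have e : ∀ ω, (∑ j ∈ s, c j * ((A j).indicator (1 : Ω → ℝ) ω - P.real (A j))) ^ 2 =
      ∑ j ∈ s, ∑ l ∈ s, (c j * c l) * (((A j).indicator 1 ω - P.real (A j)) *
        ((A l).indicator 1 ω - P.real (A l))) := by
    intro ω
    rw [sq, Finset.sum_mul_sum]
    exact Finset.sum_congr rfl fun j _ => Finset.sum_congr rfl fun l _ => by ring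
  have hint : ∀ j ∈ s, ∀ l ∈ s, Integrable (fun ω => (c j * c l) *
      (((A j).indicator (1 : Ω → ℝ) ω - P.real (A j)) *
        ((A l).indicator 1 ω - P.real (A l)))) P := by
    intro j hj l hl
    refine Integrable.const_mul ?_ _
    have i1 : ∀ j ∈ s, Integrable (fun ω => (A j).indicator (1 : Ω → ℝ) ω - P.real (A j)) P :=
      fun j hj => ((integrable_const 1).indicator (hA j hj)).sub (integrable_const _)
    refine (i1 j hj).mul_bdd (c := 1) (i1 l hl).aestronglyMeasurable
      (Eventually.of_forall fun ω => ?_)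
    have h0 : 0 ≤ P.real (A l) := measureReal_nonneg
    have h1 : P.real (A l) ≤ 1 := measureReal_le_one
    by_cases h : ω ∈ A l
    · rw [Set.indicator_of_mem h, Pi.one_apply, Real.norm_eq_abs, abs_le]; constructor <;> linarith
    · rw [Set.indicator_of_notMem h, Real.norm_eq_abs, abs_le]; constructor <;> linarith
  simp only [e]
  refine ⟨integrable_finsetSum _ fun j hj => integrable_finsetSum _ fun l hl => hint j hj l hl, ?_⟩
  rw [integral_finsetSum _ fun j hj => integrable_finsetSum _ fun l hl => hint j hj l hl]
  refine Finset.sum_le_sum fun j hj => ?_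
  rw [integral_finsetSum _ fun l hl => hint j hj l hl, Finset.sum_eq_single j]
  · rw [integral_const_mul, integral_indicator_sub_mul (hA j hj) (hA j hj), Set.inter_self]
    nlinarith [sq_nonneg (P.real (A j)), sq_nonneg (c j),
      mul_nonneg (sq_nonneg (c j)) (sq_nonneg (P.real (A j)))]
  · intro l hl hlj
    rw [integral_const_mul, integral_indicator_sub_mul (hA j hj) (hA l hl), Measure.real,
      hind j hj l hl hlj.symm, ENNReal.toReal_mul]
    simp [Measure.real]
  · intro h; exact absurd hj h

section Graph

variable {Ω : Type*} [MeasurableSpace Ω] {P : Measure Ω}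
  {K : ℝ → ℝ → ℝ} {ρ : ℝ} {G : Ω → Fin n → Fin n → Prop}

/-- The probability of the edge `{i, j}` for `i ≠ j`. -/
noncomputable def edgeProb (n : ℕ) (K : ℝ → ℝ → ℝ) (ρ : ℝ) (i j : Fin n) : ℝ :=
  ρ * min (projK n K i j) ρ⁻¹

lemma IsKernel.edgeProb_symm (hK : IsKernel K) (i j : Fin n) :
    edgeProb n K ρ i j = edgeProb n K ρ j i := by rw [edgeProb, hK.projK_symm, edgeProb]

lemma IsKernel.edgeProb_nonneg (hK : IsKernel K) (hρ : 0 < ρ) (i j : Fin n) :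
    0 ≤ edgeProb n K ρ i j :=
  mul_nonneg hρ.le (le_min (hK.projK_nonneg i j) (inv_nonneg.2 hρ.le))

lemma IsRandomGraph.edge (hG : IsRandomGraph P n K ρ G) (hK : IsKernel K) (hρ : 0 < ρ)
    {i j : Fin n} (hij : i ≠ j) : MeasurableSet {ω | G ω i j} ∧
      P.real {ω | G ω i j} = edgeProb n K ρ i j := by
  rcases lt_or_gt_of_ne hij with h | h
  · refine ⟨hG.measurable i j h, ?_⟩
    rw [Measure.real, hG.prob i j h]
    exact ENNReal.toReal_ofReal (hK.edgeProb_nonneg hρ i j)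
  · have e : {ω | G ω i j} = {ω | G ω j i} :=
      Set.ext fun ω => ⟨hG.symm ω i j, hG.symm ω j i⟩
    rw [e]
    refine ⟨hG.measurable j i h, ?_⟩
    rw [Measure.real, hG.prob j i h, hK.edgeProb_symm i j]
    exact ENNReal.toReal_ofReal (hK.edgeProb_nonneg hρ j i)

lemma IsRandomGraph.indep_edge (hG : IsRandomGraph P n K ρ G) {i j l : Fin n} (hij : i ≠ j)
    (hil : i ≠ l) (hjl : j ≠ l) : P ({ω | G ω i j} ∩ {ω | G ω i l}) =
      P {ω | G ω i j} * P {ω | G ω i l} := by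
  have key : ∀ a b c d : Fin n, ∀ (hab : a < b) (hcd : c < d), (a, b) ≠ (c, d) →
      P ({ω | G ω a b} ∩ {ω | G ω c d}) = P {ω | G ω a b} * P {ω | G ω c d} := by
    intro a b c d hab hcd hne
    have hi := (iIndepSet_iff _ _).1 hG.indep {⟨(a, b), hab⟩, ⟨(c, d), hcd⟩}
      (f := fun e => {ω | G ω e.1.1 e.1.2})
      (fun e _ => MeasurableSpace.measurableSet_generateFrom rfl)
    have hne' : (⟨(a, b), hab⟩ : {e : Fin n × Fin n // e.1 < e.2}) ≠ ⟨(c, d), hcd⟩ :=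
      fun h => hne (congrArg Subtype.val h)
    rwa [Finset.prod_pair hne', Finset.set_biInter_insert, Finset.set_biInter_singleton] at hi
  have e : ∀ a b, {ω | G ω a b} = {ω | G ω b a} := fun a b =>
    Set.ext fun ω => ⟨hG.symm ω a b, hG.symm ω b a⟩
  rcases lt_or_gt_of_ne hij with h1 | h1 <;> rcases lt_or_gt_of_ne hil with h2 | h2
  · exact key _ _ _ _ h1 h2 (by simp [hjl])
  · rw [e i l]; exact key _ _ _ _ h1 h2 (by simp [hil])
  · rw [e i j]; exact key _ _ _ _ h1 h2 (by simp [hij.symm])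
  · rw [e i j, e i l]; exact key _ _ _ _ h1 h2 (by simp [hjl])

open Classical in
/-- The weights `1 / (ρ n)` on the edges of a graph. -/
noncomputable def graphWeight (ρ : ℝ) (G : Fin n → Fin n → Prop) (i j : Fin n) : ℝ :=
  if G i j then 1 / (ρ * n) else 0

/-- The expectation of `graphWeight` on the random graph, off the diagonal. -/
noncomputable def truncWeight (n : ℕ) (K : ℝ → ℝ → ℝ) (ρ : ℝ) (i j : Fin n) : ℝ :=
  (n : ℝ)⁻¹ * min (projK n K i j) ρ⁻¹

/-- The fluctuation of the generator has variance of order `(ρ n)⁻¹`.  The diagonal terms vanish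
because `Ψ(0) = 0`, so loops are irrelevant. -/
lemma integral_sq_gen_sub_le [IsProbabilityMeasure P] {p : ℝ} (hG : IsRandomGraph P n K ρ G)
    (hK : IsKernel K) (hρ : 0 < ρ) (w : Fin n → ℝ) (i : Fin n) :
    Integrable (fun ω => (gen p (graphWeight ρ (G ω)) w i - gen p (truncWeight n K ρ) w i) ^ 2) P ∧
    ∫ ω, (gen p (graphWeight ρ (G ω)) w i - gen p (truncWeight n K ρ) w i) ^ 2 ∂P ≤
      (ρ * n)⁻¹ * ∑ j, avgWeight n K i j * Psi p (w j - w i) ^ 2 := by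
  classical
  have hn : (0 : ℝ) < n := by exact_mod_cast i.pos
  set s : Finset (Fin n) := Finset.univ.erase i
  have hs : ∀ j ∈ s, i ≠ j := fun j hj => (Finset.ne_of_mem_erase hj).symm
  have e : ∀ ω, gen p (graphWeight ρ (G ω)) w i - gen p (truncWeight n K ρ) w i =
      ∑ j ∈ s, ((ρ * n)⁻¹ * Psi p (w j - w i)) *
        ({ω | G ω i j}.indicator 1 ω - P.real {ω | G ω i j}) := by
    intro ω
    rw [gen, gen, ← Finset.sum_sub_distrib, ← Finset.add_sum_erase _ _ (Finset.mem_univ i)]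
    simp only [sub_self, Psi_zero, mul_zero, zero_add]
    refine Finset.sum_congr rfl fun j hj => ?_
    rw [(hG.edge hK hρ (hs j hj)).2, graphWeight, truncWeight, edgeProb]
    by_cases h : G ω i j
    · rw [if_pos h, Set.indicator_of_mem (show ω ∈ {ω | G ω i j} from h), Pi.one_apply]
      field_simp
    · rw [if_neg h, Set.indicator_of_notMem (show ω ∉ {ω | G ω i j} from h)]
      field_simp
      ring
  have key := integral_sq_sum_indicator_le (P := P) s (fun j => {ω | G ω i j})
    (fun j hj => (hG.edge hK hρ (hs j hj)).1) (fun j => (ρ * n)⁻¹ * Psi p (w j - w i))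
    (fun j hj l hl hjl => hG.indep_edge (hs j hj) (hs l hl) hjl)
  simp only [e]
  refine ⟨key.1, key.2.trans ?_⟩
  rw [Finset.mul_sum]
  calc ∑ j ∈ s, ((ρ * n)⁻¹ * Psi p (w j - w i)) ^ 2 * P.real {ω | G ω i j}
      ≤ ∑ j ∈ s, (ρ * n)⁻¹ * (avgWeight n K i j * Psi p (w j - w i) ^ 2) := by
        refine Finset.sum_le_sum fun j hj => ?_
        rw [(hG.edge hK hρ (hs j hj)).2, edgeProb, avgWeight]
        have h1 : ρ * min (projK n K i j) ρ⁻¹ ≤ ρ * projK n K i j :=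
          mul_le_mul_of_nonneg_left (min_le_left _ _) hρ.le
        calc _ ≤ ((ρ * n)⁻¹ * Psi p (w j - w i)) ^ 2 * (ρ * projK n K i j) :=
              mul_le_mul_of_nonneg_left h1 (sq_nonneg _)
          _ = _ := by field_simp
    _ ≤ _ := Finset.sum_le_sum_of_subset_of_nonneg (Finset.subset_univ _) fun j _ _ =>
        mul_nonneg (by positivity) (mul_nonneg (hK.avgWeight_nonneg i j) (sq_nonneg _))

/-- Markov's inequality for the accumulated fluctuation along a deterministic sequence. -/
lemma prob_fluctuation_ge [IsProbabilityMeasure P] {p : ℝ}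
    (hG : IsRandomGraph P n K ρ G) (hK : IsKernel K)
    (hn : 0 < n) (hρ : 0 < ρ) {N : ℕ} {τ : ℕ → ℝ} (hτ : ∀ k < N, 0 ≤ τ k) {w : ℕ → Fin n → ℝ}
    {T M : ℝ} (hT : 0 < T) (hsum : ∑ k ∈ Finset.range N, τ k = T) (hM0 : 0 ≤ M)
    (hM : ∀ k < N, (n : ℝ)⁻¹ * ∑ i, ∑ j, avgWeight n K i j *
      Psi p (w (k + 1) j - w (k + 1) i) ^ 2 ≤ M) {β : ℝ} :
    1 - (ρ * n) ^ (-(1 - β)) ≤ P.real {ω | ∑ k ∈ Finset.range N,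
      τ k * l2 (fun i => gen p (graphWeight ρ (G ω)) (w (k + 1)) i -
        gen p (truncWeight n K ρ) (w (k + 1)) i) ^ 2 ≤ T * (M + 1) * (ρ * n) ^ (-β)} := by
  have hn' : (0 : ℝ) < n := by exact_mod_cast hn
  have hρn : 0 < ρ * n := mul_pos hρ hn'
  set S : Ω → ℝ := fun ω => ∑ k ∈ Finset.range N,
      τ k * l2 (fun i => gen p (graphWeight ρ (G ω)) (w (k + 1)) i -
        gen p (truncWeight n K ρ) (w (k + 1)) i) ^ 2 with hS
  have hSnn : ∀ ω, 0 ≤ S ω := fun ω => Finset.sum_nonneg fun k hk =>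
    mul_nonneg (hτ k (Finset.mem_range.1 hk)) (sq_nonneg _)
  simp only [l2_sq] at hS
  have hterm := fun k i => integral_sq_gen_sub_le (p := p) hG hK hρ (w (k + 1)) i
  have hi : ∀ k, Integrable (fun ω => τ k * ((n : ℝ)⁻¹ * ∑ i, (gen p (graphWeight ρ (G ω))
      (w (k + 1)) i - gen p (truncWeight n K ρ) (w (k + 1)) i) ^ 2)) P := fun k =>
    ((integrable_finsetSum _ fun i _ => (hterm k i).1).const_mul _).const_mul _
  have hSi : Integrable S P := by
    rw [hS]; exact integrable_finsetSum _ fun k _ => hi k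
  have hES : ∫ ω, S ω ∂P ≤ T * ((ρ * n)⁻¹ * M) := by
    rw [hS, integral_finsetSum _ fun k _ => hi k, ← hsum, Finset.sum_mul]
    refine Finset.sum_le_sum fun k hk => ?_
    have hk := Finset.mem_range.1 hk
    rw [integral_const_mul, integral_const_mul, integral_finsetSum _ fun i _ => (hterm k i).1]
    refine mul_le_mul_of_nonneg_left ?_ (hτ k hk)
    calc _ ≤ (n : ℝ)⁻¹ * ∑ i, (ρ * n)⁻¹ * ∑ j, avgWeight n K i j *
          Psi p (w (k + 1) j - w (k + 1) i) ^ 2 :=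
          mul_le_mul_of_nonneg_left (Finset.sum_le_sum fun i _ => (hterm k i).2) (by positivity)
      _ = (ρ * n)⁻¹ * ((n : ℝ)⁻¹ * ∑ i, ∑ j, avgWeight n K i j *
          Psi p (w (k + 1) j - w (k + 1) i) ^ 2) := by rw [← Finset.mul_sum]; ring
      _ ≤ _ := mul_le_mul_of_nonneg_left (hM k hk) (by positivity)
  set ε := T * (M + 1) * (ρ * n) ^ (-β) with hε
  have hεpos : 0 < ε := by positivity
  have hmk := mul_meas_ge_le_integral_of_nonneg (Eventually.of_forall hSnn) hSi ε
  have h1 : P.real {ω | ε ≤ S ω} ≤ (ρ * n) ^ (-(1 - β)) := by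
    have h2 : ε * P.real {ω | ε ≤ S ω} ≤ ε * (ρ * n) ^ (-(1 - β)) := by
      refine (hmk.trans hES).trans ?_
      have e : (ρ * n) ^ (-β) * (ρ * n) ^ (-(1 - β)) = (ρ * n)⁻¹ := by
        rw [← Real.rpow_add hρn, ← Real.rpow_neg_one]; congr 1; ring
      have : ε * (ρ * n) ^ (-(1 - β)) = T * (M + 1) * (ρ * n)⁻¹ := by
        rw [hε, mul_assoc, e]
      rw [this]
      have : 0 ≤ T * (ρ * n)⁻¹ := by positivity
      nlinarith
    exact le_of_mul_le_mul_left h2 hεpos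
  have h2 : 1 ≤ P.real {ω | S ω ≤ ε} + P.real {ω | ε ≤ S ω} := by
    have hu : {ω | S ω ≤ ε} ∪ {ω | ε ≤ S ω} = Set.univ :=
      Set.eq_univ_of_forall fun ω => le_total (S ω) ε
    have := measureReal_union_le (μ := P) {ω | S ω ≤ ε} {ω | ε ≤ S ω}
    rwa [hu, probReal_univ] at this
  linarith

end Graph

/-! ### Kernel norms and truncation of the kernel -/

lemma Regime.kernelNorm_le_add (R : Regime) {D E F : ℝ → ℝ → ℝ}
    (hE : Measurable fun z : ℝ × ℝ => E z.1 z.2) (hF : Measurable fun z : ℝ × ℝ => F z.1 z.2)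
    (h : ∀ x ∈ Set.Ioc (0 : ℝ) 1, ∀ y ∈ Set.Ioc (0 : ℝ) 1, |D x y| ≤ |E x y| + |F x y|) :
    R.kernelNorm D ≤ R.kernelNorm E + R.kernelNorm F := by
  have hae : ∀ᵐ x ∂leb, x ∈ Set.Ioc (0 : ℝ) 1 := by
    filter_upwards [ae_leb_exists_cell one_pos] with x ⟨i, hi⟩ using cell_subset i hi
  have hinf : normLinf 2 D ≤ normLinf 2 E + normLinf 2 F := by
    refine (essSup_mono_ae ?_).trans (ENNReal.essSup_add_le _ _)
    filter_upwards [hae] with x hx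
    have h1 : eLpNorm (D x) 2 leb ≤ eLpNorm (fun y => |E x y| + |F x y|) 2 leb := by
      refine eLpNorm_mono_ae ?_
      filter_upwards [hae] with y hy
      rw [Real.norm_eq_abs, Real.norm_eq_abs]
      exact (h x hx y hy).trans (le_abs_self _)
    have mE : Measurable (E x) := hE.comp measurable_prodMk_left
    have mF : Measurable (F x) := hF.comp measurable_prodMk_left
    have h2 : eLpNorm (fun y => |E x y| + |F x y|) 2 leb ≤
        eLpNorm (fun y => |E x y|) 2 leb + eLpNorm (fun y => |F x y|) 2 leb :=
      eLpNorm_add_le mE.norm.aestronglyMeasurable mF.norm.aestronglyMeasurable (by norm_num)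
    exact h1.trans (h2.trans (add_le_add (eLpNorm_norm (E x)).le (eLpNorm_norm (F x)).le))
  have hsq : normL2sq D ≤ normL2sq E + normL2sq F := by
    have h1 : normL2sq D ≤ eLpNorm (fun z : ℝ × ℝ => |E z.1 z.2| + |F z.1 z.2|) 2
        (leb.prod leb) := by
      refine eLpNorm_mono_ae ?_
      filter_upwards [ae_prod_exists_cell one_pos] with z ⟨i, j, hi, hj⟩
      rw [Real.norm_eq_abs, Real.norm_eq_abs]
      exact (h _ (cell_subset i hi) _ (cell_subset j hj)).trans (le_abs_self _)
    have h2 : eLpNorm (fun z : ℝ × ℝ => |E z.1 z.2| + |F z.1 z.2|) 2 (leb.prod leb) ≤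
        eLpNorm (fun z : ℝ × ℝ => |E z.1 z.2|) 2 (leb.prod leb) +
          eLpNorm (fun z : ℝ × ℝ => |F z.1 z.2|) 2 (leb.prod leb) :=
      eLpNorm_add_le hE.norm.aestronglyMeasurable hF.norm.aestronglyMeasurable (by norm_num)
    exact h1.trans (h2.trans (add_le_add
      (eLpNorm_norm fun z : ℝ × ℝ => E z.1 z.2).le (eLpNorm_norm fun z : ℝ × ℝ => F z.1 z.2).le))
  cases R with
  | a => exact hinf
  | b => exact hinf
  | c => exact hsq

lemma measurable_kernelExcess {K : ℝ → ℝ → ℝ} (hK : IsKernel K) (ρ : ℝ) :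
    Measurable fun z : ℝ × ℝ => kernelExcess ρ K z.1 z.2 :=
  (hK.measurable.sub_const _).max measurable_const

/-- Truncating the averaged kernel at height `ρ⁻¹` costs at most the excess of the kernel over
`ρ⁻¹` and the averaging error. -/
lemma Regime.kernelNorm_trunc_le (R : Regime) {K : ℝ → ℝ → ℝ} (hK : IsKernel K) (hn : 0 < n)
    (ρ : ℝ) : R.kernelNorm (injK n fun i j => min (projK n K i j) ρ⁻¹ - projK n K i j) ≤
      R.kernelNorm (kernelExcess ρ K) + R.kernelNorm (kernelErr n K) := by
  refine R.kernelNorm_le_add (measurable_kernelExcess hK ρ) (measurable_kernelErr hK) ?_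
  intro x hx y hy
  obtain ⟨i, hi⟩ := exists_cell hn hx
  obtain ⟨j, hj⟩ := exists_cell hn hy
  rw [injK_apply _ hi hj, kernelErr, injK_apply _ hi hj, kernelExcess]
  grind

lemma ofReal_l2_gen_sub_le_consErr {p : ℝ} (hn : 0 < n) (A B : Fin n → Fin n → ℝ)
    (w : Fin n → ℝ) : ENNReal.ofReal (l2 fun i => gen p (fun i j => (n : ℝ)⁻¹ * A i j) w i -
        gen p (fun i j => (n : ℝ)⁻¹ * B i j) w i) ≤
      consErr p (injK n fun i j => A i j - B i j) (inj n w) := by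
  rw [← eLpNorm_inj_two hn]
  refine eLpNorm_le_consErr ?_
  filter_upwards [ae_leb_exists_cell hn] with x ⟨i, hi⟩
  have e : gen p (fun i j => (n : ℝ)⁻¹ * A i j) w i - gen p (fun i j => (n : ℝ)⁻¹ * B i j) w i =
      gen p (fun i j => (n : ℝ)⁻¹ * (A i j - B i j)) w i := by
    simp only [gen, ← Finset.sum_sub_distrib]
    exact Finset.sum_congr rfl fun j _ => by ring
  rw [inj_apply _ hi, e, ← (integral_injK_mul hn (fun i j => A i j - B i j) p w hi).2]
  refine (enorm_integral_le_lintegral_enorm _).trans (le_of_eq ?_)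
  simp only [enorm_mul]

/-! ### The scheme as a sequence of resolvent steps -/

/-- The nodes of a partition, as a sequence that is constant from the last node on. -/
def gridOf {α : Type*} {N : ℕ} (t : Fin (N + 1) → α) (k : ℕ) : α :=
  t ⟨min k N, by omega⟩

lemma gridOf_zero {α : Type*} {N : ℕ} (t : Fin (N + 1) → α) : gridOf t 0 = t 0 := by
  simp [gridOf]

lemma gridOf_castSucc {α : Type*} {N : ℕ} (t : Fin (N + 1) → α) (k : Fin N) :
    gridOf t k = t k.castSucc := by
  rw [gridOf]; congr 1; ext; simp

lemma gridOf_succ {α : Type*} {N : ℕ} (t : Fin (N + 1) → α) (k : Fin N) :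
    gridOf t (k + 1) = t k.succ := by
  rw [gridOf]; congr 1; ext; simp

lemma IsPartition.isGrid {T : ℝ} {N : ℕ} {t : Fin (N + 1) → ℝ} (ht : IsPartition T t) :
    IsGrid T N (gridOf t) where
  zero := (gridOf_zero t).trans ht.start
  last := by rw [← ht.final, gridOf]; congr 1; simp [Fin.last]
  mono := fun a b hab => ht.strictMono.monotone (by simp [Fin.le_def]; omega)
  lt := fun k hk => ht.strictMono (by simp [Fin.lt_def]; omega)

lemma gridOf_sub {N : ℕ} (t : Fin (N + 1) → ℝ) (k : Fin N) :
    gridOf t (k + 1) - gridOf t k = step t k := by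
  rw [gridOf_succ, gridOf_castSucc, step]

lemma gridOf_sub_le_mesh {N : ℕ} (t : Fin (N + 1) → ℝ) :
    ∀ k < N, gridOf t (k + 1) - gridOf t k ≤ mesh t := fun k hk => by
  rw [gridOf_sub t ⟨k, hk⟩]
  exact le_ciSup (Set.finite_range _).bddAbove _

lemma discSource_eq (f : ℝ → ℝ → ℝ) {N : ℕ} (t : Fin (N + 1) → ℝ) (k : Fin N) :
    discSource n f t k = gridSource n f (gridOf t) (k + 1) := by
  funext i
  rw [discSource, gridSource, gridOf_sub, gridOf_succ, gridOf_castSucc]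

lemma gen_graphWeight {p ρ : ℝ} (G : Fin n → Fin n → Prop) (w : Fin n → ℝ) (i : Fin n) :
    gen p (graphWeight ρ G) w i =
      open Classical in 1 / (ρ * n) * ∑ j with G i j, Psi p (w j - w i) := by
  classical
  rw [gen, Finset.sum_filter, Finset.mul_sum]
  refine Finset.sum_congr rfl fun j _ => ?_
  rw [graphWeight]
  split_ifs <;> simp

lemma isScheme_iff {p ρ : ℝ} {G : Fin n → Fin n → Prop} {g : ℝ → ℝ} {f : ℝ → ℝ → ℝ} {T : ℝ}
    {N : ℕ} {t : Fin (N + 1) → ℝ} (ht : IsPartition T t) {U : Fin (N + 1) → Fin n → ℝ} :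
    IsScheme p n ρ G g f t U ↔ gridOf U 0 = proj n g ∧
      Solves p (graphWeight ρ G) N (fun k => gridOf t (k + 1) - gridOf t k)
        (gridSource n f (gridOf t)) (gridOf U) := by
  rw [IsScheme, gridOf_zero]
  refine and_congr_right fun _ => ⟨fun h k hk i => ?_, fun h k i => ?_⟩
  · have := h ⟨k, hk⟩ i
    have hpos : 0 < step t ⟨k, hk⟩ := by
      rw [← gridOf_sub]; linarith [ht.isGrid.lt k hk]
    rw [div_eq_iff hpos.ne', ← gen_graphWeight, discSource_eq, ← gridOf_succ U,
      ← gridOf_castSucc U, ← gridOf_sub] at this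
    simp only at this ⊢
    linarith
  · have := h k k.2 i
    have hpos : 0 < step t k := by
      rw [← gridOf_sub]; linarith [ht.isGrid.lt k k.2]
    rw [div_eq_iff hpos.ne', ← gen_graphWeight, discSource_eq, ← gridOf_succ U,
      ← gridOf_castSucc U, ← gridOf_sub]
    simp only at this ⊢
    linarith

lemma graphWeight_nonneg {ρ : ℝ} (hρ : 0 < ρ) (G : Fin n → Fin n → Prop) (i j : Fin n) :
    0 ≤ graphWeight ρ G i j := by
  rw [graphWeight]; split_ifs <;> positivity

lemma graphWeight_symm {ρ : ℝ} {G : Fin n → Fin n → Prop} (hG : ∀ i j, G i j → G j i)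
    (i j : Fin n) : graphWeight ρ G i j = graphWeight ρ G j i := by
  have : G i j ↔ G j i := ⟨hG i j, hG j i⟩
  classical
  rw [graphWeight, graphWeight]; exact if_congr this rfl rfl

lemma existsUnique_isScheme {p ρ : ℝ} (hp : 1 < p) (hρ : 0 < ρ) {G : Fin n → Fin n → Prop}
    (hG : ∀ i j, G i j → G j i) (g : ℝ → ℝ) (f : ℝ → ℝ → ℝ) {T : ℝ}
    {N : ℕ} {t : Fin (N + 1) → ℝ} (ht : IsPartition T t) :
    ∃! U : Fin (N + 1) → Fin n → ℝ, IsScheme p n ρ G g f t U := by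
  have hτ : ∀ k, 0 ≤ gridOf t (k + 1) - gridOf t k :=
    fun k => sub_nonneg.2 (ht.isGrid.mono (Nat.le_succ k))
  obtain ⟨w, hw0, hw⟩ := exists_solves hp (graphWeight_symm (ρ := ρ) hG) (graphWeight_nonneg hρ G)
    hτ (gridSource n f (gridOf t)) (proj n g) N
  have ew : ∀ k ≤ N, gridOf (fun k : Fin (N + 1) => w k) k = w k := fun k hk => by
    simp [gridOf, hk]
  refine ⟨fun k => w k, (isScheme_iff ht).2 ⟨by rw [ew 0 (by omega), hw0], fun k hk i => ?_⟩, ?_⟩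
  · rw [ew _ hk, ew _ (le_of_lt hk)]; exact hw k hk i
  · intro U hU
    obtain ⟨h0, hs⟩ := (isScheme_iff ht).1 hU
    have := solves_unique hp (graphWeight_symm (ρ := ρ) hG) (graphWeight_nonneg hρ G) hτ hs hw
      (h0.trans hw0.symm)
    funext k
    have hk := this k (Nat.le_of_lt_succ k.2)
    rw [← hk, gridOf]
    congr 1; ext; simp; omega

/-! ### The error of the scheme on the random graph -/

/-- Bounds for the scheme with the averaged kernel as weights, uniform in the space and time
discretization: moments, consistency, and the error to the continuum solution. -/
lemma Regime.exists_deterministic_bound {p T : ℝ} (hp : 1 < p) (hT : 0 < T) {K : ℝ → ℝ → ℝ}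
    (hK : IsKernel K) {g : ℝ → ℝ} {f : ℝ → ℝ → ℝ} (hBV : MemBV T 2 f) (R : Regime)
    (hR : R.Holds p T g f) : ∃ c : ℝ, 0 ≤ c ∧ ∀ n : ℕ, 0 < n → ∀ (N : ℕ) (s : ℕ → ℝ),
      IsGrid T N s → ∀ τm : ℝ, (∀ k < N, s (k + 1) - s k ≤ τm) →
      ∀ w : ℕ → Fin n → ℝ, w 0 = proj n g →
      Solves p (avgWeight n K) N (fun k => s (k + 1) - s k) (gridSource n f s) w →
      (∀ k ≤ N, (n : ℝ)⁻¹ * ∑ i, ∑ j, avgWeight n K i j * Psi p (w k j - w k i) ^ 2 ≤ c) ∧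
      (∀ k ≤ N, ∀ D : ℝ → ℝ → ℝ, Measurable (fun z : ℝ × ℝ => D z.1 z.2) →
        consErr p D (inj n (w k)) ≤ ENNReal.ofReal c * R.kernelNorm D) ∧
      ∀ u : ℝ → Lp ℝ 1 leb, IsSolution p T K g f u → ∀ k < N, ∀ r ∈ Set.Ioc (s k) (s (k + 1)),
        eLpNorm (fun x => inj n (w (k + 1)) x - u r x) 2 leb ≤
          eLpNorm (fun x => inj n (proj n g) x - g x) 2 leb +
          (∑ k ∈ Finset.range N, ∫⁻ r in Set.Ioc (s k) (s (k + 1)),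
            eLpNorm (fun x => inj n (gridSource n f s (k + 1)) x - f r x) 2 leb) +
          ENNReal.ofReal (c * T) * R.kernelNorm (kernelErr n K) + ENNReal.ofReal (c * τm) := by
  obtain ⟨C, hC⟩ := exists_source_bound hT hBV
  obtain ⟨V, hV, hfV⟩ := hBV.exists_monotone hT
  obtain ⟨M, hM0, hM⟩ := R.exists_bound hp hK hC hR
  have hg := R.memLp_two hR
  set κ := (normLinf 2 K).toReal with hκ
  have hκ0 : 0 ≤ κ := ENNReal.toReal_nonneg
  set V' := 2 * (V T - V 0) with hV'
  have h0T : (0 : ℝ) ∈ Set.Icc 0 T := ⟨le_rfl, hT.le⟩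
  have hTT : T ∈ Set.Icc 0 T := ⟨hT.le, le_rfl⟩
  have hV'0 : 0 ≤ V' := by have := hV h0T hTT hT.le; rw [hV']; linarith
  set M' := 2 * 2 ^ (2 * (p - 1)) * κ * M with hM'
  have hM'0 : 0 ≤ M' := by positivity
  set L := √(κ * M') + (eLpNorm (f 0) 2 leb).toReal + V' with hL
  have hL0 : 0 ≤ L := by positivity
  set B := L ^ 2 / 2 + L * V' with hB
  have hx : 0 ≤ √(2 * B) + L := by positivity
  refine ⟨M' + M + (√(2 * B) + L), by positivity, ?_⟩
  intro n hn N s hs τm hτm w hw0 hw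
  have hMw := hM n hn N s hs w hw0 hw
  have hmean : ∀ k ≤ N, (n : ℝ)⁻¹ * ∑ i, ∑ j, avgWeight n K i j * Psi p (w k j - w k i) ^ 2 ≤ M' :=
    fun k hk => (mean_weight_sq_Psi_le hp hK.avgWeight_symm hK.avgWeight_nonneg
      hK.sum_avgWeight_le (w k)).trans
      (mul_le_mul_of_nonneg_left (hMw k hk).1 (by positivity))
  refine ⟨fun k hk => (hmean k hk).trans (by linarith), fun k hk D hD =>
    ((hMw k hk).2 D hD).trans (mul_le_mul_left (ENNReal.ofReal_le_ofReal (by linarith)) _), ?_⟩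
  intro u hu k hk r hr
  have hvar := gridSource_variation hn hBV.1 hC hV hfV hs
  have hl0 : l2 (fun i => gen p (avgWeight n K) (w 0) i + gridSource n f s 0 i) + V' ≤ L := by
    have h1 := l2_gen_le hp hK.avgWeight_symm hK.avgWeight_nonneg hκ0 hK.sum_avgWeight_le (w 0)
    have h2 : √(κ * (2 * 2 ^ (2 * (p - 1)) * κ * moment p (w 0))) ≤ √(κ * M') := by
      refine Real.sqrt_le_sqrt (mul_le_mul_of_nonneg_left ?_ hκ0)
      exact mul_le_mul_of_nonneg_left (hMw 0 (Nat.zero_le _)).1 (by positivity)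
    have h3 : l2 (gridSource n f s 0) ≤ (eLpNorm (f 0) 2 leb).toReal := l2_proj_le hn hBV.2.1
    have h4 := l2_add_le (gen p (avgWeight n K) (w 0)) (gridSource n f s 0)
    linarith
  obtain ⟨hinc, hdef⟩ := solves_rate hp hK.avgWeight_symm hK.avgWeight_nonneg
    (fun k hk => sub_pos.2 (hs.lt k hk)) hτm hw hvar.1 hvar.2 hl0
  have hτ0 : 0 ≤ τm := (sub_pos.2 (hs.lt k hk)).le.trans (hτm k hk)
  refine (deterministic_error hp hK hn hBV.1 hC hg hu hs hw0 hw hτm hL0 hinc hdef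
    (fun k hk => (hMw (k + 1) hk).2 _ (measurable_kernelErr hK)) k hk r hr).trans ?_
  refine add_le_add (add_le_add le_rfl ?_) (ENNReal.ofReal_le_ofReal ?_)
  · rw [← mul_assoc, ← ENNReal.ofReal_mul hT.le]
    refine mul_le_mul_left (ENNReal.ofReal_le_ofReal ?_) _
    nlinarith
  · nlinarith

/-- Cauchy–Schwarz in time. -/
lemma sum_mul_le_of_sum_mul_sq_le {N k : ℕ} (hk : k ≤ N) {τ a : ℕ → ℝ} (hτ : ∀ j, 0 ≤ τ j)
    (ha : ∀ j, 0 ≤ a j) {T ε : ℝ} (hT : ∑ j ∈ Finset.range N, τ j = T)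
    (h : ∑ j ∈ Finset.range N, τ j * a j ^ 2 ≤ ε) :
    ∑ j ∈ Finset.range k, τ j * a j ≤ √(T * ε) := by
  have h1 : ∑ j ∈ Finset.range k, τ j * a j ≤ ∑ j ∈ Finset.range N, τ j * a j :=
    Finset.sum_le_sum_of_subset_of_nonneg (Finset.range_mono hk) fun j _ _ =>
      mul_nonneg (hτ j) (ha j)
  refine h1.trans (Real.le_sqrt_of_sq_le ?_)
  have h2 := Finset.sum_mul_sq_le_sq_mul_sq (Finset.range N) (fun j => √(τ j))
    (fun j => √(τ j) * a j)
  simp only [← mul_assoc, mul_pow, Real.sq_sqrt (hτ _), Real.mul_self_sqrt (hτ _)] at h2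
  rw [hT] at h2
  have hT0 : 0 ≤ T := hT ▸ Finset.sum_nonneg fun j _ => hτ j
  exact h2.trans (mul_le_mul_of_nonneg_left h hT0)

/-- The error bound, with time error of first order, on the random graph. -/
theorem Regime.exists_error_bound {p T : ℝ} (hp : 1 < p) (hT : 0 < T) {K : ℝ → ℝ → ℝ}
    (hK : IsKernel K) {g : ℝ → ℝ} {f : ℝ → ℝ → ℝ} (hBV : MemBV T 2 f) (R : Regime)
    (hR : R.Holds p T g f) : ∃ c : ℝ, 0 < c ∧ ∀ u : ℝ → Lp ℝ 1 leb, IsSolution p T K g f u →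
      ∀ ρ > 0, ∀ β : ℝ, ∀ n : ℕ, 0 < n →
      ∀ (N : ℕ) (t : Fin (N + 1) → ℝ), IsPartition T t →
      ∀ (Ω : Type*) [MeasurableSpace Ω] (P : Measure Ω) [IsProbabilityMeasure P]
        (G : Ω → Fin n → Fin n → Prop), IsRandomGraph P n K ρ G → ∀ Bd : ℝ≥0∞,
        eLpNorm (fun x => inj n (proj n g) x - g x) 2 leb +
          (∑ k ∈ Finset.range N, ∫⁻ r in Set.Ioc (gridOf t k) (gridOf t (k + 1)),
            eLpNorm (fun x => inj n (gridSource n f (gridOf t) (k + 1)) x - f r x) 2 leb) +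
          ENNReal.ofReal (c * (ρ * n) ^ (-(β / 2))) + ENNReal.ofReal c *
            (ENNReal.ofReal (mesh t) + R.kernelNorm (kernelExcess ρ K) +
              R.kernelNorm (kernelErr n K)) ≤ Bd →
        1 - (ρ * n) ^ (-(1 - β)) ≤ P.real (errorEvent p n ρ G g f t u Bd) := by
  obtain ⟨c, hc0, hc⟩ := R.exists_deterministic_bound hp hT hK hBV hR
  have hx : 0 ≤ T * √(c + 1) := by positivity
  refine ⟨T * √(c + 1) + 2 * c * T + c + 1, by positivity, ?_⟩
  intro u hu ρ hρ β n hn N t ht Ω _ P _ G hG Bd hBd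
  have hn' : (0 : ℝ) < n := by exact_mod_cast hn
  have hs := ht.isGrid
  set s := gridOf t with hs_def
  have hτ : ∀ k, 0 ≤ s (k + 1) - s k := fun k => sub_nonneg.2 (hs.mono (Nat.le_succ k))
  have hsum : ∑ k ∈ Finset.range N, (s (k + 1) - s k) = T := by
    rw [Finset.sum_range_sub, hs.last, hs.zero, sub_zero]
  obtain ⟨w, hw0, hw⟩ := exists_solves hp (hK.avgWeight_symm (n := n)) hK.avgWeight_nonneg hτ
    (gridSource n f s) (proj n g) N
  obtain ⟨hmean, hcons, herr⟩ := hc n hn N s hs (mesh t) (gridOf_sub_le_mesh t) w hw0 hw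
  refine (prob_fluctuation_ge (p := p) hG hK hn hρ (w := w) (fun k _ => hτ k) hT hsum hc0
    (fun k hk => hmean (k + 1) hk)).trans (measureReal_mono ?_)
  intro ω hω
  simp only [Set.mem_ofPred_eq] at hω
  refine ⟨existsUnique_isScheme hp hρ (hG.symm ω) g f ht, fun U hU => ?_⟩
  obtain ⟨hU0, hU⟩ := (isScheme_iff ht).1 hU
  set kE := R.kernelNorm (kernelExcess ρ K)
  set kP := R.kernelNorm (kernelErr n K)
  -- the norms of the fluctuation and of the truncation error of the generator along `w`
  set z : ℕ → ℝ := fun j => l2 fun i => gen p (graphWeight ρ (G ω)) (w (j + 1)) i -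
      gen p (truncWeight n K ρ) (w (j + 1)) i with hz
  set d : ℕ → ℝ := fun j => l2 fun i => gen p (truncWeight n K ρ) (w (j + 1)) i -
      gen p (avgWeight n K) (w (j + 1)) i with hd
  have hfluct : ∀ k ≤ N, ∑ j ∈ Finset.range k, (s (j + 1) - s j) * z j ≤
      T * √(c + 1) * (ρ * n) ^ (-(β / 2)) := by
    intro k hk
    refine (sum_mul_le_of_sum_mul_sq_le hk hτ (fun j => l2_nonneg _) hsum hω).trans (le_of_eq ?_)
    have e : (ρ * n) ^ (-β) = ((ρ * n) ^ (-(β / 2))) ^ 2 := by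
      rw [← Real.rpow_natCast, ← Real.rpow_mul (by positivity)]; congr 1; push_cast; ring
    rw [e, show T * (T * (c + 1) * ((ρ * n) ^ (-(β / 2))) ^ 2) =
      (c + 1) * (T * (ρ * n) ^ (-(β / 2))) ^ 2 by ring, Real.sqrt_mul (by positivity),
      Real.sqrt_sq (by positivity)]
    ring
  have htrunc : ∀ k ≤ N, ENNReal.ofReal (∑ j ∈ Finset.range k, (s (j + 1) - s j) * d j) ≤
      ENNReal.ofReal (c * T) * (kE + kP) := by
    intro k hk
    rw [ENNReal.ofReal_sum_of_nonneg fun j _ => mul_nonneg (hτ j) (l2_nonneg _)]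
    have h1 : ∀ j ∈ Finset.range k, ENNReal.ofReal ((s (j + 1) - s j) * d j) ≤
        ENNReal.ofReal (s (j + 1) - s j) * (ENNReal.ofReal c * (kE + kP)) := by
      intro j hj
      have hj := Finset.mem_range.1 hj
      rw [ENNReal.ofReal_mul (hτ j)]
      refine mul_le_mul_right ?_ _
      refine (ofReal_l2_gen_sub_le_consErr hn (fun i j => min (projK n K i j) ρ⁻¹) (projK n K)
        (w (j + 1))).trans ?_
      exact (hcons (j + 1) (by omega) _ (measurable_injK _)).trans
        (mul_le_mul_right (R.kernelNorm_trunc_le hK hn ρ) _)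
    refine (Finset.sum_le_sum h1).trans ?_
    rw [← Finset.sum_mul, ← ENNReal.ofReal_sum_of_nonneg fun j _ => hτ j, ← mul_assoc,
      mul_comm (ENNReal.ofReal _) (ENNReal.ofReal c), ← ENNReal.ofReal_mul hc0]
    refine mul_le_mul_left (ENNReal.ofReal_le_ofReal (mul_le_mul_of_nonneg_left ?_ hc0)) _
    rw [← hsum]
    exact Finset.sum_le_sum_of_subset_of_nonneg (Finset.range_mono hk) fun j _ _ => hτ j
  have hcomp : ∀ k ≤ N, ENNReal.ofReal (l2 fun i => gridOf U k i - w k i) ≤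
      ENNReal.ofReal (T * √(c + 1) * (ρ * n) ^ (-(β / 2))) +
        ENNReal.ofReal (c * T) * (kE + kP) := by
    intro k hk
    have h1 := l2_sub_le_of_solves hp (graphWeight_symm (hG.symm ω)) (graphWeight_nonneg hρ (G ω))
      hτ hU hw (hU0.trans hw0.symm) k hk
    have h2 : ∑ j ∈ Finset.range k, (s (j + 1) - s j) *
        l2 (fun i => gen p (graphWeight ρ (G ω)) (w (j + 1)) i -
          gen p (avgWeight n K) (w (j + 1)) i) ≤
        ∑ j ∈ Finset.range k, (s (j + 1) - s j) * z j +
          ∑ j ∈ Finset.range k, (s (j + 1) - s j) * d j := by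
      rw [← Finset.sum_add_distrib]
      refine Finset.sum_le_sum fun j _ => ?_
      rw [← mul_add]
      refine mul_le_mul_of_nonneg_left ?_ (hτ j)
      have h3 := l2_add_le (fun i => gen p (graphWeight ρ (G ω)) (w (j + 1)) i -
        gen p (truncWeight n K ρ) (w (j + 1)) i) (fun i => gen p (truncWeight n K ρ) (w (j + 1)) i -
        gen p (avgWeight n K) (w (j + 1)) i)
      simpa only [sub_add_sub_cancel] using h3
    exact ((ENNReal.ofReal_le_ofReal (h1.trans h2)).trans ENNReal.ofReal_add_le).trans
      (add_le_add (ENNReal.ofReal_le_ofReal (hfluct k hk)) (htrunc k hk))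
  refine iSup_le fun k => iSup_le fun r => iSup_le fun hr => ?_
  rw [← gridOf_castSucc t, ← gridOf_succ t] at hr
  have h1 := herr u hu k k.2 r hr
  have h2 : eLpNorm (fun x => inj n (U k.succ) x - u r x) 2 leb ≤
      eLpNorm (inj n fun i => gridOf U (k + 1) i - w (k + 1) i) 2 leb +
        eLpNorm (fun x => inj n (w (k + 1)) x - u r x) 2 leb := by
    have e : (fun x => inj n (U k.succ) x - u r x) =
        (inj n fun i => gridOf U (k + 1) i - w (k + 1) i) +
          fun x => inj n (w (k + 1)) x - u r x := by
      funext x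
      have := inj_add_mul (gridOf U (k + 1)) (w (k + 1)) (-1) x
      have e2 : (fun i => gridOf U (k + 1) i - w (k + 1) i) =
        fun i => gridOf U (k + 1) i + -1 * w (k + 1) i := by funext i; ring
      rw [Pi.add_apply, e2, this, gridOf_succ]; ring
    rw [e]
    exact eLpNorm_add_le (measurable_inj _).aestronglyMeasurable
      ((measurable_inj _).aestronglyMeasurable.sub (Lp.aestronglyMeasurable _)) (by norm_num)
  rw [eLpNorm_inj_two hn] at h2
  refine (h2.trans (add_le_add (hcomp (k + 1) k.2) h1)).trans (le_trans ?_ hBd)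
  set e₀ := eLpNorm (fun x => inj n (proj n g) x - g x) 2 leb
  set S := ∑ k ∈ Finset.range N, ∫⁻ r in Set.Ioc (s k) (s (k + 1)),
            eLpNorm (fun x => inj n (gridSource n f s (k + 1)) x - f r x) 2 leb
  set c' := T * √(c + 1) + 2 * c * T + c + 1 with hc'
  have hcT : 0 ≤ c * T := by positivity
  have hm0 : 0 ≤ mesh t := (hτ k).trans (gridOf_sub_le_mesh t k k.2)
  have a1 : ENNReal.ofReal (T * √(c + 1) * (ρ * n) ^ (-(β / 2))) ≤
      ENNReal.ofReal (c' * (ρ * n) ^ (-(β / 2))) :=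
    ENNReal.ofReal_le_ofReal (mul_le_mul_of_nonneg_right (by linarith) (by positivity))
  have a2 : ENNReal.ofReal (c * T) * (kE + kP) + ENNReal.ofReal (c * T) * kP ≤
      ENNReal.ofReal c' * (kE + kP) := by
    calc _ ≤ ENNReal.ofReal (c * T) * (kE + kP) + ENNReal.ofReal (c * T) * (kE + kP) := by
          gcongr; exact le_add_self
      _ = ENNReal.ofReal (c * T + c * T) * (kE + kP) := by
          rw [ENNReal.ofReal_add hcT hcT, add_mul]
      _ ≤ _ := mul_le_mul_left (ENNReal.ofReal_le_ofReal (by linarith)) _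
  have a3 : ENNReal.ofReal (c * mesh t) ≤ ENNReal.ofReal c' * ENNReal.ofReal (mesh t) := by
    rw [← ENNReal.ofReal_mul (by positivity)]
    exact ENNReal.ofReal_le_ofReal (mul_le_mul_of_nonneg_right (by linarith) hm0)
  calc _ = e₀ + S + ENNReal.ofReal (T * √(c + 1) * (ρ * n) ^ (-(β / 2))) +
        (ENNReal.ofReal (c * mesh t) +
          (ENNReal.ofReal (c * T) * (kE + kP) + ENNReal.ofReal (c * T) * kP)) := by ring
    _ ≤ e₀ + S + ENNReal.ofReal (c' * (ρ * n) ^ (-(β / 2))) +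
        (ENNReal.ofReal c' * ENNReal.ofReal (mesh t) + ENNReal.ofReal c' * (kE + kP)) :=
        add_le_add (add_le_add le_rfl a1) (add_le_add a3 a2)
    _ = _ := by ring

/-! ### Piecewise averages of functions in Lipschitz spaces -/

lemma sq_lintegral_le {α : Type*} [MeasurableSpace α] {μ : Measure α} {φ : α → ℝ≥0∞}
    (hφ : AEMeasurable φ μ) : (∫⁻ x, φ x ∂μ) ^ 2 ≤ μ Set.univ * ∫⁻ x, φ x ^ 2 ∂μ := by
  have h1 := ENNReal.lintegral_mul_le_Lp_mul_Lq μ Real.HolderConjugate.two_two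
    (f := fun _ => 1) (g := φ) aemeasurable_const hφ
  have h2 := pow_le_pow_left₀ zero_le h1 2
  have e : ∀ a : ℝ≥0∞, (a ^ (1 / (2 : ℝ))) ^ 2 = a := by
    intro a
    rw [← ENNReal.rpow_natCast, ← ENNReal.rpow_mul]
    norm_num
  rw [mul_pow, e, e] at h2
  simpa using h2

/-- The variance of a function over a set is at most its mean squared oscillation. -/
lemma setLIntegral_sq_sub_average_le {E : Type*} [MeasureSpace E] {Q : Set E} {m : ℝ} (hm : 0 < m)
    (hv : volume Q = ENNReal.ofReal m) {F : E → ℝ} (hF : Measurable F) (hFi : IntegrableOn F Q)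
    (x : E) : ‖m⁻¹ * (∫ y in Q, F y) - F x‖ₑ ^ 2 ≤
      (ENNReal.ofReal m)⁻¹ * ∫⁻ y in Q, ‖F y - F x‖ₑ ^ 2 := by
  have hm0 : ENNReal.ofReal m ≠ 0 := by simpa using hm
  have hc : IntegrableOn (fun _ => F x) Q := by
    rw [integrableOn_const_iff]; right; rw [hv]; exact ENNReal.ofReal_lt_top
  have e : m⁻¹ * (∫ y in Q, F y) - F x = m⁻¹ * ∫ y in Q, (F y - F x) := by
    rw [integral_sub hFi hc, setIntegral_const, Measure.real, hv, ENNReal.toReal_ofReal hm.le,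
      smul_eq_mul, mul_sub, ← mul_assoc, inv_mul_cancel₀ hm.ne', one_mul]
  have e2 : ‖m⁻¹‖ₑ = (ENNReal.ofReal m)⁻¹ := by
    rw [Real.enorm_eq_ofReal (by positivity), ENNReal.ofReal_inv_of_pos hm]
  rw [e, enorm_mul, mul_pow, e2]
  calc (ENNReal.ofReal m)⁻¹ ^ 2 * ‖∫ y in Q, (F y - F x)‖ₑ ^ 2
      ≤ (ENNReal.ofReal m)⁻¹ ^ 2 * (ENNReal.ofReal m * ∫⁻ y in Q, ‖F y - F x‖ₑ ^ 2) := by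
        gcongr
        refine (pow_le_pow_left₀ zero_le (enorm_integral_le_lintegral_enorm _) 2).trans ?_
        have := sq_lintegral_le (μ := volume.restrict Q) (φ := fun y => ‖F y - F x‖ₑ)
          (hF.sub_const _).enorm.aemeasurable
        rwa [Measure.restrict_apply_univ, hv] at this
    _ = _ := by
        rw [sq, ← mul_assoc, mul_assoc _ _ (ENNReal.ofReal m),
          ENNReal.inv_mul_cancel hm0 ENNReal.ofReal_ne_top, mul_one]

section Averages

variable {E ι : Type*} [NormedAddCommGroup E] [MeasureSpace E] [BorelSpace E]
  [SecondCountableTopology E] [(volume : Measure E).IsAddLeftInvariant]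
  [SFinite (volume : Measure E)]

/-- The piecewise averages of `F` over cells of measure `m` and diameter at most `h` differ from `F`
in mean square by at most an average of the mean squared increments of `F` of size less
than `h`. -/
lemma lintegral_sq_sub_average_le [Countable ι] {S : Set E} (hS : MeasurableSet S) {Q : ι → Set E}
    (hQm : ∀ i, MeasurableSet (Q i)) (hQS : ∀ i, Q i ⊆ S)
    (hQ : volume.restrict S = Measure.sum fun i => volume.restrict (Q i)) {m : ℝ} (hm : 0 < m)
    (hv : ∀ i, volume (Q i) = ENNReal.ofReal m) {h : ℝ}
    (hd : ∀ i, ∀ x ∈ Q i, ∀ y ∈ Q i, ‖y - x‖ < h) {F : E → ℝ} (hF : Measurable F)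
    (hFi : ∀ i, IntegrableOn F (Q i)) {J : E → ℝ}
    (hJ : ∀ i, ∀ x ∈ Q i, J x = m⁻¹ * ∫ y in Q i, F y) :
    ∫⁻ x in S, ‖J x - F x‖ₑ ^ 2 ≤ (ENNReal.ofReal m)⁻¹ * ∫⁻ z in Metric.ball 0 h,
      ∫⁻ x, {x | x ∈ S ∧ x + z ∈ S}.indicator (fun x => ‖F (x + z) - F x‖ₑ ^ 2) x := by
  set H : E → E → ℝ≥0∞ := fun x z =>
    {x | x ∈ S ∧ x + z ∈ S}.indicator (fun x => ‖F (x + z) - F x‖ₑ ^ 2) x with hH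
  have hHm : Measurable (Function.uncurry H) := by
    have e : Function.uncurry H = {q : E × E | q.1 ∈ S ∧ q.1 + q.2 ∈ S}.indicator
        fun q => ‖F (q.1 + q.2) - F q.1‖ₑ ^ 2 := by
      funext q; simp only [hH, Function.uncurry, Set.indicator]; rfl
    rw [e]
    refine Measurable.indicator ?_ ?_
    · exact (((hF.comp measurable_add).sub (hF.comp measurable_fst)).enorm).pow_const 2
    · exact (measurable_fst hS).inter (measurable_add hS)
  have h1 : ∀ i, ∀ x ∈ Q i, ‖J x - F x‖ₑ ^ 2 ≤
      (ENNReal.ofReal m)⁻¹ * ∫⁻ z in Metric.ball 0 h, H x z := by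
    intro i x hx
    rw [hJ i x hx]
    refine (setLIntegral_sq_sub_average_le hm (hv i) hF (hFi i) x).trans (mul_le_mul_right ?_ _)
    rw [← lintegral_indicator (hQm i), ← lintegral_indicator Metric.isOpen_ball.measurableSet,
      ← lintegral_add_left_eq_self _ x]
    refine lintegral_mono fun z => ?_
    by_cases hz : x + z ∈ Q i
    · have hzb : z ∈ Metric.ball (0 : E) h := by
        rw [mem_ball_zero_iff]; simpa using hd i x hx _ hz
      rw [Set.indicator_of_mem hz, Set.indicator_of_mem hzb, hH]
      simp only
      rw [Set.indicator_of_mem (show x ∈ {x | x ∈ S ∧ x + z ∈ S} from ⟨hQS i hx, hQS i hz⟩)]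
    · rw [Set.indicator_of_notMem hz]; exact zero_le
  calc ∫⁻ x in S, ‖J x - F x‖ₑ ^ 2
      ≤ ∫⁻ x in S, (ENNReal.ofReal m)⁻¹ * ∫⁻ z in Metric.ball 0 h, H x z := by
        rw [hQ, lintegral_sum_measure, lintegral_sum_measure]
        exact ENNReal.tsum_le_tsum fun i => setLIntegral_mono' (hQm i) (h1 i)
    _ ≤ ∫⁻ x, (ENNReal.ofReal m)⁻¹ * ∫⁻ z in Metric.ball 0 h, H x z := setLIntegral_le_lintegral _ _
    _ = (ENNReal.ofReal m)⁻¹ * ∫⁻ x, ∫⁻ z in Metric.ball 0 h, H x z :=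
        lintegral_const_mul' _ _ (by simpa using hm)
    _ = _ := by rw [lintegral_lintegral_swap hHm.aemeasurable]

end Averages

lemma lintegral_indicator_increment {E : Type*} [NormedAddCommGroup E] [MeasureSpace E]
    [BorelSpace E] {S : Set E} (hS : MeasurableSet S) (F : E → ℝ) (z : E) :
    ∫⁻ x, {x | x ∈ S ∧ x + z ∈ S}.indicator (fun x => ‖F (x + z) - F x‖ₑ ^ 2) x =
      eLpNorm (fun x => F (x + z) - F x) 2 (volume.restrict {x | x ∈ S ∧ x + z ∈ S}) ^ 2 := by
  rw [eLpNorm_two_sq, lintegral_indicator]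
  exact hS.inter (measurable_add_const z hS)

/-- The Lipschitz seminorm bounds increments. -/
lemma MemLip.exists_bound {E : Type*} [NormedAddCommGroup E] [MeasureSpace E] {S : Set E} {s : ℝ}
    {q : ℝ≥0∞} {F : E → ℝ} (hF : MemLip S s q F) : ∃ A : ℝ, 0 ≤ A ∧ ∀ h > 0, ∀ z : E, ‖z‖ < h →
      eLpNorm (fun x => F (x + z) - F x) q (volume.restrict {x | x ∈ S ∧ x + z ∈ S}) ≤
        ENNReal.ofReal (A * h ^ s) := by
  set A' := ⨆ (h : ℝ) (_ : 0 < h), ENNReal.ofReal (h ^ (-s)) * modulus S q F h with hA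
  refine ⟨A'.toReal, ENNReal.toReal_nonneg, fun h hh z hz => ?_⟩
  have h1 : ENNReal.ofReal (h ^ (-s)) * modulus S q F h ≤ A' :=
    le_iSup₂ (f := fun (h : ℝ) (_ : 0 < h) => ENNReal.ofReal (h ^ (-s)) * modulus S q F h) h hh
  have h2 : eLpNorm (fun x => F (x + z) - F x) q (volume.restrict {x | x ∈ S ∧ x + z ∈ S}) ≤
      modulus S q F h :=
    le_iSup₂ (f := fun (z : E) (_ : ‖z‖ < h) =>
      eLpNorm (fun x => F (x + z) - F x) q (volume.restrict {x | x ∈ S ∧ x + z ∈ S})) z hz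
  have hs : 0 < h ^ s := by positivity
  rw [ENNReal.ofReal_mul ENNReal.toReal_nonneg, ENNReal.ofReal_toReal hF.2.ne]
  calc _ ≤ modulus S q F h := h2
    _ = (ENNReal.ofReal (h ^ (-s)) * modulus S q F h) * ENNReal.ofReal (h ^ s) := by
        rw [mul_right_comm, ← ENNReal.ofReal_mul (by positivity), ← Real.rpow_add hh]
        simp
    _ ≤ _ := by gcongr

lemma MemLip.congr_ae {E : Type*} [NormedAddCommGroup E] [MeasureSpace E] [BorelSpace E]
    [SecondCountableTopology E] [(volume : Measure E).IsAddRightInvariant] {S : Set E}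
    (hS : MeasurableSet S) {s : ℝ} {q : ℝ≥0∞} {F F' : E → ℝ} (hF : MemLip S s q F)
    (h : F =ᵐ[volume.restrict S] F') : MemLip S s q F' := by
  refine ⟨(memLp_congr_ae h).1 hF.1, ?_⟩
  have e : ∀ r, modulus S q F' r = modulus S q F r := by
    intro r
    refine iSup_congr fun z => iSup_congr fun _ => eLpNorm_congr_ae ?_
    have h1 : ∀ᵐ x : E, x ∈ S → F x = F' x := (ae_restrict_iff' hS).1 h
    have h2 : ∀ᵐ x : E, x + z ∈ S → F (x + z) = F' (x + z) :=
      (measurePreserving_add_right volume z).quasiMeasurePreserving.ae h1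
    have hm : MeasurableSet {x | x ∈ S ∧ x + z ∈ S} := hS.inter (measurable_add_const z hS)
    filter_upwards [ae_restrict_of_ae h1, ae_restrict_of_ae h2, ae_restrict_mem hm]
      with x g1 g2 g3
    rw [g1 g3.1, g2 g3.2]
  simp only [e]
  exact hF.2

lemma abs_sub_lt_of_mem_cell {i : Fin n} {x y : ℝ} (hx : x ∈ cell n i) (hy : y ∈ cell n i) :
    ‖y - x‖ < (n : ℝ)⁻¹ := by
  obtain ⟨h1, h2⟩ := hx
  obtain ⟨h3, h4⟩ := hy
  rw [add_div, one_div] at h2 h4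
  rw [Real.norm_eq_abs, abs_lt]
  constructor <;> linarith

lemma volume_cell_eq_ofReal (hn : 0 < n) (i : Fin n) :
    volume (cell n i) = ENNReal.ofReal (n : ℝ)⁻¹ := by
  rw [volume_cell, ENNReal.ofReal_inv_of_pos (by exact_mod_cast hn), ENNReal.ofReal_natCast]

/-- The one-dimensional case, before integration over the increments. -/
lemma sq_eLpNorm_inj_proj_sub_le (hn : 0 < n) {F : ℝ → ℝ} (hF : Measurable F)
    (hFi : Integrable F leb) : eLpNorm (fun x => inj n (proj n F) x - F x) 2 leb ^ 2 ≤
      n * ∫⁻ z in Metric.ball 0 (n : ℝ)⁻¹, ∫⁻ x, {x | x ∈ Set.Icc (0 : ℝ) 1 ∧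
        x + z ∈ Set.Icc (0 : ℝ) 1}.indicator (fun x => ‖F (x + z) - F x‖ₑ ^ 2) x := by
  have hn' : (0 : ℝ) < n := by exact_mod_cast hn
  rw [eLpNorm_two_sq]
  have := lintegral_sq_sub_average_le (S := Set.Icc (0 : ℝ) 1) measurableSet_Icc
    (measurableSet_cell n) cell_subset_Icc (leb_eq_sum hn) (inv_pos.2 hn')
    (volume_cell_eq_ofReal hn) (fun i x hx y hy => abs_sub_lt_of_mem_cell hx hy) hF
    (fun i => IntegrableOn.mono_set (s := cell n i) hFi (cell_subset_Icc i))
    (J := inj n (proj n F)) (fun i x hx => by rw [inj_apply _ hx, proj, inv_inv])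
  rwa [ENNReal.ofReal_inv_of_pos hn', ENNReal.ofReal_natCast, inv_inv] at this

lemma MemLip.exists_inj_proj_rate {s : ℝ} {g : ℝ → ℝ} (hg : MemLip (Set.Icc (0 : ℝ) 1) s 2 g) :
    ∃ A : ℝ, 0 ≤ A ∧ ∀ n : ℕ, 0 < n → eLpNorm (fun x => inj n (proj n g) x - g x) 2 leb ≤
      ENNReal.ofReal (A * (n : ℝ) ^ (-s)) := by
  -- it suffices to consider a measurable representative
  set g' := hg.1.1.mk g with hg'
  have hgg : g =ᵐ[leb] g' := hg.1.1.ae_eq_mk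
  have hg'm : Measurable g' := hg.1.1.stronglyMeasurable_mk.measurable
  have hL := hg.congr_ae measurableSet_Icc hgg
  obtain ⟨A, hA0, hA⟩ := hL.exists_bound
  refine ⟨2 * A, by positivity, fun n hn => ?_⟩
  have hn' : (0 : ℝ) < n := by exact_mod_cast hn
  have ep : proj n g = proj n g' := by
    funext i
    rw [proj, proj,
      integral_congr_ae (ae_restrict_of_ae_restrict_of_subset (cell_subset_Icc i) hgg)]
  have e : (fun x => inj n (proj n g) x - g x) =ᵐ[leb] fun x => inj n (proj n g') x - g' x := by
    filter_upwards [hgg] with x hx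
    rw [ep, hx]
  rw [eLpNorm_congr_ae e, ← ENNReal.pow_le_pow_left_iff two_ne_zero]
  refine (sq_eLpNorm_inj_proj_sub_le hn hg'm (hL.1.integrable (by norm_num))).trans ?_
  have h1 : ∀ z ∈ Metric.ball (0 : ℝ) (n : ℝ)⁻¹, ∫⁻ x, {x | x ∈ Set.Icc (0 : ℝ) 1 ∧
        x + z ∈ Set.Icc (0 : ℝ) 1}.indicator (fun x => ‖g' (x + z) - g' x‖ₑ ^ 2) x ≤
        ENNReal.ofReal (A * (n : ℝ) ^ (-s)) ^ 2 := by
    intro z hz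
    rw [lintegral_indicator_increment measurableSet_Icc]
    refine pow_le_pow_left₀ zero_le ?_ 2
    have := hA (n : ℝ)⁻¹ (by positivity) z (mem_ball_zero_iff.1 hz)
    rwa [Real.inv_rpow hn'.le, ← Real.rpow_neg hn'.le] at this
  have hx : 0 ≤ A * (n : ℝ) ^ (-s) := by positivity
  calc _ ≤ (n : ℝ≥0∞) * ∫⁻ _ in Metric.ball (0 : ℝ) (n : ℝ)⁻¹,
        ENNReal.ofReal (A * (n : ℝ) ^ (-s)) ^ 2 :=
        mul_le_mul_right (setLIntegral_mono' Metric.isOpen_ball.measurableSet h1) _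
    _ = ENNReal.ofReal (2 * (A * (n : ℝ) ^ (-s)) ^ 2) := by
        rw [setLIntegral_const, Real.volume_ball, ← ENNReal.ofReal_pow hx,
          ← ENNReal.ofReal_natCast, ← ENNReal.ofReal_mul (by positivity),
          ← ENNReal.ofReal_mul (by positivity)]
        congr 1; field_simp
    _ ≤ ENNReal.ofReal (2 * A * (n : ℝ) ^ (-s)) ^ 2 := by
        rw [← ENNReal.ofReal_pow (by positivity)]
        refine ENNReal.ofReal_le_ofReal ?_
        nlinarith [sq_nonneg (A * (n : ℝ) ^ (-s))]

lemma MemLip.exists_kernelErr_rate {s : ℝ} {K : ℝ → ℝ → ℝ}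
    (hKm : Measurable fun z : ℝ × ℝ => K z.1 z.2)
    (hK : MemLip (Set.Icc (0 : ℝ) 1 ×ˢ Set.Icc (0 : ℝ) 1) s 2 fun z : ℝ × ℝ => K z.1 z.2) :
    ∃ A : ℝ, 0 ≤ A ∧ ∀ n : ℕ, 0 < n → normL2sq (kernelErr n K) ≤
      ENNReal.ofReal (A * (n : ℝ) ^ (-s)) := by
  obtain ⟨A, hA0, hA⟩ := hK.exists_bound
  refine ⟨2 * A, by positivity, fun n hn => ?_⟩
  have hn' : (0 : ℝ) < n := by exact_mod_cast hn
  have hS : MeasurableSet (Set.Icc (0 : ℝ) 1 ×ˢ Set.Icc (0 : ℝ) 1) :=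
    measurableSet_Icc.prod measurableSet_Icc
  have eS : (leb.prod leb : Measure (ℝ × ℝ)) =
      volume.restrict (Set.Icc (0 : ℝ) 1 ×ˢ Set.Icc (0 : ℝ) 1) := Measure.prod_restrict _ _
  have hfin : volume (Set.Icc (0 : ℝ) 1 ×ˢ Set.Icc (0 : ℝ) 1) ≠ ∞ := by
    rw [Measure.volume_eq_prod, Measure.prod_prod]; simp
  have hKi : IntegrableOn (fun z : ℝ × ℝ => K z.1 z.2)
      (Set.Icc (0 : ℝ) 1 ×ˢ Set.Icc (0 : ℝ) 1) := by
    have : IsFiniteMeasure (volume.restrict (Set.Icc (0 : ℝ) 1 ×ˢ Set.Icc (0 : ℝ) 1)) :=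
      ⟨by rw [Measure.restrict_apply_univ]; exact hfin.lt_top⟩
    exact hK.1.integrable (by norm_num)
  have hsub : ∀ ij : Fin n × Fin n, cell n ij.1 ×ˢ cell n ij.2 ⊆
      Set.Icc (0 : ℝ) 1 ×ˢ Set.Icc (0 : ℝ) 1 := fun ij =>
    Set.prod_mono (cell_subset_Icc _) (cell_subset_Icc _)
  have hm : (0 : ℝ) < ((n : ℝ) ^ 2)⁻¹ := by positivity
  have key := lintegral_sq_sub_average_le (E := ℝ × ℝ) hS
    (Q := fun ij : Fin n × Fin n => cell n ij.1 ×ˢ cell n ij.2)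
    (fun ij => (measurableSet_cell n _).prod (measurableSet_cell n _)) hsub
    (eS.symm.trans (leb_prod_eq_sum hn)) hm
    (fun ij => by
      rw [Measure.volume_eq_prod, Measure.prod_prod, volume_cell_eq_ofReal hn,
        volume_cell_eq_ofReal hn, ← ENNReal.ofReal_mul (by positivity)]
      congr 1; field_simp)
    (h := (n : ℝ)⁻¹)
    (fun ij x hx y hy => max_lt (abs_sub_lt_of_mem_cell hx.1 hy.1)
      (abs_sub_lt_of_mem_cell hx.2 hy.2)) hKm
    (fun ij => hKi.mono_set (hsub ij)) (J := fun z => injK n (projK n K) z.1 z.2)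
    (fun ij z hz => by rw [injK_apply _ hz.1 hz.2, projK, inv_inv])
  have h1 : ∀ z ∈ Metric.ball (0 : ℝ × ℝ) (n : ℝ)⁻¹,
      ∫⁻ x, {x | x ∈ Set.Icc (0 : ℝ) 1 ×ˢ Set.Icc (0 : ℝ) 1 ∧
        x + z ∈ Set.Icc (0 : ℝ) 1 ×ˢ Set.Icc (0 : ℝ) 1}.indicator
          (fun x => ‖K (x + z).1 (x + z).2 - K x.1 x.2‖ₑ ^ 2) x ≤
        ENNReal.ofReal (A * (n : ℝ) ^ (-s)) ^ 2 := by
    intro z hz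
    rw [lintegral_indicator_increment hS fun z : ℝ × ℝ => K z.1 z.2]
    refine pow_le_pow_left₀ zero_le ?_ 2
    have := hA (n : ℝ)⁻¹ (by positivity) z (mem_ball_zero_iff.1 hz)
    rwa [Real.inv_rpow hn'.le, ← Real.rpow_neg hn'.le] at this
  have hx : 0 ≤ A * (n : ℝ) ^ (-s) := by positivity
  rw [← ENNReal.pow_le_pow_left_iff two_ne_zero, normL2sq, eLpNorm_two_sq, eS]
  refine key.trans ?_
  calc _ ≤ (ENNReal.ofReal ((n : ℝ) ^ 2)⁻¹)⁻¹ * ∫⁻ _ in Metric.ball (0 : ℝ × ℝ) (n : ℝ)⁻¹,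
        ENNReal.ofReal (A * (n : ℝ) ^ (-s)) ^ 2 :=
        mul_le_mul_right (setLIntegral_mono' Metric.isOpen_ball.measurableSet h1) _
    _ = ENNReal.ofReal (2 * A * (n : ℝ) ^ (-s)) ^ 2 := by
        rw [setLIntegral_const, show (0 : ℝ × ℝ) = (0, 0) from rfl, ← ball_prod_same,
          Measure.volume_eq_prod, Measure.prod_prod, Real.volume_ball, ← ENNReal.ofReal_pow hx,
          ← ENNReal.ofReal_inv_of_pos hm, ← ENNReal.ofReal_mul (by positivity),
          ← ENNReal.ofReal_mul (by positivity), ← ENNReal.ofReal_mul (by positivity),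
          ← ENNReal.ofReal_pow (by positivity)]
        congr 1; field_simp

lemma measurable_inj_proj_sub {f : ℝ → ℝ → ℝ} (hfm : Measurable fun z : ℝ × ℝ => f z.1 z.2) :
    Measurable fun z : ℝ × ℝ => inj n (proj n (f z.1)) z.2 - f z.1 z.2 := by
  classical
  refine Measurable.sub ?_ hfm
  have e : (fun z : ℝ × ℝ => inj n (proj n (f z.1)) z.2) =
      fun z => ∑ i, (Prod.snd ⁻¹' cell n i).indicator (fun z : ℝ × ℝ => proj n (f z.1) i) z := by
    funext z; rfl
  rw [e]
  refine Finset.measurable_sum _ fun i _ => Measurable.indicator ?_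
    (measurable_snd (measurableSet_cell n i))
  exact (measurable_proj hfm i).comp measurable_fst

/-- Spatial averaging of a source in a space-time Lipschitz space.  Only spatial increments
enter. -/
lemma MemLip.exists_source_rate {s T : ℝ} (hT : 0 < T) {f : ℝ → ℝ → ℝ}
    (hfm : Measurable fun z : ℝ × ℝ => f z.1 z.2) {C : ℝ}
    (hC : ∀ r ∈ Set.Icc 0 T, eLpNorm (f r) 2 leb ≤ ENNReal.ofReal C)
    (hf : MemLip (Set.Icc (0 : ℝ) 1 ×ˢ Set.Icc (0 : ℝ) T) s 2 fun z : ℝ × ℝ => f z.2 z.1) :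
    ∃ A : ℝ, 0 ≤ A ∧ ∀ n : ℕ, 0 < n →
      ∫⁻ r in Set.Icc 0 T, eLpNorm (fun x => inj n (proj n (f r)) x - f r x) 2 leb ≤
        ENNReal.ofReal (A * (n : ℝ) ^ (-s)) := by
  obtain ⟨A, hA0, hA⟩ := hf.exists_bound
  refine ⟨(2 * T + 1) * A, by positivity, fun n hn => ?_⟩
  have hn' : (0 : ℝ) < n := by exact_mod_cast hn
  have hS : MeasurableSet (Set.Icc (0 : ℝ) 1 ×ˢ Set.Icc (0 : ℝ) T) :=
    measurableSet_Icc.prod measurableSet_Icc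
  have hx : 0 ≤ A * (n : ℝ) ^ (-s) := by positivity
  set H : ℝ → ℝ → ℝ → ℝ≥0∞ := fun r z x => {x | x ∈ Set.Icc (0 : ℝ) 1 ∧
        x + z ∈ Set.Icc (0 : ℝ) 1}.indicator (fun x => ‖f r (x + z) - f r x‖ₑ ^ 2) x with hH
  have hHm : Measurable fun q : (ℝ × ℝ) × ℝ => H q.1.1 q.1.2 q.2 := by
    have e : (fun q : (ℝ × ℝ) × ℝ => H q.1.1 q.1.2 q.2) =
        {q : (ℝ × ℝ) × ℝ | q.2 ∈ Set.Icc (0 : ℝ) 1 ∧ q.2 + q.1.2 ∈ Set.Icc (0 : ℝ) 1}.indicator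
          fun q => ‖f q.1.1 (q.2 + q.1.2) - f q.1.1 q.2‖ₑ ^ 2 := by
      funext q; simp only [hH, Set.indicator]; rfl
    rw [e]
    have m1 : Measurable fun q : (ℝ × ℝ) × ℝ => q.2 + q.1.2 := by fun_prop
    refine Measurable.indicator ?_ ((measurable_snd measurableSet_Icc).inter (m1 measurableSet_Icc))
    have m2 : Measurable fun q : (ℝ × ℝ) × ℝ => f q.1.1 (q.2 + q.1.2) :=
      hfm.comp (by fun_prop : Measurable fun q : (ℝ × ℝ) × ℝ => (q.1.1, q.2 + q.1.2))
    have m3 : Measurable fun q : (ℝ × ℝ) × ℝ => f q.1.1 q.2 :=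
      hfm.comp (by fun_prop : Measurable fun q : (ℝ × ℝ) × ℝ => (q.1.1, q.2))
    exact ((m2.sub m3).enorm).pow_const 2
  have h1 : ∀ z ∈ Metric.ball (0 : ℝ) (n : ℝ)⁻¹, ∫⁻ r in Set.Icc 0 T, ∫⁻ x, H r z x ≤
      ENNReal.ofReal (A * (n : ℝ) ^ (-s)) ^ 2 := by
    intro z hz
    have hz' : ‖((z, 0) : ℝ × ℝ)‖ < (n : ℝ)⁻¹ := by
      rw [Prod.norm_def]; simpa using hz
    have h2 := hA (n : ℝ)⁻¹ (by positivity) (z, 0) hz'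
    rw [Real.inv_rpow hn'.le, ← Real.rpow_neg hn'.le] at h2
    have h3 := pow_le_pow_left₀ zero_le h2 2
    rw [← lintegral_indicator_increment hS fun z : ℝ × ℝ => f z.2 z.1] at h3
    refine le_trans (le_of_eq ?_) h3
    rw [← lintegral_indicator measurableSet_Icc, Measure.volume_eq_prod, lintegral_prod_symm]
    · refine lintegral_congr fun r => ?_
      by_cases hr : r ∈ Set.Icc 0 T
      · rw [Set.indicator_of_mem hr]
        refine lintegral_congr fun x => ?_
        by_cases hxz : x ∈ Set.Icc (0 : ℝ) 1 ∧ x + z ∈ Set.Icc (0 : ℝ) 1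
        · rw [hH]; simp only
          rw [Set.indicator_of_mem (by exact hxz), Set.indicator_of_mem]
          · simp
          · exact ⟨⟨hxz.1, hr⟩, hxz.2, by simpa using hr⟩
        · rw [hH]; simp only
          rw [Set.indicator_of_notMem (by exact hxz), Set.indicator_of_notMem]
          exact fun h => hxz ⟨h.1.1, h.2.1⟩
      · rw [Set.indicator_of_notMem hr]
        symm
        rw [lintegral_eq_zero_of_ae_eq_zero]
        refine Eventually.of_forall fun x => Set.indicator_of_notMem ?_ _
        exact fun h => hr h.1.2
    · refine (Measurable.indicator ?_ (hS.inter (measurable_add_const _ hS))).aemeasurable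
      have m2 : Measurable fun x : ℝ × ℝ => f (x + (z, 0)).2 (x + (z, 0)).1 :=
        (hfm.comp measurable_swap).comp (measurable_add_const ((z, 0) : ℝ × ℝ))
      exact ((m2.sub (hfm.comp measurable_swap)).enorm).pow_const 2
  have h4 : ∫⁻ r in Set.Icc 0 T, eLpNorm (fun x => inj n (proj n (f r)) x - f r x) 2 leb ^ 2 ≤
      ENNReal.ofReal (2 * (A * (n : ℝ) ^ (-s)) ^ 2) := by
    calc _ ≤ ∫⁻ r in Set.Icc 0 T, (n : ℝ≥0∞) * ∫⁻ z in Metric.ball 0 (n : ℝ)⁻¹, ∫⁻ x, H r z x := by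
          refine setLIntegral_mono' measurableSet_Icc fun r hr => ?_
          exact sq_eLpNorm_inj_proj_sub_le hn (hfm.comp measurable_prodMk_left)
            ((memLp_source hfm (hC r hr)).integrable (by norm_num))
      _ = (n : ℝ≥0∞) * ∫⁻ z in Metric.ball 0 (n : ℝ)⁻¹, ∫⁻ r in Set.Icc 0 T, ∫⁻ x, H r z x := by
          rw [lintegral_const_mul' _ _ (ENNReal.natCast_ne_top n), lintegral_lintegral_swap]
          exact hHm.lintegral_prod_right'.aemeasurable
      _ ≤ (n : ℝ≥0∞) * ∫⁻ _ in Metric.ball (0 : ℝ) (n : ℝ)⁻¹,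
        ENNReal.ofReal (A * (n : ℝ) ^ (-s)) ^ 2 :=
        mul_le_mul_right (setLIntegral_mono' Metric.isOpen_ball.measurableSet h1) _
      _ = _ := by
        rw [setLIntegral_const, Real.volume_ball, ← ENNReal.ofReal_pow hx,
          ← ENNReal.ofReal_natCast, ← ENNReal.ofReal_mul (by positivity),
          ← ENNReal.ofReal_mul (by positivity)]
        congr 1; field_simp
  rw [← ENNReal.pow_le_pow_left_iff two_ne_zero]
  refine (sq_lintegral_le
    (measurable_eLpNorm_two (measurable_inj_proj_sub hfm)).aemeasurable).trans ?_
  rw [Measure.restrict_apply_univ, Real.volume_Icc, sub_zero]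
  refine (mul_le_mul_right h4 _).trans ?_
  rw [← ENNReal.ofReal_mul hT.le, ← ENNReal.ofReal_pow (by positivity)]
  refine ENNReal.ofReal_le_ofReal ?_
  nlinarith [sq_nonneg (A * (n : ℝ) ^ (-s)), mul_nonneg hT.le (sq_nonneg (A * (n : ℝ) ^ (-s))),
    mul_nonneg (sq_nonneg T) (sq_nonneg (A * (n : ℝ) ^ (-s)))]

/-! ### The excess of the kernel over the truncation height -/

/-- Dominated convergence: the excess is at most `K`, and at each point it vanishes as soon as the
height `(ρ n)⁻¹` exceeds the value of `K`. -/
lemma tendsto_normL2sq_kernelExcess {K : ℝ → ℝ → ℝ} (hK : IsKernel K) {ρ : ℕ → ℝ}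
    (hρ : IsSparsity ρ) :
    Tendsto (fun n => normL2sq (kernelExcess (ρ n) K)) atTop (𝓝 0) := by
  have hpos : ∀ᶠ n in atTop, 0 < ρ n := by
    filter_upwards [eventually_ge_atTop 1] with n hn using hρ.pos n hn
  have hinv : Tendsto (fun n => (ρ n)⁻¹) atTop atTop :=
    tendsto_inv_nhdsGT_zero.comp (tendsto_nhdsWithin_iff.2 ⟨hρ.tendsto, hpos⟩)
  have h1 : Tendsto (fun n => ∫⁻ z : ℝ × ℝ, ‖kernelExcess (ρ n) K z.1 z.2‖ₑ ^ 2 ∂(leb.prod leb))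
      atTop (𝓝 (∫⁻ _ : ℝ × ℝ, 0 ∂(leb.prod leb))) := by
    refine tendsto_lintegral_filter_of_dominated_convergence
      (fun z : ℝ × ℝ => ‖K z.1 z.2‖ₑ ^ 2)
      (Eventually.of_forall fun n => (measurable_kernelExcess hK _).enorm.pow_const 2) ?_ ?_ ?_
    · filter_upwards [hpos] with n hn
      refine Eventually.of_forall fun z => pow_le_pow_left₀ zero_le ?_ 2
      rw [enorm_le_iff_norm_le, Real.norm_eq_abs, Real.norm_eq_abs, kernelExcess]
      have := inv_pos.2 hn
      grind
    · rw [← eLpNorm_two_sq]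
      exact ENNReal.pow_ne_top hK.memLp.2.ne
    · refine Eventually.of_forall fun z => tendsto_const_nhds.congr' ?_
      filter_upwards [hinv.eventually_ge_atTop (K z.1 z.2)] with n hn
      rw [kernelExcess, max_eq_right (by linarith)]
      simp
  rw [lintegral_zero] at h1
  have h2 := ((ENNReal.continuous_rpow_const (y := 1 / 2)).tendsto 0).comp h1
  rw [ENNReal.zero_rpow_of_pos (by norm_num)] at h2
  refine h2.congr fun n => ?_
  rw [Function.comp_apply, ← eLpNorm_two_sq, ← ENNReal.rpow_natCast, ← ENNReal.rpow_mul]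
  norm_num [normL2sq]

/-! ### The error bounds in terms of the data -/

lemma sum_gridSource_sub_le_normL1t (f : ℝ → ℝ → ℝ) {T : ℝ} {N : ℕ} {t : Fin (N + 1) → ℝ}
    (ht : IsPartition T t) :
    ∑ k ∈ Finset.range N, ∫⁻ r in Set.Ioc (gridOf t k) (gridOf t (k + 1)),
      eLpNorm (fun x => inj n (gridSource n f (gridOf t) (k + 1)) x - f r x) 2 leb ≤
    normL1t T 2 fun r x => sourceExt n f t r x - f r x := by
  refine le_trans (le_of_eq ?_) (sum_setLIntegral_grid_le ht.isGrid _)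
  refine Finset.sum_congr rfl fun k hk => setLIntegral_congr_fun measurableSet_Ioc fun r hr => ?_
  have hk := Finset.mem_range.1 hk
  have e : ∀ x, sourceExt n f t r x = inj n (gridSource n f (gridOf t) (k + 1)) x := by
    intro x
    rw [sourceExt, Finset.sum_eq_single ⟨k, hk⟩]
    · rw [Set.indicator_of_mem, discSource_eq]
      rwa [← gridOf_castSucc t, ← gridOf_succ t]
    · intro j _ hj
      refine Set.indicator_of_notMem (fun h => hj ?_) _
      rw [← gridOf_castSucc t, ← gridOf_succ t] at h
      have mono := ht.isGrid.mono
      have h1 : ¬ (j : ℕ) + 1 ≤ k := fun hle => by linarith [mono hle, h.2, hr.1]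
      have h2 : ¬ k + 1 ≤ (j : ℕ) := fun hle => by linarith [mono hle, h.1, hr.2]
      exact Fin.ext (by simp only; omega)
    · simp
  simp only [e]

lemma Regime.exponent_le_one {p T : ℝ} (hp : 1 < p) {g : ℝ → ℝ} {f : ℝ → ℝ → ℝ} (R : Regime)
    (hR : R.Holds p T g f) : R.exponent p ≤ 1 := by
  cases R with
  | a => have := hR.1; rw [exponent, div_le_one (by linarith)]; linarith
  | b => rw [exponent, div_le_one (by linarith)]; linarith
  | c =>
    rw [exponent]
    split_ifs with h
    · rw [div_le_one (by linarith)]; linarith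
    · exact le_rfl

lemma rateExponent_le_one {p s : ℝ} (hs : s ≤ 1) : rateExponent p s ≤ 1 := by
  rw [rateExponent]
  split_ifs
  · exact (min_le_left _ _).trans hs
  · exact hs

lemma IsPartition.mesh_nonneg {T : ℝ} {N : ℕ} {t : Fin (N + 1) → ℝ} (ht : IsPartition T t) :
    0 ≤ mesh t :=
  Real.iSup_nonneg fun _ => sub_nonneg.2 (ht.strictMono.monotone (Fin.castSucc_lt_succ).le)

lemma IsPartition.mesh_le_rpow {T : ℝ} {N : ℕ} {t : Fin (N + 1) → ℝ} (ht : IsPartition T t)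
    (hm : mesh t ≤ 1) {α : ℝ} (hα : α ≤ 1) : mesh t ≤ mesh t ^ α :=
  Real.self_le_rpow_of_le_one ht.mesh_nonneg hm hα

/-- The general error bound; it holds for all `τ ≤ 1`. -/
theorem Regime.exists_generalBound {p T : ℝ} (hp : 1 < p) (hT : 0 < T) {K : ℝ → ℝ → ℝ}
    (hK : IsKernel K) {g : ℝ → ℝ} {f : ℝ → ℝ → ℝ} (hBV : MemBV T 2 f) (R : Regime)
    (hR : R.Holds p T g f) : ∃ C > 0, ∀ u : ℝ → Lp ℝ 1 leb, IsSolution p T K g f u →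
      ∀ ρ > 0, ∀ β : ℝ, ∀ n : ℕ, 0 < n →
      ∀ (N : ℕ) (t : Fin (N + 1) → ℝ), IsPartition T t → mesh t ≤ 1 →
      ∀ (Ω : Type*) [MeasurableSpace Ω] (P : Measure Ω) [IsProbabilityMeasure P]
        (G : Ω → Fin n → Fin n → Prop), IsRandomGraph P n K ρ G →
        1 - (ρ * n) ^ (-(1 - β)) ≤
          P.real (errorEvent p n ρ G g f t u (generalBound R p T K g f C β n ρ t)) := by
  obtain ⟨c, hc, h⟩ := R.exists_error_bound hp hT hK hBV hR
  have hT2 : 0 < T ^ (1 / 2 : ℝ) := by positivity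
  -- dividing by `T ^ (1 / 2)` cancels the same factor in `generalBound`
  refine ⟨c / T ^ (1 / 2 : ℝ), by positivity, ?_⟩
  intro u hu ρ hρ β n hn N t ht hm Ω _ P _ G hG
  refine h u hu ρ hρ β n hn N t ht Ω P G hG _ ?_
  rw [generalBound, div_mul_cancel₀ _ hT2.ne']
  -- the bound holds without the exponential factor
  have hexp : 1 ≤ ENNReal.ofReal (Real.exp (T / 2)) := by
    rw [ENNReal.one_le_ofReal]; exact Real.one_le_exp (by positivity)
  refine le_trans ?_ (le_mul_of_one_le_left zero_le hexp)
  gcongr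
  · exact sum_gridSource_sub_le_normL1t f ht
  · exact ht.mesh_le_rpow hm (R.exponent_le_one hp hR)

/-- The error bound for Lipschitz data; it holds for all `τ ≤ 1` and every exponent `α ≤ 1`. -/
theorem exists_rateBound {p T : ℝ} (hp : 1 < p) (hT : 0 < T) {K : ℝ → ℝ → ℝ}
    (hK : IsKernel K) {g : ℝ → ℝ} {f : ℝ → ℝ → ℝ} (hBV : MemBV T 2 f) {s : ℝ}
    (hg : MemLp g ∞ leb) (hgL : MemLip (Set.Icc (0 : ℝ) 1) s 2 g)
    (hKL : MemLip (Set.Icc (0 : ℝ) 1 ×ˢ Set.Icc (0 : ℝ) 1) s 2 fun z : ℝ × ℝ => K z.1 z.2)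
    (hf : MemL1t T ∞ f)
    (hfL : MemLip (Set.Icc (0 : ℝ) 1 ×ˢ Set.Icc (0 : ℝ) T) s 2 fun z : ℝ × ℝ => f z.2 z.1) :
    ∃ C > 0, ∀ u : ℝ → Lp ℝ 1 leb, IsSolution p T K g f u →
      ∀ ρ > 0, ∀ β : ℝ, ∀ n : ℕ, 0 < n →
      ∀ (N : ℕ) (t : Fin (N + 1) → ℝ), IsPartition T t → mesh t ≤ 1 →
      ∀ (Ω : Type*) [MeasurableSpace Ω] (P : Measure Ω) [IsProbabilityMeasure P]
        (G : Ω → Fin n → Fin n → Prop), IsRandomGraph P n K ρ G → ∀ α ≤ 1,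
        1 - (ρ * n) ^ (-(1 - β)) ≤
          P.real (errorEvent p n ρ G g f t u (rateBound T K C s α β n ρ t)) := by
  obtain ⟨c, hc, h⟩ := Regime.c.exists_error_bound hp hT hK hBV ⟨hg, hf⟩
  obtain ⟨C, hC⟩ := exists_source_bound hT hBV
  obtain ⟨V, hV, hfV⟩ := hBV.exists_monotone hT
  obtain ⟨Ag, hAg, hg'⟩ := hgL.exists_inj_proj_rate
  obtain ⟨AK, hAK, hK'⟩ := hKL.exists_kernelErr_rate hK.measurable
  obtain ⟨Af, hAf, hf'⟩ := hfL.exists_source_rate hT hBV.1 hC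
  have hV0 : 0 ≤ V T - V 0 := sub_nonneg.2 (hV ⟨le_rfl, hT.le⟩ ⟨hT.le, le_rfl⟩ hT.le)
  set S := T ^ (1 / 2 : ℝ) with hS_def
  have hS : 0 < S := by positivity
  -- the approximation of `g`, `f` and `K` contributes to `D` for the term in `n ^ (-s)`;
  -- the rest of `D` absorbs the terms carrying the factor `S`
  set D := Ag + Af + c * AK + (c + (V T - V 0)) / S with hD
  have hD0 : 0 < D := by positivity
  have hcS : c / S ≤ D := by
    have : 0 ≤ (V T - V 0) / S := by positivity
    have : 0 ≤ c * AK := by positivity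
    rw [hD, add_div]; linarith
  have hcV : (c + (V T - V 0)) / S ≤ D := by
    have : 0 ≤ c * AK := by positivity
    linarith
  refine ⟨D, hD0, ?_⟩
  intro u hu ρ hρ β n hn N t ht hm Ω _ P _ G hG α hα
  refine h u hu ρ hρ β n hn N t ht Ω P G hG _ ?_
  have hn' : (0 : ℝ) < n := by exact_mod_cast hn
  have hm0 := ht.mesh_nonneg
  have hmα := ht.mesh_le_rpow hm hα
  have hmα0 : 0 ≤ mesh t ^ α := hm0.trans hmα
  have hexp : (1 : ℝ) ≤ Real.exp (T / 2) := Real.one_le_exp (by positivity)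
  set a := (n : ℝ) ^ (-s) with ha
  have ha0 : 0 ≤ a := by positivity
  set x := (ρ * n) ^ (-(β / 2)) with hx_def
  have hx : 0 ≤ x := by positivity
  set kE := normL2sq (kernelExcess ρ K)
  have hsrc := (sum_lintegral_gridSource_sub_le hn hBV.1 hC hV hfV ht.isGrid
    (gridOf_sub_le_mesh t)).trans (add_le_add_left (hf' n hn) _)
  have hle : rateBound T K D s α β n ρ t ≥ ENNReal.ofReal D *
      (ENNReal.ofReal ((1 + S) * a) + ENNReal.ofReal S * kE + ENNReal.ofReal (S * x) +
        ENNReal.ofReal (S * mesh t ^ α)) := by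
    rw [rateBound]
    refine mul_le_mul_left (ENNReal.ofReal_le_ofReal ?_) _
    exact le_mul_of_one_le_right hD0.le hexp
  refine le_trans ?_ hle
  have b1 : ENNReal.ofReal (Ag * a) + ENNReal.ofReal (Af * a) +
      ENNReal.ofReal c * ENNReal.ofReal (AK * a) ≤
      ENNReal.ofReal D * ENNReal.ofReal ((1 + S) * a) := by
    rw [← ENNReal.ofReal_mul hc.le, ← ENNReal.ofReal_add (by positivity) (by positivity),
      ← ENNReal.ofReal_add (by positivity) (by positivity), ← ENNReal.ofReal_mul hD0.le]
    refine ENNReal.ofReal_le_ofReal ?_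
    have h1 : Ag + Af + c * AK ≤ D := by
      have : 0 ≤ (c + (V T - V 0)) / S := by positivity
      linarith
    have h2 : (Ag + Af + c * AK) * a ≤ D * a := mul_le_mul_of_nonneg_right h1 ha0
    have h3 : 0 ≤ D * (S * a) := by positivity
    nlinarith
  have b2 : ENNReal.ofReal c * kE ≤ ENNReal.ofReal D * (ENNReal.ofReal S * kE) := by
    rw [← mul_assoc, ← ENNReal.ofReal_mul hD0.le]
    exact mul_le_mul_left (ENNReal.ofReal_le_ofReal ((div_le_iff₀ hS).1 hcS)) _
  have b3 : ENNReal.ofReal (c * x) ≤ ENNReal.ofReal D * ENNReal.ofReal (S * x) := by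
    rw [← ENNReal.ofReal_mul hD0.le, ← mul_assoc]
    exact ENNReal.ofReal_le_ofReal (mul_le_mul_of_nonneg_right ((div_le_iff₀ hS).1 hcS) hx)
  have b4 : ENNReal.ofReal (mesh t * (V T - V 0)) + ENNReal.ofReal c * ENNReal.ofReal (mesh t) ≤
      ENNReal.ofReal D * ENNReal.ofReal (S * mesh t ^ α) := by
    rw [← ENNReal.ofReal_mul hc.le, ← ENNReal.ofReal_add (by positivity) (by positivity),
      ← ENNReal.ofReal_mul hD0.le, ← mul_assoc]
    refine ENNReal.ofReal_le_ofReal ?_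
    calc _ = (c + (V T - V 0)) * mesh t := by ring
      _ ≤ (D * S) * mesh t ^ α :=
        mul_le_mul ((div_le_iff₀ hS).1 hcV) hmα hm0 (by positivity)
  calc _ ≤ ENNReal.ofReal (Ag * a) +
        (ENNReal.ofReal (Af * a) + ENNReal.ofReal (mesh t * (V T - V 0))) +
        ENNReal.ofReal (c * x) +
        ENNReal.ofReal c * (ENNReal.ofReal (mesh t) + kE + ENNReal.ofReal (AK * a)) := by
        refine add_le_add (add_le_add (add_le_add (hg' n hn) hsrc) le_rfl) ?_
        exact mul_le_mul_right (add_le_add le_rfl (hK' n hn)) _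
    _ = (ENNReal.ofReal (Ag * a) + ENNReal.ofReal (Af * a) +
          ENNReal.ofReal c * ENNReal.ofReal (AK * a)) + ENNReal.ofReal c * kE +
          ENNReal.ofReal (c * x) + (ENNReal.ofReal (mesh t * (V T - V 0)) +
          ENNReal.ofReal c * ENNReal.ofReal (mesh t)) := by ring
    _ ≤ _ := by
        rw [mul_add, mul_add, mul_add]
        exact add_le_add (add_le_add (add_le_add b1 b2) b3) b4

end PLap

theorem mainTheorem2 (p T : ℝ) (hp : 1 < p) (hT : 0 < T)
    (K : ℝ → ℝ → ℝ) (hK : PLap.IsKernel K)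
    (g : ℝ → ℝ) (f : ℝ → ℝ → ℝ) (hBV : PLap.MemBV T 2 f) :
    -- the general error bound
    (∀ R : PLap.Regime, R.Holds p T g f →
      ∃ C > 0, ∃ τ₀ > 0, ∀ u : ℝ → Lp ℝ 1 PLap.leb, PLap.IsSolution p T K g f u →
        ∀ ρ : ℕ → ℝ, PLap.IsSparsity ρ → ∀ β ∈ Set.Ioo (0 : ℝ) 1, ∀ n : ℕ, 1 ≤ n →
        ∀ (N : ℕ) (t : Fin (N + 1) → ℝ), PLap.IsPartition T t → PLap.mesh t ≤ τ₀ →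
        ∀ (Ω : Type*) [MeasurableSpace Ω] (P : Measure Ω) [IsProbabilityMeasure P]
          (G : Ω → Fin n → Fin n → Prop), PLap.IsRandomGraph P n K (ρ n) G →
          1 - (ρ n * n) ^ (-(1 - β)) ≤
            P.real (PLap.errorEvent p n (ρ n) G g f t u
              (PLap.generalBound R p T K g f C β n (ρ n) t))) ∧
    -- the rate for data in Lipschitz spaces
    (∀ s ∈ Set.Ioc (0 : ℝ) 1,
      MemLp g ∞ PLap.leb → PLap.MemLip (Set.Icc (0 : ℝ) 1) s 2 g →
      PLap.MemLip (Set.Icc (0 : ℝ) 1 ×ˢ Set.Icc (0 : ℝ) 1) s 2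
        (fun z : ℝ × ℝ => K z.1 z.2) →
      PLap.MemL1t T ∞ f →
      PLap.MemLip (Set.Icc (0 : ℝ) 1 ×ˢ Set.Icc (0 : ℝ) T) s 2
        (fun z : ℝ × ℝ => f z.2 z.1) →
      (∀ ρ : ℕ → ℝ, PLap.IsSparsity ρ →
        Tendsto (fun n => PLap.normL2sq (PLap.kernelExcess (ρ n) K)) atTop (𝓝 0)) ∧
      ∃ C > 0, ∃ τ₀ > 0, ∀ u : ℝ → Lp ℝ 1 PLap.leb, PLap.IsSolution p T K g f u →
        ∀ ρ : ℕ → ℝ, PLap.IsSparsity ρ → ∀ β ∈ Set.Ioo (0 : ℝ) 1, ∀ n : ℕ, 1 ≤ n →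
        ∀ (N : ℕ) (t : Fin (N + 1) → ℝ), PLap.IsPartition T t → PLap.mesh t ≤ τ₀ →
        ∀ (Ω : Type*) [MeasurableSpace Ω] (P : Measure Ω) [IsProbabilityMeasure P]
          (G : Ω → Fin n → Fin n → Prop), PLap.IsRandomGraph P n K (ρ n) G →
          1 - (ρ n * n) ^ (-(1 - β)) ≤
            P.real (PLap.errorEvent p n (ρ n) G g f t u
              (PLap.rateBound T K C s (PLap.rateExponent p s) β n (ρ n) t)) ∧
          -- for a time-independent source the power `τ ^ s` disappears
          ((∀ r ∈ Set.Icc 0 T, f r =ᵐ[PLap.leb] f 0) →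
            1 - (ρ n * n) ^ (-(1 - β)) ≤
              P.real (PLap.errorEvent p n (ρ n) G g f t u
                (PLap.rateBound T K C s (PLap.Regime.c.exponent p) β n (ρ n) t)))) := by
  refine ⟨fun R hR => ?_, fun s hs hg hgL hKL hf hfL =>
    ⟨fun ρ hρ => PLap.tendsto_normL2sq_kernelExcess hK hρ, ?_⟩⟩
  · obtain ⟨C, hC, h⟩ := R.exists_generalBound hp hT hK hBV hR
    exact ⟨C, hC, 1, one_pos, fun u hu ρ hρ β _ n hn N t ht hm Ω _ P _ G hG =>
      h u hu (ρ n) (hρ.pos n hn) β n hn N t ht hm Ω P G hG⟩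
  · obtain ⟨C, hC, h⟩ := PLap.exists_rateBound hp hT hK hBV hg hgL hKL hf hfL
    exact ⟨C, hC, 1, one_pos, fun u hu ρ hρ β _ n hn N t ht hm Ω _ P _ G hG =>
      ⟨h u hu (ρ n) (hρ.pos n hn) β n hn N t ht hm Ω P G hG _ (PLap.rateExponent_le_one hs.2),
        fun _ => h u hu (ρ n) (hρ.pos n hn) β n hn N t ht hm Ω P G hG _
          (PLap.Regime.c.exponent_le_one hp ⟨hg, hf⟩)⟩⟩
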